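/- Let $p\ge 2$ be an integer, $M_p,\Delta_0,\varepsilon>0$, $n\in\mathbb N$, $x_0\in\mathbb R^n$ (Euclidean norm $\|\cdot\|$), and let $f:\mathbb R^n\to\mathbb R$ be convex and $p$ times differentiable with $\|\nabla^pf(x)-\nabla^pf(y)\|\le M_p\|x-y\|$ for all $x,y$ (operator norm of $p$-linear forms), bounded below, with $f(x_0)-f^*\le\Delta_0$, where $f^*=\inf f$. *Tensor step.* For $M\ge 0$, $T^{g}_{p,M}(x)$ denotes a global minimizer over $y$ of $\sum_{r=0}^p\frac1{r!}\nabla^rg(x)[y-x,\dots,y-x]+\frac{M}{(p+1)!}\|y-x\|^{p+1}$. *Algorithm 1* (applied to $g$ from $z$, for $N$ steps). Put $A_0=0$, $y^0=u^0=z$. For $k=0,\dots,N-1$ choose $L_k>0$ such that $$\tfrac12\le\frac{2(p+1)M_p}{p!\,L_k}\|y^{k+1}-x^k\|^{p-1}\le1,$$ where $a_{k+1}=\frac12\Big(\frac1{L_k}+\sqrt{\frac1{L_k^2}+\frac{4A_k}{L_k}}\Big)$, $A_{k+1}=A_k+a_{k+1}$, $x^k=\frac{A_k}{A_{k+1}}y^k+\frac{a_{k+1}}{A_{k+1}}u^k$,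 $y^{k+1}=T^{F}_{p,pM_p}(x^k)$ with $F(x)=g(x)+\frac{L_k}2\|x-x^k\|^2$; and set $u^{k+1}=u^k-a_{k+1}\nabla g(y^{k+1})$. The output is $y^N$. *Algorithm 2.* Put $\mu=\frac{\varepsilon^2}{32\Delta_0}$, $f_\mu(x)=f(x)+\frac\mu2\|x-x_0\|^2$, $\tilde\varepsilon=\frac{(\varepsilon/2)^{(p+1)/p}}{8(pM_p)^{1/p}(p+1)!}$, $\Delta_k=\Delta_02^{-k}$, $c=2^{(3(p+1)^2+4)/4}(p+1)/p!$, $z_0=x_0$, $k=0$. While $\Delta_k\ge\tilde\varepsilon$: let $z_{k+1}$ be the output of Algorithm 1 applied to $f_\mu$ from $z_k$ for $$N_k=\max\left\{\left\lceil\left(\frac{2cM_p2^{(p+1)/2}}{\mu^{(p+1)/2}}\Delta_k^{(p-1)/2}\right)^{2/(3p+1)}\right\rceil,1\right\}$$ steps, and replace $k$ by $k+1$. When the loop ends, output $\tilde z=T^{f_\mu}_{p,pM_p}(z_k)$. Put $$B(\varepsilon)=\frac{M_p^{\frac2{3p+1}}\Delta_0^{\frac{2p}{3p+1}}}{\varepsilon^{\frac{2(p+1)}{3p+1}}}+\max\left\{0,\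 \log_2\frac{2^{\frac{4p+1}p}\Delta_0(pM_p)^{\frac1p}(p+1)!}{\varepsilon^{\frac{p+1}p}}\right\}.$$ **Theorem.** (i) There is a constant $C$ depending only on $p$ such that, for all data as above, every complete execution of Algorithm 2 (with any admissible choices of the $L_k$ and of the minimizers) outputs a point with $\|\nabla f(\tilde z)\|\le\varepsilon$ and makes at most $C\,B(\varepsilon)$ iterations of Algorithm 1 in total. (ii) For all $M_p,\Delta_0>0$ there is a constant $C'$ depending only on $p,M_p,\Delta_0$ such that, for all $\varepsilon\in(0,\frac12]$, $n$ and $x_0$, there is an adaptive deterministic procedure, not depending on $f$, which has access to $f$ only through an oracle returning $f(x),\nabla f(x),\dots,\nabla^pf(x)$ at a queried point $x$, and which for every $f$ as above carries out Algorithm 2, including the choice of the $L_k$, with at most $C'\ln(1/\varepsilon)\,B(\varepsilon)$ oracle calls. Here the procedure returns a record of the execution, which is either a complete execution of Algorithm 2, or an execution interrupted while searching for some $L_k$ because the trial point $y^{k+1}$ computed for some trial value $L>0$ of $L_k$ satisfies $\|\nabla f(y^{k+1})\|\le\varepsilon$; that trial point is then the output. In either case the output point has gradient norm of $f$ at most $\varepsilon$.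 -/

import Mathlib

open scoped Nat

/-! ### The problem class -/

/-- The Euclidean space `ℝⁿ` with its standard inner product and norm. -/
abbrev Euc (n : ℕ) : Type := EuclideanSpace ℝ (Fin n)

/-- `f : ℝⁿ → ℝ` is convex, `p` times differentiable with `M`-Lipschitz `p`-th derivative
(multilinear operator norm), bounded below, and `f x₀ - f* ≤ Δ₀` where `f* = inf f`.
(Since the `p`-th derivative is Lipschitz, hence continuous, `ContDiff` loses nothing.) -/
structure IsProblem (p : ℕ) (M Δ₀ : ℝ) {n : ℕ} (x₀ : Euc n) (f : Euc n → ℝ) : Prop where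
  convex : ConvexOn ℝ Set.univ f
  contDiff : ContDiff ℝ p f
  lipschitz : ∀ x y : Euc n,
    ‖iteratedFDeriv ℝ p f x - iteratedFDeriv ℝ p f y‖ ≤ M * ‖x - y‖
  bddBelow : BddBelow (Set.range f)
  gap : f x₀ - (⨅ x, f x) ≤ Δ₀

/-! ### Tensor steps -/

/-- The regularized Taylor model
`∑_{r ≤ p} (1/r!) ∇ʳf(x)[y - x, …, y - x] + M/(p+1)! ‖y - x‖^(p+1)`. -/
noncomputable def tensorModel (p : ℕ) (M : ℝ) {n : ℕ} (f : Euc n → ℝ) (x y : Euc n) : ℝ :=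
  (∑ r ∈ Finset.range (p + 1), (1 / (r ! : ℝ)) * iteratedFDeriv ℝ r f x (fun _ => y - x))
    + M / ((p + 1)! : ℝ) * ‖y - x‖ ^ (p + 1)

/-- `y` is a value of the tensor step `T_{p,M}^f(x)`: a global minimizer of the model at `x`. -/
def IsTensorStep (p : ℕ) (M : ℝ) {n : ℕ} (f : Euc n → ℝ) (x y : Euc n) : Prop :=
  IsMinOn (tensorModel p M f x) Set.univ y

/-- `f(x) + (L/2) ‖x - z‖²`. With `z = xᵏ` this is `F_{L,xᵏ}`, with `L = μ`, `z = x₀`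
it is the regularized objective `f_μ`. -/
noncomputable def addQuad {n : ℕ} (f : Euc n → ℝ) (L : ℝ) (z : Euc n) (x : Euc n) : ℝ :=
  f x + L / 2 * ‖x - z‖ ^ 2

/-! ### The inner method (near-optimal tensor method) -/

/-- The step weight `a` determined by `A_k = A` and `L_k = L`. -/
noncomputable def stepWeight (A L : ℝ) : ℝ :=
  (1 / L + Real.sqrt (1 / L ^ 2 + 4 * A / L)) / 2

/-- The extrapolated point `x = A/(A+a) y + a/(A+a) u` determined by `A, L, y, u`. -/
noncomputable def extrapolate {n : ℕ} (A L : ℝ) (y u : Euc n) : Euc n :=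
  (A / (A + stepWeight A L)) • y + (stepWeight A L / (A + stepWeight A L)) • u

/-- Data of an execution of the inner method: the sequences `L_k, A_k, y^k, u^k`. -/
structure InnerTrace (n : ℕ) where
  L : ℕ → ℝ
  A : ℕ → ℝ
  y : ℕ → Euc n
  u : ℕ → Euc n

/-- `y'` is the trial point that the inner method, applied to `g`, computes
at iteration `k` for the trial value `L`. -/
def InnerTrace.IsTrial {n : ℕ} (t : InnerTrace n) (p : ℕ) (M : ℝ) (g : Euc n → ℝ)
    (k : ℕ) (L : ℝ) (y' : Euc n) : Prop :=
  IsTensorStep p (p * M) (addQuad g L (extrapolate (t.A k) L (t.y k) (t.u k)))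
    (extrapolate (t.A k) L (t.y k) (t.u k)) y'

/-- Iteration `k` of the inner method applied to `g`. -/
structure InnerTrace.IsStep {n : ℕ} (t : InnerTrace n) (p : ℕ) (M : ℝ) (g : Euc n → ℝ)
    (k : ℕ) : Prop where
  L_pos : 0 < t.L k
  A_succ : t.A (k + 1) = t.A k + stepWeight (t.A k) (t.L k)
  y_succ : t.IsTrial p M g k (t.L k) (t.y (k + 1))
  lower : 1 / 2 ≤ 2 * (p + 1) * M / (p ! * t.L k)
    * ‖t.y (k + 1) - extrapolate (t.A k) (t.L k) (t.y k) (t.u k)‖ ^ (p - 1)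
  upper : 2 * (p + 1) * M / (p ! * t.L k)
    * ‖t.y (k + 1) - extrapolate (t.A k) (t.L k) (t.y k) (t.u k)‖ ^ (p - 1) ≤ 1
  u_succ : t.u (k + 1) = t.u k - stepWeight (t.A k) (t.L k) • gradient g (t.y (k + 1))

/-- The first `N` iterations of `t` are an execution of the inner method
applied to `g` and started from `z`. -/
structure InnerTrace.IsRun {n : ℕ} (t : InnerTrace n) (p : ℕ) (M : ℝ) (g : Euc n → ℝ)
    (z : Euc n) (N : ℕ) : Prop where
  A_zero : t.A 0 = 0
  y_zero : t.y 0 = z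
  u_zero : t.u 0 = z
  step : ∀ k < N, t.IsStep p M g k

/-! ### The outer method (regularization and restarts) -/

/-- `μ = ε² / (32 Δ₀)`. -/
noncomputable def regParam (Δ₀ ε : ℝ) : ℝ := ε ^ 2 / (32 * Δ₀)

/-- `ε̃ = (ε/2)^((p+1)/p) / (8 (p M)^(1/p) (p+1)!)`. -/
noncomputable def innerTol (p : ℕ) (M ε : ℝ) : ℝ :=
  (ε / 2) ^ (((p : ℝ) + 1) / p) / (8 * (p * M) ^ (1 / (p : ℝ)) * ((p + 1)! : ℝ))

/-- `c = 2^((3(p+1)²+4)/4) (p+1) / p!`. -/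
noncomputable def rateConst (p : ℕ) : ℝ :=
  (2 : ℝ) ^ ((3 * ((p : ℝ) + 1) ^ 2 + 4) / 4) * (p + 1) / (p ! : ℝ)

/-- `Δ_k = Δ₀ 2^(-k)`. -/
noncomputable def residualBound (Δ₀ : ℝ) (k : ℕ) : ℝ := Δ₀ / 2 ^ k

/-- `N_k = max {⌈(2 c M 2^((p+1)/2) / μ^((p+1)/2) · Δ_k^((p-1)/2))^(2/(3p+1))⌉, 1}`. -/
noncomputable def phaseLength (p : ℕ) (M Δ₀ ε : ℝ) (k : ℕ) : ℕ :=
  max ⌈(2 * rateConst p * M * (2 : ℝ) ^ (((p : ℝ) + 1) / 2)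
      / regParam Δ₀ ε ^ (((p : ℝ) + 1) / 2)
      * residualBound Δ₀ k ^ (((p : ℝ) - 1) / 2)) ^ (2 / (3 * (p : ℝ) + 1))⌉₊ 1

/-- Data of an execution of the outer method: the number of completed phases (passes through
the `while` loop), the points `z_k`, the executions of the inner method in the
phases, and the output point. -/
structure OuterTrace (n : ℕ) where
  phases : ℕ
  z : ℕ → Euc n
  inner : ℕ → InnerTrace n
  output : Euc n

/-- The first `t.phases` passes through the `while` loop are executed as prescribed. -/
structure OuterTrace.IsLoop {n : ℕ} (t : OuterTrace n) (p : ℕ) (M Δ₀ ε : ℝ)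
    (x₀ : Euc n) (f : Euc n → ℝ) : Prop where
  z_zero : t.z 0 = x₀
  continues : ∀ k < t.phases, innerTol p M ε ≤ residualBound Δ₀ k
  phase : ∀ k < t.phases,
    (t.inner k).IsRun p M (addQuad f (regParam Δ₀ ε) x₀) (t.z k) (phaseLength p M Δ₀ ε k)
  z_succ : ∀ k < t.phases, t.z (k + 1) = (t.inner k).y (phaseLength p M Δ₀ ε k)

/-- `t` is a complete execution of the outer method: the loop is left at the first `k` with
`Δ_k < ε̃`, and the output is a tensor step for `f_μ` from the last `z_k`. -/
structure OuterTrace.IsRun {n : ℕ} (t : OuterTrace n) (p : ℕ) (M Δ₀ ε : ℝ)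
    (x₀ : Euc n) (f : Euc n → ℝ) : Prop where
  loop : t.IsLoop p M Δ₀ ε x₀ f
  stops : residualBound Δ₀ t.phases < innerTol p M ε
  final : IsTensorStep p (p * M) (addQuad f (regParam Δ₀ ε) x₀) (t.z t.phases) t.output

/-- `t` is an execution of the outer method that is interrupted during the search for `L_j` at
some iteration `j` of the inner method in the current phase, because the trial point of some
trial value `L > 0` already has `‖∇f‖ ≤ ε`; this trial point is the output. -/
structure OuterTrace.IsStoppedRun {n : ℕ} (t : OuterTrace n) (p : ℕ) (M Δ₀ ε : ℝ)
    (x₀ : Euc n) (f : Euc n → ℝ) : Prop where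
  loop : t.IsLoop p M Δ₀ ε x₀ f
  continues : innerTol p M ε ≤ residualBound Δ₀ t.phases
  trial : ∃ j < phaseLength p M Δ₀ ε t.phases,
    (t.inner t.phases).IsRun p M (addQuad f (regParam Δ₀ ε) x₀) (t.z t.phases) j ∧
    ∃ L : ℝ, 0 < L ∧
      (t.inner t.phases).IsTrial p M (addQuad f (regParam Δ₀ ε) x₀) j L t.output
  small : ‖gradient f t.output‖ ≤ ε

/-- Total number of iterations of the inner method in a complete execution. -/
noncomputable def OuterTrace.iterations {n : ℕ} (t : OuterTrace n) (p : ℕ) (M Δ₀ ε : ℝ) : ℕ :=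
  ∑ k ∈ Finset.range t.phases, phaseLength p M Δ₀ ε k

/-- `M^(2/(3p+1)) Δ₀^(2p/(3p+1)) / ε^(2(p+1)/(3p+1))
  + max {0, log₂ (2^((4p+1)/p) Δ₀ (pM)^(1/p) (p+1)! / ε^((p+1)/p))}`. -/
noncomputable def iterationBound (p : ℕ) (M Δ₀ ε : ℝ) : ℝ :=
  M ^ (2 / (3 * (p : ℝ) + 1)) / ε ^ (2 * ((p : ℝ) + 1) / (3 * (p : ℝ) + 1))
      * Δ₀ ^ (2 * (p : ℝ) / (3 * (p : ℝ) + 1))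
    + max 0 (Real.logb 2 ((2 : ℝ) ^ ((4 * (p : ℝ) + 1) / p) * Δ₀ * (p * M) ^ (1 / (p : ℝ))
      * ((p + 1)! : ℝ) / ε ^ (((p : ℝ) + 1) / p)))

/-! ### Oracle complexity -/

/-- The answer of a `p`-th order oracle at a point: the value and the derivatives of
orders `0, …, p`. -/
abbrev Jet (p n : ℕ) : Type :=
  (r : Fin (p + 1)) → ContinuousMultilinearMap ℝ (fun _ : Fin (r : ℕ) => Euc n) ℝ

/-- The `p`-th order oracle of `f`. -/
noncomputable def oracle (p : ℕ) {n : ℕ} (f : Euc n → ℝ) (x : Euc n) : Jet p n :=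
  fun r => iteratedFDeriv ℝ (r : ℕ) f x

/-- Adaptive deterministic procedures in the information-based (black-box) model: a procedure
either returns a result or asks the oracle at a point and continues depending on the answer.
Only oracle calls are counted. -/
inductive OracleProgram (Q A R : Type) : Type where
  | done (result : R) : OracleProgram Q A R
  | ask (query : Q) (next : A → OracleProgram Q A R) : OracleProgram Q A R

/-- The result of a procedure for the oracle `O`. -/
def OracleProgram.result {Q A R : Type} (O : Q → A) : OracleProgram Q A R → R
  | .done r => r
  | .ask q next => (next (O q)).result O

/-- The number of oracle calls of a procedure for the oracle `O`. -/
def OracleProgram.calls {Q A R : Type} (O : Q → A) : OracleProgram Q A R → ℕ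
  | .done _ => 0
  | .ask q next => (next (O q)).calls O + 1

/-! ### Taylor expansion of functions with Lipschitz `p`-th derivative -/

section Taylor

variable {E F : Type*} [NormedAddCommGroup E] [NormedSpace ℝ E] [NormedAddCommGroup F]
  [NormedSpace ℝ F]

/-! Part (i). The Taylor model with regularization weight `pM` dominates the function and is convex.
The inner method is an inexact accelerated proximal point method: the upper condition on `L_k` makes
`y^{k+1}` a proximal point of `g` up to relative error 1/2. With `h_j` the step lengths, the
potential `A_k (g(y^k) - g*) + ½‖u^k - x*‖² + (3/8) Σ_{j<k} A_{j+1} L_j h_j²` therefore does not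
increase (`potential_step`). The lower condition gives `L_j ≤ κ h_j^{p-1}`. Combined by Hölder's
inequality with the bounded sum in the potential, it forces `A_N` to grow at least like
`N^{(3p+1)/2}` (`growth_bound`), so the residual decays at this rate.

The function `f_μ` grows quadratically around its minimizer, so a small residual means a small
distance, and a phase of `N_k` steps halves the residual bound (`phase_halves`). Once the residual
is below `ε̃`, a last tensor step converts it into a small gradient of `f_μ`
(`HasLipschitzDeriv.norm_fderiv_rpow_le`), and `μ` is so small that the quadratic changes the
gradient by at most `ε/2`. The `N_k` decay geometrically up to rounding, so their sum is of the
order of the main term plus the number of phases (`exists_sum_phaseLength_le`).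

Part (ii). With `c = 2(p+1)M/p!` and `h` the length of the trial step, a trial value `L` is called
long if `L < c h^{p-1}` and short if `2c h^{p-1} < L`; otherwise it is admissible. A sufficiently
large `U` is always short. If the small value `ℓ` is short, its trial point already has gradient at
most `ε`, and the search is interrupted. If `ℓ` is long, bisection on `[ℓ, U]` applies. Convexity of
the models makes the trial point Hölder continuous in `L`, so a long value and a larger short one
are more than `δ` apart (`IsSearchBound.gap`), and the bisection must hit an admissible value before
its interval shrinks to length `δ`. All parameters are polynomial in `1/ε`, which bounds the number
of bisections by `O(ln(1/ε))`. The procedure is assembled in terms of `Solvable`: along each branch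
one keeps the class of functions consistent with the answers so far. -/

lemma iteratedFDeriv_add_two_apply {f : E → F} {n : ℕ} (hf : ContDiff ℝ (n + 2 : ℕ) f) (x : E)
    (v : Fin (n + 2) → E) :
    iteratedFDeriv ℝ (n + 2) f x v
      = (fderiv ℝ (fderiv ℝ (iteratedFDeriv ℝ n f)) x (v 0)) (v 1) (fun i => v i.succ.succ) := by
  have h1 : DifferentiableAt ℝ (fderiv ℝ (iteratedFDeriv ℝ n f)) x := by
    have : ContDiff ℝ 2 (iteratedFDeriv ℝ n f) := by
      refine hf.iteratedFDeriv_right (m := 2) ?_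
      push_cast; rw [add_comm]
    exact ((this.fderiv_right (m := 1) (by norm_num)).differentiable (by norm_num)) x
  have hd : Differentiable ℝ (iteratedFDeriv ℝ (n + 1) f) :=
    hf.differentiable_iteratedFDeriv (by exact_mod_cast Nat.lt_succ_self _)
  have h2 : iteratedFDeriv ℝ (n + 1 + 1) f x v
      = fderiv ℝ (fun y => iteratedFDeriv ℝ (n + 1) f y (Fin.tail v)) x (v 0) := by
    rw [iteratedFDeriv_succ_apply_left,
      ((hd x).hasFDerivAt.continuousMultilinear_apply_const (Fin.tail v)).fderiv]
    rfl
  have h3 : (fun y => iteratedFDeriv ℝ (n + 1) f y (Fin.tail v))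
      = fun y => fderiv ℝ (iteratedFDeriv ℝ n f) y (v 1) (fun i => v i.succ.succ) := by
    ext1 y
    rw [iteratedFDeriv_succ_apply_left]
    rfl
  have h4 : HasFDerivAt (fun y => fderiv ℝ (iteratedFDeriv ℝ n f) y (v 1))
      ((fderiv ℝ (fderiv ℝ (iteratedFDeriv ℝ n f)) x).flip (v 1)) x := by
    simpa using h1.hasFDerivAt.clm_apply (hasFDerivAt_const (v 1) x)
  rw [h2, h3, (h4.continuousMultilinear_apply_const _).fderiv]
  rfl

/-- Exchanging the first two arguments is the symmetry of the second derivative of a lower iterated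
derivative. An exchange further right affects only the tail, to which the induction hypothesis
applies before the last differentiation. -/
lemma iteratedFDeriv_comp_swap {f : E → F} : ∀ {n : ℕ} (_ : ContDiff ℝ (n + 1 : ℕ) f) (x : E)
    (v : Fin (n + 1) → E) (i : Fin n),
    iteratedFDeriv ℝ (n + 1) f x (v ∘ Equiv.swap i.castSucc i.succ)
      = iteratedFDeriv ℝ (n + 1) f x v := by
  intro n
  induction n with
  | zero => intro _ _ _ i; exact i.elim0
  | succ n ih =>
    intro hf x v i
    refine Fin.cases ?_ (fun j => ?_) i
    · have hsymm : IsSymmSndFDerivAt ℝ (iteratedFDeriv ℝ n f) x := by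
        have : ContDiff ℝ 2 (iteratedFDeriv ℝ n f) := by
          refine hf.iteratedFDeriv_right (m := 2) ?_
          push_cast; rw [add_comm, add_assoc]; norm_num
        exact this.contDiffAt.isSymmSndFDerivAt (by simp)
      rw [iteratedFDeriv_add_two_apply hf, iteratedFDeriv_add_two_apply hf]
      have e0 : (v ∘ Equiv.swap (Fin.castSucc (0 : Fin (n + 1))) (Fin.succ 0)) 0 = v 1 := by simp
      have e1 : (v ∘ Equiv.swap (Fin.castSucc (0 : Fin (n + 1))) (Fin.succ 0)) 1 = v 0 := by simp
      have e2 : (fun k : Fin n => (v ∘ Equiv.swap (Fin.castSucc (0 : Fin (n + 1))) (Fin.succ 0))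
          k.succ.succ) = fun k => v k.succ.succ := by
        ext1 k
        rw [Function.comp_apply, Equiv.swap_apply_of_ne_of_ne]
        · simp [Fin.ext_iff]
        · simp [Fin.ext_iff]
      rw [e0, e1, e2, hsymm]
    · have hd : Differentiable ℝ (iteratedFDeriv ℝ (n + 1) f) :=
        hf.differentiable_iteratedFDeriv (by exact_mod_cast Nat.lt_succ_self _)
      have hf' : ContDiff ℝ (n + 1 : ℕ) f := hf.of_le (by exact_mod_cast Nat.le_succ _)
      have key : ∀ w : Fin (n + 2) → E, iteratedFDeriv ℝ (n + 1 + 1) f x w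
          = fderiv ℝ (fun y => iteratedFDeriv ℝ (n + 1) f y (Fin.tail w)) x (w 0) := by
        intro w
        rw [iteratedFDeriv_succ_apply_left]
        have := (hd x).hasFDerivAt.continuousMultilinear_apply_const (Fin.tail w)
        rw [this.fderiv]; rfl
      rw [key, key]
      have e0 : (v ∘ Equiv.swap (Fin.castSucc j.succ) (Fin.succ j.succ)) 0 = v 0 := by
        rw [Function.comp_apply, Equiv.swap_apply_of_ne_of_ne]
        · simp [Fin.ext_iff]
        · simp [Fin.ext_iff]
      have et : Fin.tail (v ∘ Equiv.swap (Fin.castSucc j.succ) (Fin.succ j.succ))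
          = Fin.tail v ∘ Equiv.swap j.castSucc j.succ := by
        ext1 k
        simp only [Fin.tail, Function.comp_apply]
        congr 1
        rw [Fin.castSucc_succ, ← (Fin.succ_injective _).map_swap]
      rw [e0, et]
      congr 2
      ext1 y
      exact ih hf' y _ j

lemma iteratedFDeriv_comp_perm_of_contDiff {f : E → F} {n : ℕ} (hf : ContDiff ℝ n f) (x : E)
    (v : Fin n → E) (σ : Equiv.Perm (Fin n)) :
    iteratedFDeriv ℝ n f x (v ∘ σ) = iteratedFDeriv ℝ n f x v := by
  cases n with
  | zero => congr 1; ext1 i; exact i.elim0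
  | succ n =>
    have hσ : σ ∈ Submonoid.closure
        (Set.range fun i : Fin n => Equiv.swap i.castSucc i.succ) := by
      rw [Equiv.Perm.mclosure_swap_castSucc_succ]; trivial
    induction hσ using Submonoid.closure_induction generalizing v with
    | mem τ hτ => obtain ⟨i, rfl⟩ := hτ; exact iteratedFDeriv_comp_swap hf x v i
    | one => rfl
    | mul a b _ _ ha hb =>
      rw [Equiv.Perm.coe_mul, ← Function.comp_assoc, hb, ha]

/-- The Taylor polynomial of order `p` at `x`, evaluated at `y`. -/
noncomputable def taylorPoly (p : ℕ) (f : E → ℝ) (x y : E) : ℝ :=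
  ∑ r ∈ Finset.range (p + 1), (1 / (r ! : ℝ)) * iteratedFDeriv ℝ r f x (fun _ => y - x)

/-- The truncated Taylor series at `x`. -/
noncomputable def truncTaylorSeries (p : ℕ) (f : E → ℝ) (x : E) :
    FormalMultilinearSeries ℝ E ℝ :=
  fun r => if r < p + 1 then (1 / (r ! : ℝ)) • iteratedFDeriv ℝ r f x else 0

lemma hasFiniteFPowerSeriesOnBall_taylorPoly (p : ℕ) (f : E → ℝ) (x : E) :
    HasFiniteFPowerSeriesOnBall (taylorPoly p f x) (truncTaylorSeries p f x) x (p + 1) ⊤ := by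
  refine HasFiniteFPowerSeriesOnBall.mk' ?_ (by simp) ?_
  · intro m hm
    simp [truncTaylorSeries, not_lt.2 hm]
  · intro y _
    refine Finset.sum_congr rfl fun r hr => ?_
    rw [truncTaylorSeries, if_pos (Finset.mem_range.1 hr)]
    simp

lemma contDiff_taylorPoly (p : ℕ) (f : E → ℝ) (x : E) {n : WithTop ℕ∞} :
    ContDiff ℝ n (taylorPoly p f x) := by
  refine ContDiff.sum fun r _ => contDiff_const.mul ?_
  exact (iteratedFDeriv ℝ r f x).contDiff.comp
    (contDiff_pi.2 fun _ => contDiff_id.sub contDiff_const)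

/-- Differentiating the term of degree `r` symmetrizes its coefficient over all permutations. The
derivative of `f` is already symmetric, so the `r!` equal summands cancel the factor `1/r!`. -/
lemma iteratedFDeriv_taylorPoly_self {p r : ℕ} (hr : r ≤ p) {f : E → ℝ} (hf : ContDiff ℝ p f)
    (x : E) : iteratedFDeriv ℝ r (taylorPoly p f x) x = iteratedFDeriv ℝ r f x := by
  ext v
  have hfr : ContDiff ℝ r f := hf.of_le (by exact_mod_cast hr)
  rw [(hasFiniteFPowerSeriesOnBall_taylorPoly p f
    x).toHasFPowerSeriesOnBall.iteratedFDeriv_eq_sum_of_completeSpace]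
  have : ∀ σ : Equiv.Perm (Fin r), (truncTaylorSeries p f x r) (fun i => v (σ i))
      = (1 / (r ! : ℝ)) * iteratedFDeriv ℝ r f x v := by
    intro σ
    rw [truncTaylorSeries, if_pos (Nat.lt_succ_of_le hr), smul_apply,
      smul_eq_mul]
    congr 1
    exact iteratedFDeriv_comp_perm_of_contDiff hfr x v σ
  rw [Finset.sum_congr rfl fun σ _ => this σ, Finset.sum_const, Finset.card_univ,
    Fintype.card_perm, Fintype.card_fin, nsmul_eq_mul]
  field_simp

/-- Re-expanding the finite series around `y` produces no term of degree `p + 1`. -/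
lemma iteratedFDeriv_succ_taylorPoly (p : ℕ) (f : E → ℝ) (x y : E) :
    iteratedFDeriv ℝ (p + 1) (taylorPoly p f x) y = 0 := by
  ext v
  have h := (hasFiniteFPowerSeriesOnBall_taylorPoly p f x).changeOrigin (y := y - x) (by simp)
  rw [add_sub_cancel] at h
  rw [h.toHasFPowerSeriesOnBall.iteratedFDeriv_eq_sum_of_completeSpace, h.finite _ le_rfl]
  simp

lemma iteratedFDeriv_order_taylorPoly {p : ℕ} {f : E → ℝ} (hf : ContDiff ℝ p f)
    (x y : E) : iteratedFDeriv ℝ p (taylorPoly p f x) y = iteratedFDeriv ℝ p f x := by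
  rw [← iteratedFDeriv_taylorPoly_self le_rfl hf]
  refine is_const_of_fderiv_eq_zero (𝕜 := ℝ) ?_ ?_ y x
  · exact (contDiff_taylorPoly p f x (n := (p + 1 : ℕ))).differentiable_iteratedFDeriv
      (by exact_mod_cast Nat.lt_succ_self _)
  · intro z
    rw [← norm_eq_zero, norm_fderiv_iteratedFDeriv, iteratedFDeriv_succ_taylorPoly, norm_zero]

/-- A `C^{r+1}` function on a segment: bound for `D^r` from a bound for `D^{r+1}`. -/
lemma norm_iteratedFDeriv_le_of_succ {R : E → F} {r : ℕ} (hR : ContDiff ℝ (r + 1 : ℕ) R)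
    {x y : E} {B B' : ℝ → ℝ} (hB : ∀ t, HasDerivAt B (B' t) t)
    (h0 : ‖iteratedFDeriv ℝ r R x‖ ≤ B 0)
    (hb : ∀ t ∈ Set.Ico (0 : ℝ) 1,
      ‖iteratedFDeriv ℝ (r + 1) R (x + t • (y - x))‖ * ‖y - x‖ ≤ B' t) :
    ‖iteratedFDeriv ℝ r R y‖ ≤ B 1 := by
  have hd : Differentiable ℝ (iteratedFDeriv ℝ r R) :=
    hR.differentiable_iteratedFDeriv (by exact_mod_cast Nat.lt_succ_self _)
  have hder : ∀ t : ℝ, HasDerivAt (fun t : ℝ => iteratedFDeriv ℝ r R (x + t • (y - x)))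
      (fderiv ℝ (iteratedFDeriv ℝ r R) (x + t • (y - x)) (y - x)) t := by
    intro t
    have h1 : HasDerivAt (fun t : ℝ => x + t • (y - x)) (y - x) t := by
      simpa using ((hasDerivAt_id t).smul_const (y - x)).const_add x
    exact (hd _).hasFDerivAt.comp_hasDerivAt t h1
  have := image_norm_le_of_norm_deriv_right_le_deriv_boundary (a := (0 : ℝ)) (b := 1)
    (f := fun t : ℝ => iteratedFDeriv ℝ r R (x + t • (y - x)))
    (f' := fun t => fderiv ℝ (iteratedFDeriv ℝ r R) (x + t • (y - x)) (y - x))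
    (fun t _ => (hder t).continuousAt.continuousWithinAt)
    (fun t _ => (hder t).hasDerivWithinAt) (by simpa using h0) hB
    (fun t ht => (ContinuousLinearMap.le_opNorm _ _).trans
      (by rw [norm_fderiv_iteratedFDeriv]; exact hb t ht))
    (x := 1) (by simp)
  simpa using this

/-- A function with vanishing derivatives of order `< p` at `x` and
`‖Dᵖ R(y)‖ ≤ M ‖y - x‖` satisfies the corresponding bounds for lower derivatives. -/
lemma norm_iteratedFDeriv_le_of_vanishing {R : E → F} {p : ℕ} {M : ℝ} (hR : ContDiff ℝ p R)
    {x : E} (h0 : ∀ r < p, iteratedFDeriv ℝ r R x = 0)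
    (hM : ∀ y, ‖iteratedFDeriv ℝ p R y‖ ≤ M * ‖y - x‖) :
    ∀ j r : ℕ, r + j = p → ∀ y,
      ‖iteratedFDeriv ℝ r R y‖ ≤ M / ((j + 1)! : ℝ) * ‖y - x‖ ^ (j + 1) := by
  intro j
  induction j with
  | zero => intro r hr y; obtain rfl : r = p := by omega
            simpa using hM y
  | succ j ih =>
    intro r hr y
    have hlt : r < p := by omega
    have hjf : ((j + 1 : ℕ) + 1 : ℝ) ≠ 0 := by positivity
    have hb : ∀ t : ℝ, HasDerivAt
        (fun t : ℝ => M / ((j + 1 + 1)! : ℝ) * ‖y - x‖ ^ (j + 1 + 1) * t ^ (j + 1 + 1))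
        (M / ((j + 1)! : ℝ) * ‖y - x‖ ^ (j + 1 + 1) * t ^ (j + 1)) t := by
      intro t
      refine ((hasDerivAt_pow (j + 1 + 1) t).const_mul
        (M / ((j + 1 + 1)! : ℝ) * ‖y - x‖ ^ (j + 1 + 1))).congr_deriv ?_
      rw [Nat.factorial_succ (j + 1)]
      push_cast
      have : ((j + 1)! : ℝ) ≠ 0 := by positivity
      have : (j : ℝ) + 1 + 1 ≠ 0 := by positivity
      field_simp
    have := norm_iteratedFDeriv_le_of_succ (r := r) (x := x) (y := y)
      (hR.of_le (by exact_mod_cast hlt)) hb (by simp [h0 r hlt]) (fun t ht => by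
        refine (mul_le_mul_of_nonneg_right (ih (r + 1) (by omega) _) (norm_nonneg _)).trans ?_
        rw [add_sub_cancel_left, norm_smul, Real.norm_of_nonneg ht.1]
        apply le_of_eq; ring)
    simpa using this

lemma contDiff_sub_taylorPoly {p : ℕ} {f : E → ℝ} (hf : ContDiff ℝ p f) (x : E) :
    ContDiff ℝ p (fun y => f y - taylorPoly p f x y) :=
  hf.sub (contDiff_taylorPoly p f x)

lemma iteratedFDeriv_sub_taylorPoly {p r : ℕ} (hr : r ≤ p) {f : E → ℝ} (hf : ContDiff ℝ p f)
    (x y : E) : iteratedFDeriv ℝ r (fun y => f y - taylorPoly p f x y) y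
      = iteratedFDeriv ℝ r f y - iteratedFDeriv ℝ r (taylorPoly p f x) y := by
  have h1 : ContDiff ℝ r f := hf.of_le (by exact_mod_cast hr)
  exact iteratedFDeriv_sub_apply h1.contDiffAt (contDiff_taylorPoly p f x).contDiffAt

/-- Taylor's theorem for all derivatives of a function with Lipschitz `p`-th derivative. -/
lemma norm_iteratedFDeriv_sub_taylorPoly_le {p : ℕ} {M : ℝ} {f : E → ℝ} (hf : ContDiff ℝ p f)
    (hM : ∀ x y, ‖iteratedFDeriv ℝ p f x - iteratedFDeriv ℝ p f y‖ ≤ M * ‖x - y‖)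
    {j r : ℕ} (hjr : r + j = p) (x y : E) :
    ‖iteratedFDeriv ℝ r f y - iteratedFDeriv ℝ r (taylorPoly p f x) y‖
      ≤ M / ((j + 1)! : ℝ) * ‖y - x‖ ^ (j + 1) := by
  rw [← iteratedFDeriv_sub_taylorPoly (by omega) hf]
  refine norm_iteratedFDeriv_le_of_vanishing (contDiff_sub_taylorPoly hf x) ?_ ?_ j r hjr y
  · intro r hr
    rw [iteratedFDeriv_sub_taylorPoly hr.le hf, iteratedFDeriv_taylorPoly_self hr.le hf, sub_self]
  · intro y
    rw [iteratedFDeriv_sub_taylorPoly le_rfl hf, iteratedFDeriv_order_taylorPoly hf]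
    exact hM y x

lemma abs_sub_taylorPoly_le {p : ℕ} {M : ℝ} {f : E → ℝ} (hf : ContDiff ℝ p f)
    (hM : ∀ x y, ‖iteratedFDeriv ℝ p f x - iteratedFDeriv ℝ p f y‖ ≤ M * ‖x - y‖) (x y : E) :
    |f y - taylorPoly p f x y| ≤ M / ((p + 1)! : ℝ) * ‖y - x‖ ^ (p + 1) := by
  have h := norm_iteratedFDeriv_sub_taylorPoly_le hf hM (zero_add p) x y
  rw [← iteratedFDeriv_sub_taylorPoly (Nat.zero_le p) hf, norm_iteratedFDeriv_zero] at h
  exact h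

/-- Dependence of the Taylor polynomial on the expansion point. -/
lemma abs_taylorPoly_sub_taylorPoly_le {p : ℕ} {M : ℝ} (hM0 : 0 ≤ M) {f : E → ℝ}
    (hf : ContDiff ℝ p f)
    (hM : ∀ x y, ‖iteratedFDeriv ℝ p f x - iteratedFDeriv ℝ p f y‖ ≤ M * ‖x - y‖)
    {x x' y : E} {ρ : ℝ} (hx : ‖x' - x‖ ≤ ρ) (hy : ‖y - x'‖ ≤ ρ) :
    |taylorPoly p f x' y - taylorPoly p f x y| ≤ (p + 1) * M * ‖x' - x‖ * ρ ^ p := by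
  set Q : E → ℝ := fun z => taylorPoly p f x' z - taylorPoly p f x z with hQ
  have hQd : ∀ n : WithTop ℕ∞, ContDiff ℝ n Q := fun n =>
    (contDiff_taylorPoly p f x').sub (contDiff_taylorPoly p f x)
  have hQr : ∀ (r : ℕ) z, iteratedFDeriv ℝ r Q z
      = iteratedFDeriv ℝ r (taylorPoly p f x') z - iteratedFDeriv ℝ r (taylorPoly p f x) z :=
    fun r z => iteratedFDeriv_sub_apply (contDiff_taylorPoly p f x').contDiffAt
      (contDiff_taylorPoly p f x).contDiffAt
  have hρ : 0 ≤ ρ := (norm_nonneg _).trans hx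
  -- Descending induction on the order `r = p - j`. At order `p` both polynomials have constant
  -- derivatives. At a lower order the difference is estimated at `x'`, where one polynomial has the
  -- exact derivatives of `f` and Taylor's theorem applies to the other, and is then integrated from
  -- `x'` to `z`.
  have main : ∀ j r : ℕ, r + j = p → ∀ z, ‖z - x'‖ ≤ ρ →
      ‖iteratedFDeriv ℝ r Q z‖ ≤ (j + 1) * M * ‖x' - x‖ * ρ ^ j := by
    intro j
    induction j with
    | zero =>
      intro r hr z _
      obtain rfl : r = p := by omega
      rw [hQr, iteratedFDeriv_order_taylorPoly hf, iteratedFDeriv_order_taylorPoly hf]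
      simpa using hM x' x
    | succ j ih =>
      intro r hr z hz
      have hat : ‖iteratedFDeriv ℝ r Q x'‖ ≤ M * ‖x' - x‖ * ρ ^ (j + 1) := by
        rw [hQr, iteratedFDeriv_taylorPoly_self (by omega) hf]
        refine (norm_iteratedFDeriv_sub_taylorPoly_le hf hM hr x x').trans ?_
        calc M / ((j + 1 + 1)! : ℝ) * ‖x' - x‖ ^ (j + 1 + 1)
            ≤ M * ‖x' - x‖ ^ (j + 1 + 1) := by
              gcongr
              exact div_le_self hM0 (by exact_mod_cast Nat.factorial_pos _)
          _ = M * ‖x' - x‖ * ‖x' - x‖ ^ (j + 1) := by ring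
          _ ≤ _ := by gcongr
      have hb : ∀ t : ℝ, HasDerivAt
          (fun t : ℝ => M * ‖x' - x‖ * ρ ^ (j + 1) + (j + 1) * M * ‖x' - x‖ * ρ ^ j * ρ * t)
          ((j + 1) * M * ‖x' - x‖ * ρ ^ j * ρ) t := by
        intro t
        simpa using ((hasDerivAt_id t).const_mul
          ((j + 1) * M * ‖x' - x‖ * ρ ^ j * ρ)).const_add (M * ‖x' - x‖ * ρ ^ (j + 1))
      have := norm_iteratedFDeriv_le_of_succ (r := r) (x := x') (y := z) (hQd _) hb
        (by simpa using hat) (fun t ht => by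
          have h1 : ‖x' + t • (z - x') - x'‖ ≤ ρ := by
            rw [add_sub_cancel_left, norm_smul, Real.norm_of_nonneg ht.1]
            exact (mul_le_of_le_one_left (norm_nonneg _) ht.2.le).trans hz
          have := ih (r + 1) (by omega) _ h1
          gcongr)
      refine this.trans (le_of_eq ?_)
      push_cast
      ring
  have := main p 0 (zero_add p) y hy
  rwa [norm_iteratedFDeriv_zero] at this

/-- If the derivative of order `p` is constant, the function is its Taylor polynomial. -/
lemma taylorPoly_eq_of_iteratedFDeriv_const {p : ℕ} {f : E → ℝ} (hf : ContDiff ℝ p f)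
    (hc : ∀ x y, iteratedFDeriv ℝ p f x = iteratedFDeriv ℝ p f y) (x y : E) :
    taylorPoly p f x y = f y := by
  have := abs_sub_taylorPoly_le hf (M := 0) (fun x y => by simp [hc x y]) x y
  simp only [zero_div, zero_mul, abs_nonpos_iff] at this
  linarith

end Taylor

section

/-! ### Calculus and convexity along lines, powers of the norm -/

section LinesAndPowers

variable {E : Type*} [NormedAddCommGroup E] [InnerProductSpace ℝ E]

lemma hasDerivAt_add_smul (w e : E) (t : ℝ) : HasDerivAt (fun s : ℝ => w + s • e) e t := by
  simpa using ((hasDerivAt_id t).smul_const e).const_add w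

lemma hasFDerivAt_norm_sub_pow {m : ℕ} (x y : E) :
    HasFDerivAt (fun y : E => ‖y - x‖ ^ (m + 2))
      (((m + 2 : ℝ) * ‖y - x‖ ^ m) • innerSL ℝ (y - x)) y := by
  have h := (hasFDerivAt_norm_rpow (y - x) (p := ((m + 2 : ℕ) : ℝ))
    (by push_cast; linarith [(Nat.cast_nonneg m : (0 : ℝ) ≤ m)])).comp y
    ((hasFDerivAt_id y).sub_const x)
  rw [show (((m + 2 : ℕ) : ℝ) - 2) = (m : ℝ) by push_cast; ring, Real.rpow_natCast] at h
  refine (h.congr_fderiv ?_).congr_of_eventuallyEq (Filter.Eventually.of_forall fun z => ?_)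
  · ext v; simp
  · simp only [Function.comp, id]
    exact (Real.rpow_natCast _ _).symm

/-- The derivative of `t ↦ ‖w + t e‖ᵐ ⟪w + t e, e⟫` is at least `‖w + t e‖ᵐ ‖e‖²`. -/
lemma exists_hasDerivAt_norm_pow_mul_inner {m : ℕ} (hm : m ≠ 0) (w e : E) (t : ℝ) :
    ∃ d : ℝ, ‖w + t • e‖ ^ m * ‖e‖ ^ 2 ≤ d ∧
      HasDerivAt (fun s : ℝ => ‖w + s • e‖ ^ m * inner ℝ (w + s • e) e) d t := by
  have hl := hasDerivAt_add_smul w e t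
  have hi : HasDerivAt (fun s : ℝ => inner ℝ (w + s • e) e) (‖e‖ ^ 2) t := by
    simpa using hl.inner ℝ (hasDerivAt_const t e)
  -- The norm is not differentiable at the origin, but there the product is `o(1) · O(s - t)`, so
  -- its derivative is 0.
  by_cases hv : w + t • e = 0
  · refine ⟨0, by simp [hv, hm], ?_⟩
    rw [hasDerivAt_iff_isLittleO]
    have hA : (fun s : ℝ => ‖w + s • e‖ ^ m) =o[nhds t] (fun _ => (1 : ℝ)) := by
      rw [Asymptotics.isLittleO_one_iff]
      have : ContinuousAt (fun s : ℝ => ‖w + s • e‖ ^ m) t := (hl.continuousAt.norm).pow m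
      simpa [ContinuousAt, hv, hm] using this
    have hB : (fun s : ℝ => inner ℝ (w + s • e) e) =O[nhds t] (fun s => s - t) := by
      have := hi.isBigO_sub
      simpa [hv] using this
    simpa [hv] using hA.mul_isBigO hB
  · have hn : HasDerivAt (fun s : ℝ => ‖w + s • e‖) (inner ℝ (w + t • e) e / ‖w + t • e‖) t := by
      have h := (hl.norm_sq).sqrt (by positivity)
      simp only [Real.sqrt_sq (norm_nonneg _)] at h
      refine h.congr_deriv ?_
      rw [mul_div_mul_left _ _ two_ne_zero]
    refine ⟨_, ?_, (hn.pow m).mul hi⟩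
    have : (0 : ℝ) ≤ m * ‖w + t • e‖ ^ (m - 1) * (inner ℝ (w + t • e) e / ‖w + t • e‖)
        * inner ℝ (w + t • e) e := by
      rw [mul_assoc, div_mul_eq_mul_div]
      have := mul_self_nonneg (inner ℝ (w + t • e) e)
      positivity
    simpa using this

lemma convexOn_univ_of_lines {ψ : E → ℝ}
    (h : ∀ a e : E, ConvexOn ℝ Set.univ (fun t : ℝ => ψ (a + t • e))) :
    ConvexOn ℝ Set.univ ψ := by
  refine ⟨convex_univ, fun x _ y _ a b ha hb hab => ?_⟩
  have := (h x (y - x)).2 (Set.mem_univ 0) (Set.mem_univ 1) ha hb hab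
  simp only [smul_eq_mul, mul_zero, zero_smul, add_zero, one_smul, add_sub_cancel, mul_one,
    zero_add] at this
  have e : a • x + b • y = x + b • (y - x) := by
    obtain rfl : a = 1 - b := by linarith
    module
  rw [e]
  exact this

lemma ConvexOn.comp_line {ψ : E → ℝ} (h : ConvexOn ℝ Set.univ ψ) (a e : E) :
    ConvexOn ℝ Set.univ (fun t : ℝ => ψ (a + t • e)) := by
  refine ⟨convex_univ, fun x _ y _ s t hs ht hst => ?_⟩
  have := h.2 (Set.mem_univ (a + x • e)) (Set.mem_univ (a + y • e)) hs ht hst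
  convert this using 2
  obtain rfl : s = 1 - t := by linarith
  simp only [smul_eq_mul]
  module

lemma hasDerivAt_fderiv_line {g : E → ℝ} (hg : ContDiff ℝ 2 g) (a e : E) (t : ℝ) :
    HasDerivAt (fun s : ℝ => fderiv ℝ g (a + s • e) e)
      (iteratedFDeriv ℝ 2 g (a + t • e) (fun _ => e)) t := by
  have h1 : Differentiable ℝ (fderiv ℝ g) :=
    (hg.fderiv_right (m := 1) (by norm_num)).differentiable (by norm_num)
  have h2 : HasDerivAt (fun s : ℝ => fderiv ℝ g (a + s • e))
      (fderiv ℝ (fderiv ℝ g) (a + t • e) e) t :=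
    (h1 (a + t • e)).hasFDerivAt.comp_hasDerivAt t (hasDerivAt_add_smul a e t)
  rw [iteratedFDeriv_two_apply]
  exact ((ContinuousLinearMap.apply ℝ ℝ e).hasFDerivAt).comp_hasDerivAt t h2

lemma ConvexOn.iteratedFDeriv_two_nonneg {g : E → ℝ} (hg : ConvexOn ℝ Set.univ g)
    (hg2 : ContDiff ℝ 2 g) (x e : E) : 0 ≤ iteratedFDeriv ℝ 2 g x (fun _ => e) := by
  have hd : ∀ t : ℝ, HasDerivAt (fun s : ℝ => g (x + s • e)) (fderiv ℝ g (x + t • e) e) t :=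
    fun t => ((hg2.differentiable (by norm_num)) _).hasFDerivAt.comp_hasDerivAt t
      (hasDerivAt_add_smul x e t)
  have hmono := (hg.comp_line x e).monotoneOn_deriv fun t _ => (hd t).differentiableAt
  have hder : deriv (fun s : ℝ => g (x + s • e)) = fun t => fderiv ℝ g (x + t • e) e :=
    funext fun t => (hd t).deriv
  rw [hder, monotoneOn_univ] at hmono
  have h := hmono.deriv_nonneg (x := 0)
  rw [(hasDerivAt_fderiv_line hg2 x e 0).deriv] at h
  simpa using h

/-- Quadratic growth at a minimizer of a convex function plus a quadratic. -/
lemma ConvexOn.quadratic_growth {ψ : E → ℝ} (hψ : ConvexOn ℝ Set.univ ψ) {L : ℝ}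
    {c y : E} (hmin : ∀ z, ψ y + L / 2 * ‖y - c‖ ^ 2 ≤ ψ z + L / 2 * ‖z - c‖ ^ 2) (z : E) :
    ψ y + L / 2 * ‖y - c‖ ^ 2 + L / 2 * ‖z - y‖ ^ 2 ≤ ψ z + L / 2 * ‖z - c‖ ^ 2 := by
  -- Minimality is tested at `(1 - t) y + t z` and divided by `t`; the lost factor `1 - t`
  -- disappears as `t → 0`.
  have key : ∀ t : ℝ, 0 < t → t ≤ 1 →
      ψ y + L / 2 * ‖y - c‖ ^ 2 + L / 2 * (1 - t) * ‖z - y‖ ^ 2 ≤ ψ z + L / 2 * ‖z - c‖ ^ 2 := by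
    intro t ht ht1
    have h1 := hmin ((1 - t) • y + t • z)
    have h2 := hψ.2 (Set.mem_univ y) (Set.mem_univ z) (sub_nonneg.2 ht1) ht.le (by ring)
    have h3 : ‖(1 - t) • y + t • z - c‖ ^ 2
        = (1 - t) * ‖y - c‖ ^ 2 + t * ‖z - c‖ ^ 2 - t * (1 - t) * ‖z - y‖ ^ 2 := by
      have e1 : (1 - t) • y + t • z - c = (1 - t) • (y - c) + t • (z - c) := by module
      have e2 : z - y = (z - c) - (y - c) := by abel
      rw [e1, e2, norm_add_sq_real, norm_sub_sq_real (z - c) (y - c), norm_smul, norm_smul,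
        real_inner_smul_left, real_inner_smul_right, Real.norm_of_nonneg ht.le,
        Real.norm_of_nonneg (sub_nonneg.2 ht1), real_inner_comm (z - c)]
      ring
    rw [h3] at h1
    simp only [smul_eq_mul] at h2
    have h4 : 0 ≤ t * (ψ z + L / 2 * ‖z - c‖ ^ 2
        - (ψ y + L / 2 * ‖y - c‖ ^ 2 + L / 2 * (1 - t) * ‖z - y‖ ^ 2)) := by
      nlinarith
    have := nonneg_of_mul_nonneg_right h4 ht
    linarith
  have hlim : Filter.Tendsto (fun t : ℝ =>
      ψ y + L / 2 * ‖y - c‖ ^ 2 + L / 2 * (1 - t) * ‖z - y‖ ^ 2) (nhdsWithin 0 (Set.Ioi 0))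
      (nhds (ψ y + L / 2 * ‖y - c‖ ^ 2 + L / 2 * (1 - 0) * ‖z - y‖ ^ 2)) := by
    have : Continuous (fun t : ℝ =>
      ψ y + L / 2 * ‖y - c‖ ^ 2 + L / 2 * (1 - t) * ‖z - y‖ ^ 2) := by fun_prop
    exact this.continuousWithinAt
  have := le_of_tendsto hlim (by
    filter_upwards [Ioc_mem_nhdsGT (zero_lt_one' ℝ)] with t ht using key t ht.1 ht.2)
  simpa using this

/-- Tangent inequality for a convex function. -/
lemma ConvexOn.add_fderiv_le {g : E → ℝ} (hg : ConvexOn ℝ Set.univ g)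
    (hd : Differentiable ℝ g) (x y : E) : g x + fderiv ℝ g x (y - x) ≤ g y := by
  have hx : HasDerivAt (fun s : ℝ => g (x + s • (y - x))) (fderiv ℝ g x (y - x)) 0 := by
    have := (hd (x + (0 : ℝ) • (y - x))).hasFDerivAt.comp_hasDerivAt 0
      (hasDerivAt_add_smul x (y - x) 0)
    rw [zero_smul, add_zero] at this
    exact this
  have := (hg.comp_line x (y - x)).le_slope_of_hasDerivAt (Set.mem_univ 0) (Set.mem_univ 1)
    one_pos hx
  rw [slope_def_field] at this
  simp only [one_smul, zero_smul, add_zero, add_sub_cancel, sub_zero, div_one] at this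
  linarith

end LinesAndPowers

/-- `f` is `p` times continuously differentiable with `M`-Lipschitz `p`-th derivative. -/
structure HasLipschitzDeriv (p : ℕ) (M : ℝ) {n : ℕ} (f : Euc n → ℝ) : Prop where
  contDiff : ContDiff ℝ p f
  lipschitz : ∀ x y : Euc n,
    ‖iteratedFDeriv ℝ p f x - iteratedFDeriv ℝ p f y‖ ≤ M * ‖x - y‖

/-! ### Tensor steps and their models -/

variable {p n : ℕ} {M : ℝ} {f : Euc n → ℝ}

lemma IsProblem.hasLipschitzDeriv {Δ₀ : ℝ} {x₀ : Euc n} (h : IsProblem p M Δ₀ x₀ f) :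
    HasLipschitzDeriv p M f := ⟨h.contDiff, h.lipschitz⟩

lemma HasLipschitzDeriv.differentiable (hp : 2 ≤ p) (h : HasLipschitzDeriv p M f) :
    Differentiable ℝ f :=
  h.contDiff.differentiable (by exact_mod_cast (by omega : p ≠ 0))

lemma HasLipschitzDeriv.contDiff_two (hp : 2 ≤ p) (h : HasLipschitzDeriv p M f) :
    ContDiff ℝ 2 f := h.contDiff.of_le (by exact_mod_cast hp)

lemma contDiff_quad (L : ℝ) (z : Euc n) {m : WithTop ℕ∞} :
    ContDiff ℝ m (fun x : Euc n => L / 2 * ‖x - z‖ ^ 2) :=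
  contDiff_const.mul ((contDiff_id.sub contDiff_const).norm_sq ℝ)

/-- The increment `q(a + h) - q(a)` of a quadratic is affine in `a`, so its derivatives of order at
least two vanish. Hence adding quadratics preserves the Lipschitz constant. -/
lemma iteratedFDeriv_quad_const (hp : 2 ≤ p) (L : ℝ) (z x y : Euc n) :
    iteratedFDeriv ℝ p (fun x : Euc n => L / 2 * ‖x - z‖ ^ 2) x
      = iteratedFDeriv ℝ p (fun x : Euc n => L / 2 * ‖x - z‖ ^ 2) y := by
  set q : Euc n → ℝ := fun x => L / 2 * ‖x - z‖ ^ 2 with hq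
  have hqd : ContDiff ℝ p q := contDiff_quad L z
  set ℓ : Euc n →L[ℝ] ℝ := L • innerSL ℝ (x - y)
  have haff : (fun a => q (a + (x - y)) - q a)
      = fun a => L / 2 * (‖x - y‖ ^ 2 - 2 * inner ℝ (x - y) z) + ℓ a := by
    ext1 a
    have : a + (x - y) - z = (a - z) + (x - y) := by abel
    simp only [hq, this, @norm_add_sq ℝ, ℓ, smul_apply, innerSL_apply_apply,
      smul_eq_mul, inner_sub_left, inner_sub_right, real_inner_comm a, real_inner_comm z,
      RCLike.re_to_real]
    ring
  have h0 : iteratedFDeriv ℝ p (fun a => q (a + (x - y)) - q a) y = 0 := by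
    rw [haff]
    obtain ⟨k, rfl⟩ : ∃ k, p = k + 1 + 1 := ⟨p - 2, by omega⟩
    rw [← norm_eq_zero, ← norm_iteratedFDeriv_fderiv]
    have : fderiv ℝ (fun a => L / 2 * (‖x - y‖ ^ 2 - 2 * inner ℝ (x - y) z) + ℓ a)
        = fun _ => ℓ := by
      ext1 a
      rw [fderiv_const_add, ℓ.fderiv]
    rw [this, iteratedFDeriv_succ_const]
    simp
  have h1 := iteratedFDeriv_sub_apply (𝕜 := ℝ) (i := p) (x := y)
    (f := fun a => q (a + (x - y))) (g := q)
    (hqd.comp (contDiff_id.add contDiff_const)).contDiffAt hqd.contDiffAt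
  change iteratedFDeriv ℝ p (fun a => q (a + (x - y)) - q a) y = _ at h1
  rw [h0, iteratedFDeriv_comp_add_right, add_sub_cancel] at h1
  exact (sub_eq_zero.1 h1.symm)

lemma hasLipschitzDeriv_addQuad (hp : 2 ≤ p) (h : HasLipschitzDeriv p M f) (L : ℝ)
    (z : Euc n) : HasLipschitzDeriv p M (addQuad f L z) := by
  refine ⟨h.contDiff.add (contDiff_quad L z), fun x y => ?_⟩
  have : ∀ x, iteratedFDeriv ℝ p (addQuad f L z) x = iteratedFDeriv ℝ p f x
      + iteratedFDeriv ℝ p (fun x : Euc n => L / 2 * ‖x - z‖ ^ 2) x := fun x =>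
    iteratedFDeriv_add_apply h.contDiff.contDiffAt (contDiff_quad L z).contDiffAt
  rw [this, this, iteratedFDeriv_quad_const hp L z x y, add_sub_add_right_eq_sub]
  exact h.lipschitz x y

lemma tensorModel_eq (p : ℕ) (K : ℝ) (f : Euc n → ℝ) (x y : Euc n) :
    tensorModel p K f x y = taylorPoly p f x y + K / ((p + 1)! : ℝ) * ‖y - x‖ ^ (p + 1) := rfl

/-- A quadratic is its own Taylor polynomial for `p ≥ 2`. Thus proximal and regularized tensor steps
need only the jet of `f` itself. -/
lemma tensorModel_addQuad (hp : 2 ≤ p) (hf : ContDiff ℝ p f) (K L : ℝ) (z x y : Euc n) :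
    tensorModel p K (addQuad f L z) x y = tensorModel p K f x y + L / 2 * ‖y - z‖ ^ 2 := by
  rw [tensorModel_eq, tensorModel_eq, ← taylorPoly_eq_of_iteratedFDeriv_const
    (f := fun x : Euc n => L / 2 * ‖x - z‖ ^ 2) (contDiff_quad L z)
    (iteratedFDeriv_quad_const hp L z) x y]
  have : taylorPoly p (addQuad f L z) x y = taylorPoly p f x y
      + taylorPoly p (fun x : Euc n => L / 2 * ‖x - z‖ ^ 2) x y := by
    unfold taylorPoly
    rw [← Finset.sum_add_distrib]
    refine Finset.sum_congr rfl fun r hr => ?_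
    have hrp : r ≤ p := Nat.lt_succ_iff.1 (Finset.mem_range.1 hr)
    have : iteratedFDeriv ℝ r (addQuad f L z) x = iteratedFDeriv ℝ r f x
      + iteratedFDeriv ℝ r (fun x : Euc n => L / 2 * ‖x - z‖ ^ 2) x :=
      iteratedFDeriv_add_apply (hf.of_le (by exact_mod_cast hrp)).contDiffAt
        (contDiff_quad L z).contDiffAt
    rw [this, add_apply, mul_add]
  rw [this]
  ring

lemma continuous_tensorModel (p : ℕ) (K : ℝ) (f : Euc n → ℝ) (x : Euc n) :
    Continuous (tensorModel p K f x) := by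
  have : Continuous (taylorPoly p f x) := (contDiff_taylorPoly p f x (n := 0)).continuous
  change Continuous fun y => taylorPoly p f x y + K / ((p + 1)! : ℝ) * ‖y - x‖ ^ (p + 1)
  fun_prop

lemma HasLipschitzDeriv.le_tensorModel (h : HasLipschitzDeriv p M f) (K : ℝ) (x y : Euc n) :
    f y + (K - M) / ((p + 1)! : ℝ) * ‖y - x‖ ^ (p + 1) ≤ tensorModel p K f x y := by
  have := (abs_le.1 (abs_sub_taylorPoly_le h.contDiff h.lipschitz x y)).2
  rw [tensorModel_eq, sub_div, sub_mul]
  linarith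

lemma HasLipschitzDeriv.tensorModel_le (h : HasLipschitzDeriv p M f) (K : ℝ) (x y : Euc n) :
    tensorModel p K f x y ≤ f y + (K + M) / ((p + 1)! : ℝ) * ‖y - x‖ ^ (p + 1) := by
  have := (abs_le.1 (abs_sub_taylorPoly_le h.contDiff h.lipschitz x y)).1
  rw [tensorModel_eq, add_div, add_mul]
  linarith

lemma tensorModel_self (p : ℕ) (K : ℝ) (f : Euc n → ℝ) (x : Euc n) :
    tensorModel p K f x x = f x := by
  rw [tensorModel_eq, taylorPoly, Finset.sum_eq_single 0]
  · simp
  · intro r _ hr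
    have : Nonempty (Fin r) := ⟨⟨0, Nat.pos_of_ne_zero hr⟩⟩
    rw [(iteratedFDeriv ℝ r f x).map_coord_zero (Classical.arbitrary _) (by simp), mul_zero]
  · simp

lemma hasFDerivAt_tensorModel (hp : 2 ≤ p) (K : ℝ) (f : Euc n → ℝ) (x y : Euc n) :
    HasFDerivAt (tensorModel p K f x) (fderiv ℝ (taylorPoly p f x) y
      + (K / (p ! : ℝ) * ‖y - x‖ ^ (p - 1)) • innerSL ℝ (y - x)) y := by
  obtain ⟨m, rfl⟩ : ∃ m, p = m + 1 := ⟨p - 1, by omega⟩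
  have h1 : HasFDerivAt (taylorPoly (m + 1) f x) (fderiv ℝ (taylorPoly (m + 1) f x) y) y :=
    (((contDiff_taylorPoly (m + 1) f x (n := 1)).differentiable (by norm_num)) y).hasFDerivAt
  have h2 := (hasFDerivAt_norm_sub_pow (m := m) x y).const_mul (K / ((m + 1 + 1)! : ℝ))
  refine (h1.add h2).congr_fderiv ?_
  rw [smul_smul]
  congr 2
  rw [Nat.factorial_succ (m + 1)]
  push_cast
  have : ((m + 1)! : ℝ) ≠ 0 := by positivity
  have : (m : ℝ) + 1 + 1 ≠ 0 := by positivity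
  field_simp
  ring

lemma norm_gradient (f : Euc n → ℝ) (x : Euc n) : ‖gradient f x‖ = ‖fderiv ℝ f x‖ := by
  rw [← toDual_gradient, LinearIsometryEquiv.norm_map]

/-- The gradient at a tensor step. -/
lemma HasLipschitzDeriv.norm_fderiv_tensorStep_le (hp : 2 ≤ p) (hM : 0 ≤ M)
    (h : HasLipschitzDeriv p M f) {x y : Euc n} (hy : IsTensorStep p (p * M) f x y) :
    ‖fderiv ℝ f y‖ ≤ (p + 1) * M / (p ! : ℝ) * ‖y - x‖ ^ p := by
  have hmin : IsLocalMin (tensorModel p (p * M) f x) y :=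
    Filter.Eventually.of_forall fun z => hy (Set.mem_univ z)
  have h0 := hmin.hasFDerivAt_eq_zero (hasFDerivAt_tensorModel hp _ f x y)
  -- At a stationary point of the model the gradient of the Taylor polynomial is opposite to that of
  -- the regularizer.
  have h1 : ‖fderiv ℝ (taylorPoly p f x) y‖ = p * M / (p ! : ℝ) * ‖y - x‖ ^ p := by
    rw [eq_neg_of_add_eq_zero_left h0, norm_neg, norm_smul, innerSL_apply_norm,
      Real.norm_of_nonneg (by positivity), mul_assoc, ← pow_succ, Nat.sub_add_cancel (by omega)]
  have h2 : ‖fderiv ℝ f y - fderiv ℝ (taylorPoly p f x) y‖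
      ≤ M / (p ! : ℝ) * ‖y - x‖ ^ p := by
    have := norm_iteratedFDeriv_sub_taylorPoly_le h.contDiff h.lipschitz
      (j := p - 1) (r := 1) (by omega) x y
    rw [← iteratedFDeriv_sub_taylorPoly (by omega) h.contDiff, norm_iteratedFDeriv_one,
      Nat.sub_add_cancel (by omega)] at this
    rwa [← fderiv_fun_sub (h.differentiable hp y)
      ((contDiff_taylorPoly p f x (n := 1)).differentiable (by norm_num) y)]
  calc ‖fderiv ℝ f y‖ = ‖(fderiv ℝ f y - fderiv ℝ (taylorPoly p f x) y)
        + fderiv ℝ (taylorPoly p f x) y‖ := by rw [sub_add_cancel]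
    _ ≤ M / (p ! : ℝ) * ‖y - x‖ ^ p + p * M / (p ! : ℝ) * ‖y - x‖ ^ p :=
      (norm_add_le _ _).trans (add_le_add h2 h1.le)
    _ = _ := by ring

/-- The decrease of the function in a tensor step. -/
lemma HasLipschitzDeriv.tensorStep_decrease (h : HasLipschitzDeriv p M f) {x y : Euc n}
    (hy : IsTensorStep p (p * M) f x y) :
    f y + (p - 1) * M / ((p + 1)! : ℝ) * ‖y - x‖ ^ (p + 1) ≤ f x := by
  have h1 := h.le_tensorModel (p * M) x y
  have h2 : tensorModel p (p * M) f x y ≤ tensorModel p (p * M) f x x := hy (Set.mem_univ x)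
  rw [tensorModel_self] at h2
  rw [sub_mul, one_mul]
  linarith

/-- The model is coercive: it dominates `inf f` plus `(p-1)M/(p+1)!` times `‖y - x‖^(p+1)`, and `p ≥
2` makes this factor positive. -/
lemma HasLipschitzDeriv.exists_isTensorStep (hp : 2 ≤ p) (hM : 0 < M)
    (h : HasLipschitzDeriv p M f) (hb : BddBelow (Set.range f)) (x : Euc n) :
    ∃ y, IsTensorStep p (p * M) f x y := by
  obtain ⟨b, hb⟩ := hb
  have hp1 : (0 : ℝ) < p - 1 := by
    have : (2 : ℝ) ≤ p := by exact_mod_cast hp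
    linarith
  have hc : 0 < (p * M - M) / ((p + 1)! : ℝ) := by
    have : 0 < p * M - M := by nlinarith
    positivity
  have htend : Filter.Tendsto (tensorModel p (p * M) f x) (Filter.cocompact _) Filter.atTop := by
    refine Filter.tendsto_atTop_mono (f := fun y =>
      b + (p * M - M) / ((p + 1)! : ℝ) * ‖y - x‖ ^ (p + 1)) (fun y => ?_) ?_
    · exact (add_le_add_left (hb ⟨y, rfl⟩) _).trans (h.le_tensorModel _ x y)
    · refine Filter.tendsto_atTop_add_const_left _ _ (Filter.Tendsto.const_mul_atTop hc ?_)
      refine (Filter.tendsto_pow_atTop (by omega)).comp ?_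
      exact tendsto_norm_cocompact_atTop.comp
        (Homeomorph.subRight x).isClosedEmbedding.tendsto_cocompact
  obtain ⟨y, hy⟩ := (continuous_tensorModel p (p * M) f x).exists_forall_le htend
  exact ⟨y, fun z _ => hy z⟩

/-- The regularized Taylor model of a convex function is convex. -/
lemma HasLipschitzDeriv.convexOn_tensorModel (hp : 2 ≤ p) (hM : 0 ≤ M)
    (h : HasLipschitzDeriv p M f) (hf : ConvexOn ℝ Set.univ f) (x : Euc n) :
    ConvexOn ℝ Set.univ (tensorModel p (p * M) f x) := by
  refine convexOn_univ_of_lines fun a e => ?_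
  choose d hd hd' using exists_hasDerivAt_norm_pow_mul_inner (m := p - 1) (by omega) (a - x) e
  have hsub : ∀ t : ℝ, a - x + t • e = a + t • e - x := fun t => by abel
  refine convexOn_of_hasDerivWithinAt2_nonneg convex_univ
    (f' := fun t => fderiv ℝ (taylorPoly p f x) (a + t • e) e
      + p * M / (p ! : ℝ) * (‖a - x + t • e‖ ^ (p - 1) * inner ℝ (a - x + t • e) e))
    (f'' := fun t => iteratedFDeriv ℝ 2 (taylorPoly p f x) (a + t • e) (fun _ => e)
      + p * M / (p ! : ℝ) * d t) ?_ ?_ ?_ ?_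
  · refine ((continuous_tensorModel p (p * M) f x).comp ?_).continuousOn
    fun_prop
  · intro t _
    have := (hasFDerivAt_tensorModel hp (p * M) f x (a + t • e)).comp_hasDerivAt t
      (hasDerivAt_add_smul a e t)
    refine (this.congr_deriv ?_).hasDerivWithinAt
    rw [hsub, add_apply, smul_apply, innerSL_apply_apply, smul_eq_mul, mul_assoc]
  · intro t _
    exact ((hasDerivAt_fderiv_line (contDiff_taylorPoly p f x) a e t).add
      ((hd' t).const_mul _)).hasDerivWithinAt
  · intro t _
    -- The Hessian of the Taylor polynomial can be less than that of `f` by at most `M/(p-1)! · ‖a +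
    -- te - x‖^(p-1)`. The weight `pM` is chosen because `pM/p! = M/(p-1)!`, so the regularizer
    -- compensates exactly this loss.
    have h1 := hf.iteratedFDeriv_two_nonneg (h.contDiff_two hp) (a + t • e) e
    have h2 : ‖(iteratedFDeriv ℝ 2 f (a + t • e)
        - iteratedFDeriv ℝ 2 (taylorPoly p f x) (a + t • e)) (fun _ => e)‖
        ≤ M / ((p - 1)! : ℝ) * ‖a + t • e - x‖ ^ (p - 1) * ‖e‖ ^ 2 := by
      refine (ContinuousMultilinearMap.le_opNorm _ _).trans ?_
      have := norm_iteratedFDeriv_sub_taylorPoly_le h.contDiff h.lipschitz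
        (j := p - 2) (r := 2) (by omega) x (a + t • e)
      rw [show p - 2 + 1 = p - 1 by omega] at this
      simp only [Finset.prod_const, Finset.card_univ, Fintype.card_fin]
      gcongr
    have h3 := (abs_le.1 h2).2
    rw [sub_apply] at h3
    have h4 : p * M / (p ! : ℝ) = M / ((p - 1)! : ℝ) := by
      rw [← Nat.mul_factorial_pred (by omega : p ≠ 0)]
      push_cast
      rw [mul_div_mul_left]
      exact_mod_cast (by omega : p ≠ 0)
    rw [h4]
    have h5 := mul_le_mul_of_nonneg_left (hd t)
      (by positivity : 0 ≤ M / ((p - 1)! : ℝ))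
    rw [hsub] at h5
    linarith

/-- Quadratic growth of the model around a tensor step for `f + (L/2) ‖· - x‖²`. -/
lemma HasLipschitzDeriv.tensorStep_growth (hp : 2 ≤ p) (hM : 0 ≤ M)
    (h : HasLipschitzDeriv p M f) (hf : ConvexOn ℝ Set.univ f) {L : ℝ} {x y : Euc n}
    (hy : IsTensorStep p (p * M) (addQuad f L x) x y) (z : Euc n) :
    tensorModel p (p * M) f x y + L / 2 * ‖y - x‖ ^ 2 + L / 2 * ‖z - y‖ ^ 2
      ≤ tensorModel p (p * M) f x z + L / 2 * ‖z - x‖ ^ 2 := by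
  refine (h.convexOn_tensorModel hp hM hf x).quadratic_growth (fun z => ?_) z
  have := hy (Set.mem_univ z)
  change tensorModel p (p * M) (addQuad f L x) x y
    ≤ tensorModel p (p * M) (addQuad f L x) x z at this
  rwa [tensorModel_addQuad hp h.contDiff, tensorModel_addQuad hp h.contDiff] at this

end

/-! ### One iteration of the inner method and its potential -/

section

variable {p n : ℕ} {M : ℝ}

lemma stepWeight_pos {A L : ℝ} (hL : 0 < L) : 0 < stepWeight A L := by
  have : 0 < 1 / L := by positivity
  have := Real.sqrt_nonneg (1 / L ^ 2 + 4 * A / L)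
  unfold stepWeight
  linarith

/-- The weight is the positive root of this quadratic equation. Besides positivity, this is all that
the potential estimate uses about it. -/
lemma stepWeight_sq {A L : ℝ} (hA : 0 ≤ A) (hL : 0 < L) :
    L * stepWeight A L ^ 2 = A + stepWeight A L := by
  have h : Real.sqrt (1 / L ^ 2 + 4 * A / L) ^ 2 = 1 / L ^ 2 + 4 * A / L :=
    Real.sq_sqrt (by positivity)
  unfold stepWeight
  set s := Real.sqrt (1 / L ^ 2 + 4 * A / L)
  have h2 : L * s ^ 2 = 1 / L + 4 * A := by rw [h]; field_simp
  have h3 : L * (1 / L) = 1 := by field_simp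
  have h4 : L * (1 / L) ^ 2 = 1 / L := by field_simp
  linear_combination (1 / 4 : ℝ) * h2 + s / 2 * h3 + 1 / 4 * h4

lemma stepWeight_zero {L : ℝ} (hL : 0 < L) : stepWeight 0 L = 1 / L := by
  unfold stepWeight
  rw [mul_zero, zero_div, add_zero, Real.sqrt_eq_iff_mul_self_eq_of_pos (by positivity) |>.2
    (show 1 / L * (1 / L) = 1 / L ^ 2 by field_simp)]
  ring

/-- The weight is at least `1/(2L) + √(A/L)`, which completes a square. Summation yields `Σ
L_k^(-1/2) ≤ 2 √A_K`. -/
lemma sqrt_add_stepWeight {A L : ℝ} (hA : 0 ≤ A) (hL : 0 < L) :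
    Real.sqrt A + (Real.sqrt L)⁻¹ / 2 ≤ Real.sqrt (A + stepWeight A L) := by
  refine Real.le_sqrt_of_sq_le ?_
  set w := (Real.sqrt L)⁻¹
  have hw : 1 / L = w ^ 2 := by rw [inv_pow, Real.sq_sqrt hL.le, one_div]
  have hw0 : 0 ≤ w := by positivity
  have h1 : 2 * (w * Real.sqrt A) ≤ Real.sqrt (1 / L ^ 2 + 4 * A / L) := by
    refine Real.le_sqrt_of_sq_le ?_
    have e1 : 1 / L ^ 2 + 4 * A / L = w ^ 2 * w ^ 2 + 4 * A * w ^ 2 := by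
      rw [← hw]; field_simp
    have e2 : (2 * (w * Real.sqrt A)) ^ 2 = 4 * A * w ^ 2 := by
      rw [mul_pow, mul_pow, Real.sq_sqrt hA]; ring
    rw [e1, e2]
    have : 0 ≤ w ^ 2 * w ^ 2 := by positivity
    linarith
  have h2 : (Real.sqrt A + w / 2) ^ 2 = A + w * Real.sqrt A + w ^ 2 / 4 := by
    rw [add_sq, Real.sq_sqrt hA]; ring
  rw [h2]
  unfold stepWeight
  rw [hw]
  have : 0 ≤ w ^ 2 := by positivity
  linarith

lemma gradient_addQuad {f : Euc n → ℝ} (hf : Differentiable ℝ f) (L : ℝ) (z x : Euc n) :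
    gradient (addQuad f L z) x = gradient f x + L • (x - z) := by
  refine HasGradientAt.gradient ?_
  rw [hasGradientAt_iff_hasFDerivAt]
  have h1 : HasFDerivAt (fun x : Euc n => ‖x - z‖ ^ 2) (2 • innerSL ℝ (x - z)) x := by
    have := ((hasFDerivAt_id x).sub_const z).norm_sq
    refine this.congr_fderiv ?_
    ext v; simp
  refine ((hf x).hasFDerivAt.add (h1.const_mul (L / 2))).congr_fderiv ?_
  rw [map_add, toDual_gradient]
  congr 1
  ext v
  simp [InnerProductSpace.toDual_apply_apply]
  ring

lemma HasLipschitzDeriv.norm_gradient_prox_le (hp : 2 ≤ p) (hM : 0 ≤ M) {g : Euc n → ℝ}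
    (h : HasLipschitzDeriv p M g) {L : ℝ} {x y : Euc n}
    (hy : IsTensorStep p (p * M) (addQuad g L x) x y) :
    ‖gradient g y + L • (y - x)‖ ≤ (p + 1) * M / (p ! : ℝ) * ‖y - x‖ ^ p := by
  rw [← gradient_addQuad (h.differentiable hp), norm_gradient]
  exact (hasLipschitzDeriv_addQuad hp h L x).norm_fderiv_tensorStep_le hp hM hy

/-- The upper condition on `L` says that the error `(p+1)M/p! · h^p` in the optimality condition of
the proximal subproblem is at most `L/2 · h`. -/
lemma HasLipschitzDeriv.norm_gradient_prox_le_half (hp : 2 ≤ p) (hM : 0 ≤ M) {g : Euc n → ℝ}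
    (h : HasLipschitzDeriv p M g) {L : ℝ} (hL : 0 < L) {x y : Euc n}
    (hy : IsTensorStep p (p * M) (addQuad g L x) x y)
    (hup : 2 * (p + 1) * M / (p ! * L) * ‖y - x‖ ^ (p - 1) ≤ 1) :
    ‖gradient g y + L • (y - x)‖ ≤ L / 2 * ‖y - x‖ := by
  refine (h.norm_gradient_prox_le hp hM hy).trans ?_
  have e : (p + 1) * M / (p ! : ℝ) * ‖y - x‖ ^ p
      = (2 * (p + 1) * M / (p ! * L) * ‖y - x‖ ^ (p - 1)) * (L / 2 * ‖y - x‖) := by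
    conv_lhs => rw [← Nat.sub_add_cancel (by omega : 1 ≤ p), pow_succ]
    simp only [Nat.sub_add_cancel (by omega : 1 ≤ p)]
    field_simp
  rw [e]
  exact mul_le_of_le_one_left (by positivity) hup

/-- One iteration of the accelerated proximal scheme decreases the potential. -/
lemma potential_step {g : Euc n → ℝ} {A L : ℝ} (hA : 0 ≤ A) (hL : 0 < L)
    {y u y' xs v : Euc n}
    (h1 : g y' + inner ℝ v (y - y') ≤ g y) (h2 : g y' + inner ℝ v (xs - y') ≤ g xs)
    (hv : ‖v + L • (y' - extrapolate A L y u)‖ ≤ L / 2 * ‖y' - extrapolate A L y u‖) :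
    (A + stepWeight A L) * (g y' - g xs) + 1 / 2 * ‖u - stepWeight A L • v - xs‖ ^ 2
      + 3 / 8 * ((A + stepWeight A L) * L * ‖y' - extrapolate A L y u‖ ^ 2)
      ≤ A * (g y - g xs) + 1 / 2 * ‖u - xs‖ ^ 2 := by
  have ha := stepWeight_pos (A := A) hL
  have hq := stepWeight_sq hA hL
  set a := stepWeight A L with ha_def
  set d := y' - extrapolate A L y u with hd
  have hAa : A + a ≠ 0 := by positivity
  have e1 : (A + a) * inner ℝ v d = A * inner ℝ v (y' - y) + a * inner ℝ v (y' - u) := by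
    have : (A + a) • d = A • (y' - y) + a • (y' - u) := by
      rw [hd, extrapolate, ← ha_def, smul_sub, smul_add, smul_smul, smul_smul,
        mul_div_cancel₀ _ hAa, mul_div_cancel₀ _ hAa]
      module
    rw [← real_inner_smul_right, this, inner_add_right, real_inner_smul_right,
      real_inner_smul_right]
  have e2 : ‖u - a • v - xs‖ ^ 2
      = ‖u - xs‖ ^ 2 - 2 * a * inner ℝ v (u - xs) + a ^ 2 * ‖v‖ ^ 2 := by
    rw [show u - a • v - xs = (u - xs) - a • v by abel, norm_sub_sq_real,
      real_inner_smul_right, norm_smul, Real.norm_of_nonneg ha.le, real_inner_comm]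
    ring
  -- Squaring the inexact optimality condition leaves `-(3/4) L² ‖d‖²`. Multiplied by `a²/2` and
  -- with `L a² = A + a`, this is the source of the coefficient 3/8.
  have e3 : ‖v‖ ^ 2 + 2 * L * inner ℝ v d + L ^ 2 * ‖d‖ ^ 2 ≤ L ^ 2 / 4 * ‖d‖ ^ 2 := by
    have := pow_le_pow_left₀ (norm_nonneg _) hv 2
    rw [norm_add_sq_real, real_inner_smul_right, norm_smul, Real.norm_of_nonneg hL.le] at this
    nlinarith
  have e4 := mul_le_mul_of_nonneg_left e3 (sq_nonneg a)
  have e5 : a ^ 2 * (2 * L * inner ℝ v d) = 2 * ((A + a) * inner ℝ v d) := by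
    rw [← hq]; ring
  have e6 : a ^ 2 * (L ^ 2 * ‖d‖ ^ 2) = (A + a) * L * ‖d‖ ^ 2 := by
    rw [← hq]; ring
  have e7 : a ^ 2 * (L ^ 2 / 4 * ‖d‖ ^ 2) = (A + a) * L * ‖d‖ ^ 2 / 4 := by
    rw [← hq]; ring
  rw [mul_add, mul_add, e5, e6, e7, e1] at e4
  have h1' := mul_le_mul_of_nonneg_left h1 hA
  have h2' := mul_le_mul_of_nonneg_left h2 ha.le
  have i1 : inner ℝ v (y - y') = - inner ℝ v (y' - y) := by
    rw [← inner_neg_right, neg_sub]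
  have i2 : inner ℝ v (u - xs) = - inner ℝ v (y' - u) - inner ℝ v (xs - y') := by
    rw [← inner_neg_right, ← inner_sub_right]; congr 1; abel
  rw [e2]
  rw [i2]
  rw [i1] at h1'
  nlinarith

/-- The length of the tensor step in iteration `k`. -/
noncomputable def InnerTrace.stepLength (t : InnerTrace n) (k : ℕ) : ℝ :=
  ‖t.y (k + 1) - extrapolate (t.A k) (t.L k) (t.y k) (t.u k)‖

section Run

variable {g : Euc n → ℝ} {t : InnerTrace n} {z : Euc n} {N : ℕ}

lemma InnerTrace.IsRun.A_nonneg (h : t.IsRun p M g z N) : ∀ k ≤ N, 0 ≤ t.A k := by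
  intro k
  induction k with
  | zero => intro _; rw [h.A_zero]
  | succ k ih =>
    intro hk
    rw [(h.step k hk).A_succ]
    have := stepWeight_pos (A := t.A k) (h.step k hk).L_pos
    have := ih (by omega)
    positivity

lemma InnerTrace.IsRun.A_pos (h : t.IsRun p M g z N) {k : ℕ} (hk : k < N) : 0 < t.A (k + 1) := by
  rw [(h.step k hk).A_succ]
  have := stepWeight_pos (A := t.A k) (h.step k hk).L_pos
  have := h.A_nonneg k hk.le
  positivity

lemma InnerTrace.IsRun.potential (hp : 2 ≤ p) (hM : 0 ≤ M) (hg : HasLipschitzDeriv p M g)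
    (hconv : ConvexOn ℝ Set.univ g) (h : t.IsRun p M g z N) (xs : Euc n) : ∀ k ≤ N,
    t.A k * (g (t.y k) - g xs) + 1 / 2 * ‖t.u k - xs‖ ^ 2
      + 3 / 8 * ∑ j ∈ Finset.range k, t.A (j + 1) * t.L j * t.stepLength j ^ 2
      ≤ 1 / 2 * ‖z - xs‖ ^ 2 := by
  intro k
  induction k with
  | zero => intro _; simp [h.A_zero, h.u_zero]
  | succ k ih =>
    intro hk
    have hs := h.step k hk
    have hd := hg.differentiable hp
    have htan : ∀ w, g (t.y (k + 1)) + inner ℝ (gradient g (t.y (k + 1))) (w - t.y (k + 1))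
        ≤ g w := by
      intro w
      rw [inner_gradient_left]
      exact hconv.add_fderiv_le hd _ _
    have := potential_step (h.A_nonneg k (by omega)) hs.L_pos (htan (t.y k)) (htan xs)
      (hg.norm_gradient_prox_le_half hp hM hs.L_pos hs.y_succ hs.upper)
    rw [Finset.sum_range_succ, hs.u_succ]
    have ih' := ih (by omega)
    rw [← hs.A_succ] at this
    unfold InnerTrace.stepLength at *
    linarith

/-- This form of the lower condition on `L_k` is what the growth of `A_k` depends on: a large `L_k`
entails a long step, which is expensive in the potential. -/
lemma InnerTrace.IsRun.L_le (h : t.IsRun p M g z N) {k : ℕ}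
    (hk : k < N) : t.L k ≤ 4 * (p + 1) * M / (p ! : ℝ) * t.stepLength k ^ (p - 1) := by
  have hs := h.step k hk
  have h1 := mul_le_mul_of_nonneg_left hs.lower hs.L_pos.le
  have hL := hs.L_pos
  have e : t.L k * (2 * (p + 1) * M / (p ! * t.L k) * t.stepLength k ^ (p - 1))
      = (4 * (p + 1) * M / (p ! : ℝ) * t.stepLength k ^ (p - 1)) / 2 := by
    field_simp
    ring
  unfold InnerTrace.stepLength at *
  linarith

end Run

end

/-! ### Growth of `A_k` -/

section Growth

/-- Concavity of `t ↦ t^β`, with the tangent taken at the upper point `b`; it is Bernoulli's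
inequality for `a / b`. -/
lemma rpow_sub_rpow_ge {a b β : ℝ} (ha : 0 ≤ a) (hb : 0 < b) (hβ0 : 0 ≤ β) (hβ1 : β ≤ 1) :
    β * b ^ (β - 1) * (b - a) ≤ b ^ β - a ^ β := by
  have h := rpow_one_add_le_one_add_mul_self (s := a / b - 1)
    (by have : 0 ≤ a / b := by positivity
        linarith) hβ0 hβ1
  rw [add_sub_cancel, Real.div_rpow ha hb.le, div_le_iff₀ (by positivity)] at h
  have e : b ^ β = b ^ (β - 1) * b := by
    rw [← Real.rpow_add_one hb.ne', sub_add_cancel]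
  have e2 : (1 + β * (a / b - 1)) * b ^ β = b ^ β + β * b ^ (β - 1) * (a - b) := by
    rw [add_mul, one_mul, e]
    field_simp
  linarith

/-- Discrete version of the differential inequality `T' ≥ (T / C)^γ`. -/
lemma growth_of_recurrence {C γ β : ℝ} (hC : 0 < C) (hβ0 : 0 ≤ β) (hβ1 : β ≤ 1)
    (hγ : γ = 1 - β) {T : ℕ → ℝ} {N : ℕ} (hT0 : T 0 = 0)
    (hpos : ∀ k < N, 0 < T (k + 1))
    (hrec : ∀ k < N, (T (k + 1) / C) ^ γ ≤ T (k + 1) - T k) :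
    ∀ k ≤ N, k * (β * C ^ (-γ)) ≤ T k ^ β := by
  have hnn : ∀ k ≤ N, 0 ≤ T k := by
    intro k hk
    cases k with
    | zero => rw [hT0]
    | succ k => exact (hpos k hk).le
  intro k
  induction k with
  | zero => intro _; simpa using Real.rpow_nonneg hT0.ge β
  | succ k ih =>
    intro hk
    have hb := hpos k hk
    have h1 := rpow_sub_rpow_ge (hnn k (by omega)) hb hβ0 hβ1
    have h2 : β * C ^ (-γ) ≤ β * T (k + 1) ^ (β - 1) * (T (k + 1) - T k) := by
      have h3 := mul_le_mul_of_nonneg_left (hrec k hk)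
        (by positivity : 0 ≤ β * T (k + 1) ^ (β - 1))
      refine le_trans (le_of_eq ?_) h3
      rw [Real.div_rpow hb.le hC.le, Real.rpow_neg hC.le, hγ, div_eq_mul_inv, mul_assoc,
        ← mul_assoc (T (k + 1) ^ (β - 1)), ← Real.rpow_add hb]
      simp
    have := ih (by omega)
    push_cast
    linarith

variable {p : ℕ}

/-- Lower bound for the growth of `A_k` in the inner method. -/
lemma growth_bound (hp : 2 ≤ p) {κ S : ℝ} (hκ : 0 < κ) (hS : 0 < S) {A L h : ℕ → ℝ} {N : ℕ}
    (hA0 : A 0 = 0) (hL : ∀ k < N, 0 < L k)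
    (hA : ∀ k < N, A (k + 1) = A k + stepWeight (A k) (L k))
    (hApos : ∀ k < N, 0 < A (k + 1)) (hh : ∀ k, 0 ≤ h k)
    (hLh : ∀ k < N, L k ≤ κ * h k ^ (p - 1))
    (hsum : ∑ k ∈ Finset.range N, A (k + 1) * L k * h k ^ 2 ≤ S) :
    (2 * N / (p + 1)) ^ ((3 * (p : ℝ) + 1) / 2)
      ≤ 2 ^ (p + 1) * κ * S ^ (((p : ℝ) - 1) / 2) * A N := by
  have hp2 : (2 : ℝ) ≤ p := by exact_mod_cast hp
  set s : ℝ := 3 * p + 1 with hs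
  have hs0 : 0 < s := by linarith
  have hAnn : ∀ k ≤ N, 0 ≤ A k := by
    intro k hk
    cases k with
    | zero => rw [hA0]
    | succ k => exact (hApos k hk).le
  -- With this exponent the powers of `L` cancel in `(A L h²)^α (L^(-1/2))^(1-α)` once `h^(p-1)` is
  -- replaced by its lower bound `L/κ`: `α + 2/s = (p+1)/s`.
  set α : ℝ := (p - 1) / s with hα
  have hα0 : 0 < α := div_pos (by linarith) hs0
  have h1α : 1 - α = (2 * p + 2) / s := by rw [hα, hs]; field_simp; ring
  have h1α0 : 0 < 1 - α := by rw [h1α]; positivity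
  set w : ℕ → ℝ := fun k => (Real.sqrt (L k))⁻¹ with hw
  have hw0 : ∀ k, 0 ≤ w k := fun k => by positivity
  have hsqrt : ∀ K ≤ N, ∑ k ∈ Finset.range K, w k ≤ 2 * Real.sqrt (A K) := by
    intro K
    induction K with
    | zero => intro _; simp
    | succ K ih =>
      intro hK
      rw [Finset.sum_range_succ, hA K hK]
      have := sqrt_add_stepWeight (hAnn K (by omega)) (hL K hK)
      have := ih (by omega)
      simp only [hw] at *
      linarith
  -- Hölder's inequality bounds `T K` by `C · A_K^((p+1)/s)`. Since the increments of `T` are the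
  -- `A_{k+1}^α`, this closes into a recurrence for `T` alone, with `γ = (p-1)/(p+1)`.
  set T : ℕ → ℝ := fun K => ∑ k ∈ Finset.range K, A (k + 1) ^ α with hT
  set C : ℝ := κ ^ (2 / s) * S ^ α * 2 ^ (1 - α) with hC
  have hC0 : 0 < C := by positivity
  have hpt : ∀ k < N, A (k + 1) ^ α
      ≤ κ ^ (2 / s) * ((A (k + 1) * L k * h k ^ 2) ^ α * w k ^ (1 - α)) := by
    intro k hk
    have hLk := hL k hk
    have hAk := hApos k hk
    have hhk : 0 < h k := by
      refine lt_of_le_of_ne (hh k) fun h0 => ?_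
      have := hLh k hk
      rw [← h0, zero_pow (by omega), mul_zero] at this
      linarith
    have hh2 : (L k / κ) ^ (2 / s) ≤ (h k ^ 2) ^ α := by
      have : L k / κ ≤ h k ^ (p - 1) := by
        rw [div_le_iff₀ hκ, mul_comm]; exact hLh k hk
      refine (Real.rpow_le_rpow (by positivity) this (by positivity)).trans (le_of_eq ?_)
      rw [← Real.rpow_natCast, ← Real.rpow_natCast, ← Real.rpow_mul hhk.le,
        ← Real.rpow_mul hhk.le, hα, Nat.cast_sub (by omega)]
      congr 1
      push_cast
      ring
    have hwk : w k ^ (1 - α) = L k ^ (-((p + 1) / s)) := by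
      simp only [hw]
      rw [Real.sqrt_eq_rpow, ← Real.rpow_neg hLk.le, ← Real.rpow_mul hLk.le, h1α]
      congr 1
      ring
    rw [Real.mul_rpow (by positivity) (by positivity), Real.mul_rpow hAk.le hLk.le, hwk]
    have e : κ ^ (2 / s) * (A (k + 1) ^ α * L k ^ α * (L k / κ) ^ (2 / s)
        * L k ^ (-((p + 1) / s))) = A (k + 1) ^ α := by
      rw [Real.div_rpow hLk.le hκ.le]
      have e1 : L k ^ α * L k ^ (2 / s) * L k ^ (-((p + 1) / s)) = 1 := by
        rw [← Real.rpow_add hLk, ← Real.rpow_add hLk, hα]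
        convert Real.rpow_zero _ using 2
        field_simp
        ring
      have e2 : κ ^ (2 / s) ≠ 0 := by positivity
      field_simp
      linear_combination e1
    rw [← e]
    gcongr
    rw [e]
  have hTle : ∀ K ≤ N, T K ≤ C * A K ^ ((p + 1) / s) := by
    intro K hK
    have hlt : ∀ k ∈ Finset.range K, k < N := fun k hk => (Finset.mem_range.1 hk).trans_le hK
    have hconj : (1 / α).HolderConjugate (1 / (1 - α)) := by
      rw [Real.holderConjugate_iff]
      refine ⟨by rw [lt_div_iff₀ hα0]; linarith, by simp⟩
    have hH := Real.inner_le_Lp_mul_Lq_of_nonneg (Finset.range K) hconj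
      (f := fun k => (A (k + 1) * L k * h k ^ 2) ^ α) (g := fun k => w k ^ (1 - α))
      (fun k hk => by
        have := hApos k (hlt k hk)
        have := hL k (hlt k hk)
        positivity) (fun k _ => by have := hw0 k; positivity)
    have s1 : ∑ k ∈ Finset.range K, ((A (k + 1) * L k * h k ^ 2) ^ α) ^ (1 / α)
        = ∑ k ∈ Finset.range K, A (k + 1) * L k * h k ^ 2 := by
      refine Finset.sum_congr rfl fun k hk => ?_
      have := hApos k (hlt k hk)
      have := hL k (hlt k hk)
      rw [← Real.rpow_mul (by positivity), mul_one_div_cancel hα0.ne', Real.rpow_one]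
    have s2 : ∑ k ∈ Finset.range K, (w k ^ (1 - α)) ^ (1 / (1 - α))
        = ∑ k ∈ Finset.range K, w k := by
      refine Finset.sum_congr rfl fun k hk => ?_
      rw [← Real.rpow_mul (hw0 k), mul_one_div_cancel h1α0.ne', Real.rpow_one]
    rw [s1, s2, one_div_one_div, one_div_one_div] at hH
    have s3 : ∑ k ∈ Finset.range K, A (k + 1) * L k * h k ^ 2 ≤ S := by
      refine le_trans (Finset.sum_le_sum_of_subset_of_nonneg
        (Finset.range_subset_range.2 hK) fun k hk _ => ?_) hsum
      have := hApos k (Finset.mem_range.1 hk)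
      have := hL k (Finset.mem_range.1 hk)
      positivity
    have s0 : 0 ≤ ∑ k ∈ Finset.range K, A (k + 1) * L k * h k ^ 2 :=
      Finset.sum_nonneg fun k hk => by
        have := hApos k (hlt k hk)
        have := hL k (hlt k hk)
        positivity
    have s4 : 0 ≤ ∑ k ∈ Finset.range K, w k := Finset.sum_nonneg fun k _ => hw0 k
    calc T K ≤ ∑ k ∈ Finset.range K,
          κ ^ (2 / s) * ((A (k + 1) * L k * h k ^ 2) ^ α * w k ^ (1 - α)) :=
          Finset.sum_le_sum fun k hk => hpt k (hlt k hk)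
      _ ≤ κ ^ (2 / s) * (S ^ α * (2 * Real.sqrt (A K)) ^ (1 - α)) := by
          rw [← Finset.mul_sum]
          refine mul_le_mul_of_nonneg_left (hH.trans ?_) (by positivity)
          gcongr
          exact hsqrt K hK
      _ = C * A K ^ ((p + 1) / s) := by
          rw [Real.mul_rpow (by norm_num) (Real.sqrt_nonneg _), Real.sqrt_eq_rpow,
            ← Real.rpow_mul (hAnn K hK), hC, h1α]
          rw [show 1 / 2 * ((2 * (p : ℝ) + 2) / s) = (p + 1) / s by ring]
          ring
  set β : ℝ := 2 / (p + 1) with hβ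
  have hβ0 : 0 < β := by positivity
  have hβ1 : β ≤ 1 := by rw [hβ, div_le_one (by positivity)]; linarith
  have hTpos : ∀ k < N, 0 < T (k + 1) := by
    intro k hk
    refine Finset.sum_pos (fun j hj => ?_) ⟨0, by simp⟩
    have := hApos j (by have := Finset.mem_range.1 hj; omega)
    positivity
  have hgrow := growth_of_recurrence hC0 hβ0.le hβ1 (γ := 1 - β) rfl (T := T) (N := N)
    (by simp [hT]) hTpos (fun k hk => by
      have e : T (k + 1) - T k = A (k + 1) ^ α := by
        simp only [hT]; rw [Finset.sum_range_succ]; ring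
      rw [e]
      have hle : T (k + 1) / C ≤ A (k + 1) ^ ((p + 1) / s) := by
        rw [div_le_iff₀ hC0, mul_comm]; exact hTle (k + 1) hk
      have h1β : 0 ≤ 1 - β := by linarith
      refine (Real.rpow_le_rpow (div_nonneg (hTpos k hk).le hC0.le) hle h1β).trans (le_of_eq ?_)
      rw [← Real.rpow_mul (hApos k hk).le]
      congr 1
      rw [hβ, hα]
      field_simp
      ring) N le_rfl
  have hTN : 0 ≤ T N := Finset.sum_nonneg fun j hj => by
    have := hApos j (Finset.mem_range.1 hj)
    positivity
  have h5 : T N ^ β ≤ C ^ β * A N ^ (2 / s) := by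
    refine (Real.rpow_le_rpow hTN (hTle N le_rfl) hβ0.le).trans (le_of_eq ?_)
    rw [Real.mul_rpow hC0.le (Real.rpow_nonneg (hAnn N le_rfl) _),
      ← Real.rpow_mul (hAnn N le_rfl)]
    congr 2
    rw [hβ]
    field_simp
  have h6 : 2 * N / (p + 1) ≤ C * A N ^ (2 / s) := by
    have h7 := mul_le_mul_of_nonneg_left (hgrow.trans h5)
      (by positivity : 0 ≤ C ^ (1 - β))
    have e1 : C ^ (1 - β) * (N * (β * C ^ (-(1 - β)))) = 2 * N / (p + 1) := by
      rw [Real.rpow_neg hC0.le, hβ]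
      have : C ^ (1 - 2 / ((p : ℝ) + 1)) ≠ 0 := by positivity
      field_simp
    have e2 : C ^ (1 - β) * (C ^ β * A N ^ (2 / s)) = C * A N ^ (2 / s) := by
      rw [← mul_assoc, ← Real.rpow_add hC0, sub_add_cancel, Real.rpow_one]
    rwa [e1, e2] at h7
  refine (Real.rpow_le_rpow (by positivity) h6 (by positivity : 0 ≤ s / 2)).trans (le_of_eq ?_)
  have hAN := hAnn N le_rfl
  rw [Real.mul_rpow hC0.le (Real.rpow_nonneg hAN _), ← Real.rpow_mul hAN,
    show 2 / s * (s / 2) = 1 by field_simp, Real.rpow_one, hC,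
    Real.mul_rpow (by positivity) (by positivity), Real.mul_rpow (by positivity) (by positivity),
    ← Real.rpow_mul hκ.le, ← Real.rpow_mul hS.le, ← Real.rpow_mul (by norm_num),
    show 2 / s * (s / 2) = 1 by field_simp, Real.rpow_one, h1α, hα,
    show ((p : ℝ) - 1) / s * (s / 2) = (p - 1) / 2 by field_simp,
    show (2 * (p : ℝ) + 2) / s * (s / 2) = ((p + 1 : ℕ) : ℝ) by push_cast; field_simp,
    Real.rpow_natCast]
  ring

/-- The numerical inequality behind the constant `c` of the inner method. -/
lemma rateConst_bound (hp : 2 ≤ p) :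
    ((p + 1 : ℝ) / 2) ^ ((3 * (p : ℝ) + 1) / 2) * 2 ^ (p + 1)
      * (4 / 3 : ℝ) ^ (((p : ℝ) - 1) / 2) * 2 ≤ 2 ^ ((3 * ((p : ℝ) + 1) ^ 2 + 4) / 4) := by
  have hp2 : (2 : ℝ) ≤ p := by exact_mod_cast hp
  -- For `m = p + 1` this is `(p+1)/2 ≤ 2^((2p-1)/4)`. With `4/3 ≤ √2` every factor becomes a power
  -- of two; the total exponent is `(6p²+9p+13)/8`, against the allowed `(6p²+12p+14)/8`.
  have hnat : ∀ m : ℕ, 3 ≤ m → m ^ 4 ≤ 2 ^ (2 * m + 1) := by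
    intro m hm
    induction m, hm using Nat.le_induction with
    | base => norm_num
    | succ m hm ih =>
      have h1 : (m + 1) ^ 4 ≤ 4 * m ^ 4 := by
        have h2 : 3 * (m + 1) ≤ 4 * m := by omega
        have h3 := Nat.pow_le_pow_left h2 4
        rw [mul_pow, mul_pow] at h3
        have : (0 : ℕ) ≤ m ^ 4 := Nat.zero_le _
        omega
      calc (m + 1) ^ 4 ≤ 4 * m ^ 4 := h1
        _ ≤ 4 * 2 ^ (2 * m + 1) := by gcongr
        _ = 2 ^ (2 * (m + 1) + 1) := by ring
  have h1 : ((p + 1 : ℝ) / 2) ≤ 2 ^ ((2 * (p : ℝ) - 1) / 4) := by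
    have h2 : ((p + 1 : ℝ) / 2) ^ (4 : ℕ) ≤ (2 ^ ((2 * (p : ℝ) - 1) / 4)) ^ (4 : ℕ) := by
      have h3 : ((p + 1 : ℕ) : ℝ) ^ 4 ≤ 2 ^ (2 * (p + 1) + 1) := by
        exact_mod_cast hnat (p + 1) (by omega)
      rw [← Real.rpow_natCast (2 ^ ((2 * (p : ℝ) - 1) / 4)), ← Real.rpow_mul (by norm_num),
        show (2 * (p : ℝ) - 1) / 4 * ((4 : ℕ) : ℝ) = ((2 * (p + 1) + 1 : ℕ) : ℝ) - ((4 : ℕ) : ℝ) by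
          push_cast; ring, Real.rpow_sub (by norm_num), Real.rpow_natCast, Real.rpow_natCast,
        div_pow]
      push_cast at h3
      gcongr
    exact le_of_pow_le_pow_left₀ (by norm_num) (by positivity) h2
  have h4 : (4 / 3 : ℝ) ≤ 2 ^ (1 / 2 : ℝ) := by
    rw [← Real.sqrt_eq_rpow]
    exact Real.le_sqrt_of_sq_le (by norm_num)
  have e1 : ((p + 1 : ℝ) / 2) ^ ((3 * (p : ℝ) + 1) / 2)
      ≤ 2 ^ ((2 * (p : ℝ) - 1) / 4 * ((3 * (p : ℝ) + 1) / 2)) := by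
    rw [Real.rpow_mul (by norm_num)]
    exact Real.rpow_le_rpow (by positivity) h1 (by positivity)
  have e2 : (4 / 3 : ℝ) ^ (((p : ℝ) - 1) / 2) ≤ 2 ^ (1 / 2 * (((p : ℝ) - 1) / 2)) := by
    rw [Real.rpow_mul (by norm_num)]
    exact Real.rpow_le_rpow (by positivity) h4 (by linarith)
  calc _ ≤ (2 : ℝ) ^ ((2 * (p : ℝ) - 1) / 4 * ((3 * (p : ℝ) + 1) / 2)) * 2 ^ (p + 1)
        * 2 ^ (1 / 2 * (((p : ℝ) - 1) / 2)) * 2 := by gcongr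
    _ = 2 ^ ((2 * (p : ℝ) - 1) / 4 * ((3 * (p : ℝ) + 1) / 2) + ((p + 1 : ℕ) : ℝ)
        + 1 / 2 * (((p : ℝ) - 1) / 2) + 1) := by
      rw [Real.rpow_add (by norm_num), Real.rpow_add (by norm_num), Real.rpow_add (by norm_num),
        Real.rpow_natCast, Real.rpow_one]
    _ ≤ _ := by
      refine Real.rpow_le_rpow_of_exponent_le (by norm_num) ?_
      push_cast
      nlinarith

end Growth

/-! ### Rate of convergence of the inner method -/

section Rate

variable {p n : ℕ} {M : ℝ} {g : Euc n → ℝ} {t : InnerTrace n} {z : Euc n} {N : ℕ}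

lemma InnerTrace.stepLength_nonneg (t : InnerTrace n) (k : ℕ) : 0 ≤ t.stepLength k :=
  norm_nonneg _

/-- At a minimizer `xs` the other terms of the potential are nonnegative; 4/3 is the quotient of 1/2
and 3/8. -/
lemma InnerTrace.IsRun.sum_le (hp : 2 ≤ p) (hM : 0 ≤ M) (hg : HasLipschitzDeriv p M g)
    (hconv : ConvexOn ℝ Set.univ g) (h : t.IsRun p M g z N) {xs : Euc n}
    (hxs : ∀ x, g xs ≤ g x) {k : ℕ} (hk : k ≤ N) :
    ∑ j ∈ Finset.range k, t.A (j + 1) * t.L j * t.stepLength j ^ 2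
      ≤ 4 / 3 * ‖z - xs‖ ^ 2 := by
  have h1 := h.potential hp hM hg hconv xs k hk
  have h2 := mul_nonneg (h.A_nonneg k hk) (sub_nonneg.2 (hxs (t.y k)))
  have h3 := sq_nonneg ‖t.u k - xs‖
  linarith

lemma InnerTrace.IsRun.residual_le (hp : 2 ≤ p) (hM : 0 ≤ M) (hg : HasLipschitzDeriv p M g)
    (hconv : ConvexOn ℝ Set.univ g) (h : t.IsRun p M g z N) (xs : Euc n) {k : ℕ} (hk : k ≤ N) :
    t.A k * (g (t.y k) - g xs) ≤ 1 / 2 * ‖z - xs‖ ^ 2 := by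
  have h1 := h.potential hp hM hg hconv xs k hk
  have h2 : 0 ≤ ∑ j ∈ Finset.range k, t.A (j + 1) * t.L j * t.stepLength j ^ 2 :=
    Finset.sum_nonneg fun j hj => by
      have := (h.A_pos ((Finset.mem_range.1 hj).trans_le hk)).le
      have := (h.step j ((Finset.mem_range.1 hj).trans_le hk)).L_pos
      positivity
  have h3 := sq_nonneg ‖t.u k - xs‖
  linarith

lemma InnerTrace.IsRun.norm_u_sub_le (hp : 2 ≤ p) (hM : 0 ≤ M) (hg : HasLipschitzDeriv p M g)
    (hconv : ConvexOn ℝ Set.univ g) (h : t.IsRun p M g z N) {xs : Euc n}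
    (hxs : ∀ x, g xs ≤ g x) {k : ℕ} (hk : k ≤ N) : ‖t.u k - xs‖ ≤ ‖z - xs‖ := by
  have h1 := h.potential hp hM hg hconv xs k hk
  have h2 : 0 ≤ ∑ j ∈ Finset.range k, t.A (j + 1) * t.L j * t.stepLength j ^ 2 :=
    Finset.sum_nonneg fun j hj => by
      have := (h.A_pos ((Finset.mem_range.1 hj).trans_le hk)).le
      have := (h.step j ((Finset.mem_range.1 hj).trans_le hk)).L_pos
      positivity
  have h3 := mul_nonneg (h.A_nonneg k hk) (sub_nonneg.2 (hxs (t.y k)))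
  exact le_of_sq_le_sq (by linarith) (norm_nonneg _)

/-- The rate of convergence of the inner method. -/
lemma InnerTrace.IsRun.rate (hp : 2 ≤ p) (hM : 0 < M) (hg : HasLipschitzDeriv p M g)
    (hconv : ConvexOn ℝ Set.univ g) (h : t.IsRun p M g z N) (hN : 1 ≤ N) {xs : Euc n}
    (hxs : ∀ x, g xs ≤ g x) :
    (g (t.y N) - g xs) * (N : ℝ) ^ ((3 * (p : ℝ) + 1) / 2)
      ≤ rateConst p * M * ‖z - xs‖ ^ (p + 1) := by
  have hp2 : (2 : ℝ) ≤ p := by exact_mod_cast hp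
  set R := ‖z - xs‖ with hR
  have hr := h.residual_le hp hM.le hg hconv xs le_rfl
  have hAN : 0 < t.A N := by
    obtain ⟨m, rfl⟩ : ∃ m, N = m + 1 := ⟨N - 1, by omega⟩
    exact h.A_pos (Nat.lt_succ_self m)
  have hrc : 0 < rateConst p := by unfold rateConst; positivity
  have hres := sub_nonneg.2 (hxs (t.y N))
  -- The growth bound needs a positive budget `S`, so a start at the minimizer is separate: there
  -- `A_N > 0` forces a zero residual.
  rcases (norm_nonneg (z - xs)).eq_or_lt with h0 | h0
  · rw [← hR] at h0
    rw [← hR, ← h0] at hr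
    have : g (t.y N) - g xs = 0 := by
      refine le_antisymm ?_ hres
      by_contra hc
      have := mul_pos hAN (not_le.1 hc)
      norm_num at hr
      linarith
    rw [this, ← h0]
    simp
  · rw [← hR] at h0 hr
    set κ : ℝ := 4 * (p + 1) * M / (p ! : ℝ) with hκ
    have hg1 := growth_bound hp (κ := κ) (S := 4 / 3 * R ^ 2) (by positivity) (by positivity)
      h.A_zero (fun k hk => (h.step k hk).L_pos) (fun k hk => (h.step k hk).A_succ)
      (fun k hk => h.A_pos hk) t.stepLength_nonneg (fun k hk => h.L_le hk)
      (h.sum_le hp hM.le hg hconv hxs le_rfl)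
    have e1 : (4 / 3 * R ^ 2) ^ (((p : ℝ) - 1) / 2)
        = (4 / 3) ^ (((p : ℝ) - 1) / 2) * R ^ (p - 1) := by
      rw [Real.mul_rpow (by norm_num) (by positivity), ← Real.rpow_natCast,
        ← Real.rpow_mul h0.le, ← Real.rpow_natCast, Nat.cast_sub (by omega)]
      congr 2
      push_cast
      ring
    have e2 : (N : ℝ) ^ ((3 * (p : ℝ) + 1) / 2) = ((p + 1 : ℝ) / 2) ^ ((3 * (p : ℝ) + 1) / 2)
        * (2 * N / (p + 1)) ^ ((3 * (p : ℝ) + 1) / 2) := by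
      rw [← Real.mul_rpow (by positivity) (by positivity)]
      congr 1
      field_simp
    have hc := rateConst_bound hp
    set X : ℝ := ((p + 1 : ℝ) / 2) ^ ((3 * (p : ℝ) + 1) / 2) with hX
    set Y : ℝ := (4 / 3) ^ (((p : ℝ) - 1) / 2) with hY
    have hX0 : 0 ≤ X := by positivity
    have hY0 : 0 ≤ Y := by positivity
    rw [e1] at hg1
    have hRp : R ^ (p + 1) = R ^ (p - 1) * R ^ 2 := by
      rw [← pow_add]; congr 1; omega
    calc (g (t.y N) - g xs) * (N : ℝ) ^ ((3 * (p : ℝ) + 1) / 2)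
        ≤ (g (t.y N) - g xs) * (X * (2 ^ (p + 1) * κ * (Y * R ^ (p - 1)) * t.A N)) := by
          rw [e2]; gcongr
      _ = X * 2 ^ (p + 1) * κ * Y * R ^ (p - 1) * (t.A N * (g (t.y N) - g xs)) := by ring
      _ ≤ X * 2 ^ (p + 1) * κ * Y * R ^ (p - 1) * (1 / 2 * R ^ 2) := by gcongr
      _ = (X * 2 ^ (p + 1) * Y * 2) * ((p + 1) * M / (p ! : ℝ)) * R ^ (p + 1) := by
          rw [hRp, hκ]; ring
      _ ≤ 2 ^ ((3 * ((p : ℝ) + 1) ^ 2 + 4) / 4) * ((p + 1) * M / (p ! : ℝ)) * R ^ (p + 1) := by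
          gcongr
      _ = rateConst p * M * R ^ (p + 1) := by unfold rateConst; ring

end Rate

/-! ### The regularized objective and the restarts -/

section Regularized

variable {p n : ℕ} {M Δ₀ ε : ℝ} {x₀ : Euc n} {f : Euc n → ℝ}

lemma regParam_pos (hΔ : 0 < Δ₀) (hε : 0 < ε) : 0 < regParam Δ₀ ε := by
  unfold regParam; positivity

lemma convexOn_addQuad (hf : ConvexOn ℝ Set.univ f) {L : ℝ} (hL : 0 ≤ L) (z : Euc n) :
    ConvexOn ℝ Set.univ (addQuad f L z) := by
  have h1 : ConvexOn ℝ Set.univ (fun x : Euc n => dist x z ^ 2) :=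
    (convexOn_dist z convex_univ).pow (fun _ _ => dist_nonneg) 2
  have h2 := hf.add (h1.smul (by positivity : 0 ≤ L / 2))
  refine h2.congr fun x _ => ?_
  simp [addQuad, dist_eq_norm]

lemma le_addQuad {L : ℝ} (hL : 0 ≤ L) (f : Euc n → ℝ) (z x : Euc n) : f x ≤ addQuad f L z x := by
  unfold addQuad
  have : 0 ≤ L / 2 * ‖x - z‖ ^ 2 := by positivity
  linarith

lemma bddBelow_addQuad (hf : BddBelow (Set.range f)) {L : ℝ} (hL : 0 ≤ L) (z : Euc n) :
    BddBelow (Set.range (addQuad f L z)) := by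
  obtain ⟨b, hb⟩ := hf
  refine ⟨b, ?_⟩
  rintro _ ⟨x, rfl⟩
  exact (hb ⟨x, rfl⟩).trans (le_addQuad hL f z x)

lemma exists_forall_addQuad_le (hc : Continuous f) (hb : BddBelow (Set.range f)) {L : ℝ}
    (hL : 0 < L) (z : Euc n) : ∃ xs, ∀ x, addQuad f L z xs ≤ addQuad f L z x := by
  obtain ⟨b, hb⟩ := hb
  have hcont : Continuous (addQuad f L z) := by unfold addQuad; fun_prop
  refine hcont.exists_forall_le (Filter.tendsto_atTop_mono
    (f := fun y => b + L / 2 * ‖y - z‖ ^ 2) (fun y => ?_) ?_)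
  · exact add_le_add_left (hb ⟨y, rfl⟩) _
  · refine Filter.tendsto_atTop_add_const_left _ _
      (Filter.Tendsto.const_mul_atTop (by positivity) ?_)
    exact (Filter.tendsto_pow_atTop (by norm_num)).comp (tendsto_norm_cocompact_atTop.comp
      (Homeomorph.subRight z).isClosedEmbedding.tendsto_cocompact)

/-- The regularized objective has a minimizer with quadratic growth, and the initial residual
is bounded by `Δ₀`. -/
lemma IsProblem.exists_minimizer (hp : 2 ≤ p) (hΔ : 0 < Δ₀) (hε : 0 < ε)
    (h : IsProblem p M Δ₀ x₀ f) :
    ∃ xs, (∀ x, addQuad f (regParam Δ₀ ε) x₀ xs ≤ addQuad f (regParam Δ₀ ε) x₀ x) ∧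
      (∀ x, regParam Δ₀ ε / 2 * ‖x - xs‖ ^ 2
        ≤ addQuad f (regParam Δ₀ ε) x₀ x - addQuad f (regParam Δ₀ ε) x₀ xs) ∧
      addQuad f (regParam Δ₀ ε) x₀ x₀ - addQuad f (regParam Δ₀ ε) x₀ xs ≤ Δ₀ := by
  have hμ := regParam_pos hΔ hε
  obtain ⟨xs, hxs⟩ := exists_forall_addQuad_le
    (h.hasLipschitzDeriv.differentiable hp).continuous h.bddBelow hμ x₀
  refine ⟨xs, hxs, fun x => ?_, ?_⟩
  · have := h.convex.quadratic_growth (c := x₀) (y := xs) hxs x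
    unfold addQuad
    linarith
  · have h1 : addQuad f (regParam Δ₀ ε) x₀ x₀ = f x₀ := by simp [addQuad]
    have h2 := le_addQuad hμ.le f x₀ xs
    have h3 : ⨅ x, f x ≤ f xs := ciInf_le h.bddBelow xs
    have h4 := h.gap
    rw [h1]
    linarith

/-- The choice of `μ` gives `μ² ‖x - xs‖² ≤ 2 μ Δ₀ = (ε/4)²`. -/
lemma regParam_mul_norm_le (hΔ : 0 < Δ₀) (hε : 0 < ε) {g : Euc n → ℝ} {x xs : Euc n}
    (hgrow : regParam Δ₀ ε / 2 * ‖x - xs‖ ^ 2 ≤ g x - g xs) (hres : g x - g xs ≤ Δ₀) :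
    regParam Δ₀ ε * ‖x - xs‖ ≤ ε / 4 := by
  have hμ := regParam_pos hΔ hε
  have e : regParam Δ₀ ε * Δ₀ = ε ^ 2 / 32 := by unfold regParam; field_simp
  refine le_of_sq_le_sq ?_ (by positivity)
  have := mul_le_mul_of_nonneg_left (hgrow.trans hres) hμ.le
  rw [e] at this
  nlinarith

lemma residualBound_pos (hΔ : 0 < Δ₀) (k : ℕ) : 0 < residualBound Δ₀ k := by
  unfold residualBound; positivity

lemma residualBound_le (hΔ : 0 < Δ₀) (k : ℕ) : residualBound Δ₀ k ≤ Δ₀ := by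
  unfold residualBound
  exact div_le_self hΔ.le (one_le_pow₀ (by norm_num))

/-- One phase of the outer method halves the bound on the residual. -/
lemma phase_halves (hp : 2 ≤ p) (hM : 0 < M) (hΔ : 0 < Δ₀) (hε : 0 < ε) {g : Euc n → ℝ}
    (hg : HasLipschitzDeriv p M g) (hconv : ConvexOn ℝ Set.univ g) {xs : Euc n}
    (hxs : ∀ x, g xs ≤ g x) {t : InnerTrace n} {z : Euc n} {k : ℕ}
    (hgrow : regParam Δ₀ ε / 2 * ‖z - xs‖ ^ 2 ≤ g z - g xs)
    (hres : g z - g xs ≤ residualBound Δ₀ k)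
    (ht : t.IsRun p M g z (phaseLength p M Δ₀ ε k)) :
    g (t.y (phaseLength p M Δ₀ ε k)) - g xs ≤ residualBound Δ₀ (k + 1) := by
  have hp2 : (2 : ℝ) ≤ p := by exact_mod_cast hp
  set N := phaseLength p M Δ₀ ε k with hN
  set μ := regParam Δ₀ ε with hμd
  have hμ : 0 < μ := regParam_pos hΔ hε
  set D := residualBound Δ₀ k with hD
  have hD0 : 0 < D := residualBound_pos hΔ k
  have hc : 0 < rateConst p := by unfold rateConst; positivity
  -- `X` is the rate bound at the largest possible distance `√(2D/μ)`, divided by the target `D/2`;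
  -- `N_k` is chosen so that `N_k^((3p+1)/2) ≥ X`.
  set X : ℝ := 2 * rateConst p * M * (2 : ℝ) ^ (((p : ℝ) + 1) / 2)
      / μ ^ (((p : ℝ) + 1) / 2) * D ^ (((p : ℝ) - 1) / 2) with hX
  have hX0 : 0 < X := by positivity
  have hN1 : 1 ≤ N := le_max_right _ _
  have hXN : X ^ (2 / (3 * (p : ℝ) + 1)) ≤ N :=
    (Nat.le_ceil _).trans (Nat.cast_le.2 (le_max_left _ 1))
  have hXN' : X ≤ (N : ℝ) ^ ((3 * (p : ℝ) + 1) / 2) := by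
    have := Real.rpow_le_rpow (by positivity) hXN (by positivity : 0 ≤ (3 * (p : ℝ) + 1) / 2)
    rwa [← Real.rpow_mul hX0.le, show 2 / (3 * (p : ℝ) + 1) * ((3 * (p : ℝ) + 1) / 2) = 1 by
      field_simp, Real.rpow_one] at this
  have hrate := ht.rate hp hM hg hconv hN1 hxs
  have hR : ‖z - xs‖ ^ (p + 1) ≤ (2 * D / μ) ^ (((p : ℝ) + 1) / 2) := by
    have h1 : ‖z - xs‖ ^ 2 ≤ 2 * D / μ := by
      rw [le_div_iff₀ hμ]
      linarith
    have h2 := Real.rpow_le_rpow (by positivity) h1 (by positivity : 0 ≤ ((p : ℝ) + 1) / 2)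
    rwa [← Real.rpow_natCast, ← Real.rpow_mul (norm_nonneg _),
      show ((2 : ℕ) : ℝ) * (((p : ℝ) + 1) / 2) = ((p + 1 : ℕ) : ℝ) by push_cast; ring,
      Real.rpow_natCast] at h2
  have hfin : (g (t.y N) - g xs) * X ≤ D / 2 * X := by
    calc (g (t.y N) - g xs) * X ≤ (g (t.y N) - g xs) * (N : ℝ) ^ ((3 * (p : ℝ) + 1) / 2) :=
          mul_le_mul_of_nonneg_left hXN' (sub_nonneg.2 (hxs _))
      _ ≤ rateConst p * M * (2 * D / μ) ^ (((p : ℝ) + 1) / 2) := by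
          refine hrate.trans ?_
          gcongr
      _ = D / 2 * X := by
          rw [hX, Real.div_rpow (by positivity) hμ.le, Real.mul_rpow (by norm_num) hD0.le,
            show ((p : ℝ) + 1) / 2 = ((p : ℝ) - 1) / 2 + 1 by ring, Real.rpow_add_one hD0.ne']
          ring
  have := le_of_mul_le_mul_right hfin hX0
  have e : residualBound Δ₀ (k + 1) = D / 2 := by
    rw [hD]; unfold residualBound; rw [pow_succ]; field_simp
  rw [e]
  exact this

lemma OuterTrace.IsLoop.residual_le (hp : 2 ≤ p) (hM : 0 < M) (hΔ : 0 < Δ₀) (hε : 0 < ε)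
    (h : IsProblem p M Δ₀ x₀ f) {t : OuterTrace n} (ht : t.IsLoop p M Δ₀ ε x₀ f) {xs : Euc n}
    (hxs : ∀ x, addQuad f (regParam Δ₀ ε) x₀ xs ≤ addQuad f (regParam Δ₀ ε) x₀ x)
    (hgrow : ∀ x, regParam Δ₀ ε / 2 * ‖x - xs‖ ^ 2
        ≤ addQuad f (regParam Δ₀ ε) x₀ x - addQuad f (regParam Δ₀ ε) x₀ xs)
    (h0 : addQuad f (regParam Δ₀ ε) x₀ x₀ - addQuad f (regParam Δ₀ ε) x₀ xs ≤ Δ₀) :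
    ∀ k ≤ t.phases, addQuad f (regParam Δ₀ ε) x₀ (t.z k) - addQuad f (regParam Δ₀ ε) x₀ xs
      ≤ residualBound Δ₀ k := by
  intro k
  induction k with
  | zero => intro _; rw [ht.z_zero]; simpa [residualBound] using h0
  | succ k ih =>
    intro hk
    rw [ht.z_succ k hk]
    exact phase_halves hp hM hΔ hε (hasLipschitzDeriv_addQuad hp h.hasLipschitzDeriv _ _)
      (convexOn_addQuad h.convex (regParam_pos hΔ hε).le _) hxs (hgrow _) (ih (by omega))
      (ht.phase k hk)

/-- The gradient after a tensor step is controlled by the decrease of the function. -/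
lemma HasLipschitzDeriv.norm_fderiv_rpow_le (hp : 2 ≤ p) (hM : 0 < M)
    (h : HasLipschitzDeriv p M f) {x y : Euc n} (hy : IsTensorStep p (p * M) f x y) :
    ‖fderiv ℝ f y‖ ^ (((p : ℝ) + 1) / p)
      ≤ 8 * (p * M) ^ (1 / (p : ℝ)) * ((p + 1)! : ℝ) * (f x - f y) := by
  have hp2 : (2 : ℝ) ≤ p := by exact_mod_cast hp
  have hp0 : (p : ℝ) ≠ 0 := by positivity
  set H := ‖y - x‖ with hH
  have hH0 : 0 ≤ H := norm_nonneg _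
  set q : ℝ := (p + 1) / (p ! : ℝ) with hq
  have hq0 : 0 < q := by positivity
  have hq2 : q ≤ 2 := by
    rw [hq, div_le_iff₀ (by positivity)]
    have : (p : ℝ) ≤ (p ! : ℝ) := by exact_mod_cast Nat.self_le_factorial p
    linarith
  have hG := h.norm_fderiv_tensorStep_le hp hM.le hy
  have hd := h.tensorStep_decrease hy
  have hd' : M * H ^ (p + 1) ≤ ((p + 1)! : ℝ) * (f x - f y) := by
    have h1 : ((p : ℝ) - 1) * M / ((p + 1)! : ℝ) * H ^ (p + 1) ≤ f x - f y := by linarith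
    rw [div_mul_eq_mul_div, div_le_iff₀ (by positivity)] at h1
    have : M * H ^ (p + 1) ≤ ((p : ℝ) - 1) * M * H ^ (p + 1) := by
      gcongr
      nlinarith
    linarith
  have e1 : ((p + 1) * M / (p ! : ℝ) * H ^ p) = q * M * H ^ p := by rw [hq]; ring
  rw [e1] at hG
  -- The exponent `(p+1)/p` turns the `H^p` of the gradient bound into `H^(p+1)`, which the decrease
  -- of the function controls.
  have h2 := Real.rpow_le_rpow (norm_nonneg _) hG (by positivity : 0 ≤ ((p : ℝ) + 1) / p)
  refine h2.trans ?_
  rw [Real.mul_rpow (by positivity) (by positivity), ← Real.rpow_natCast H, ← Real.rpow_mul hH0,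
    show (p : ℝ) * (((p : ℝ) + 1) / p) = ((p + 1 : ℕ) : ℝ) by push_cast; field_simp,
    Real.rpow_natCast, show ((p : ℝ) + 1) / p = 1 + 1 / p by field_simp,
    Real.rpow_add (by positivity), Real.rpow_one]
  have h3 : (q * M) ^ (1 / (p : ℝ)) ≤ (p * M) ^ (1 / (p : ℝ)) := by
    refine Real.rpow_le_rpow (by positivity) ?_ (by positivity)
    nlinarith
  calc q * M * (q * M) ^ (1 / (p : ℝ)) * H ^ (p + 1)
      ≤ 8 * M * (p * M) ^ (1 / (p : ℝ)) * H ^ (p + 1) := by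
        gcongr
        linarith
    _ = 8 * (p * M) ^ (1 / (p : ℝ)) * (M * H ^ (p + 1)) := by ring
    _ ≤ 8 * (p * M) ^ (1 / (p : ℝ)) * (((p + 1)! : ℝ) * (f x - f y)) := by gcongr
    _ = _ := by ring

/-- If the gradient of the regularized objective is small, so is the gradient of `f`. -/
lemma norm_gradient_le_of_addQuad (hΔ : 0 < Δ₀) (hε : 0 < ε) (hf : Differentiable ℝ f)
    {xs y : Euc n} (hx₀ : regParam Δ₀ ε * ‖x₀ - xs‖ ≤ ε / 4) :
    ‖gradient f y‖ ≤ ‖gradient (addQuad f (regParam Δ₀ ε) x₀) y‖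
      + regParam Δ₀ ε * ‖y - xs‖ + ε / 4 := by
  have hμ := regParam_pos hΔ hε
  have e : gradient f y = gradient (addQuad f (regParam Δ₀ ε) x₀) y
      - regParam Δ₀ ε • (y - x₀) := by
    rw [gradient_addQuad hf]; abel
  have h1 : ‖y - x₀‖ ≤ ‖y - xs‖ + ‖x₀ - xs‖ := by
    rw [← sub_sub_sub_cancel_right y x₀ xs]; exact norm_sub_le _ _
  rw [e]
  refine (norm_sub_le _ _).trans ?_
  rw [norm_smul, Real.norm_of_nonneg hμ.le]
  have := mul_le_mul_of_nonneg_left h1 hμ.le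
  linarith

/-- The output of a complete execution of the outer method. -/
lemma OuterTrace.IsRun.norm_gradient_output_le (hp : 2 ≤ p) (hM : 0 < M) (hΔ : 0 < Δ₀)
    (hε : 0 < ε) (h : IsProblem p M Δ₀ x₀ f) {t : OuterTrace n}
    (ht : t.IsRun p M Δ₀ ε x₀ f) : ‖gradient f t.output‖ ≤ ε := by
  obtain ⟨xs, hxs, hgrow, h0⟩ := h.exists_minimizer hp hΔ hε
  set g := addQuad f (regParam Δ₀ ε) x₀ with hg
  have hgl : HasLipschitzDeriv p M g := hasLipschitzDeriv_addQuad hp h.hasLipschitzDeriv _ _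
  have hres := ht.loop.residual_le hp hM hΔ hε h hxs hgrow h0 t.phases le_rfl
  have hp2 : (2 : ℝ) ≤ p := by exact_mod_cast hp
  have hdec : g t.output ≤ g (t.z t.phases) := by
    have := hgl.tensorStep_decrease ht.final
    have h1 : 0 ≤ ((p : ℝ) - 1) * M / ((p + 1)! : ℝ)
        * ‖t.output - t.z t.phases‖ ^ (p + 1) := by
      have : 0 ≤ (p : ℝ) - 1 := by linarith
      positivity
    linarith
  have hG : ‖gradient g t.output‖ ≤ ε / 2 := by
    rw [norm_gradient]
    have h1 := hgl.norm_fderiv_rpow_le hp hM ht.final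
    have h2 : g (t.z t.phases) - g t.output ≤ innerTol p M ε := by
      have := hxs t.output
      have := ht.stops
      linarith
    have h3 : 0 < 8 * (p * M) ^ (1 / (p : ℝ)) * ((p + 1)! : ℝ) := by positivity
    have h4 := h1.trans (mul_le_mul_of_nonneg_left h2 h3.le)
    rw [innerTol, mul_div_cancel₀ _ h3.ne'] at h4
    exact (Real.rpow_le_rpow_iff (norm_nonneg _) (by positivity) (by positivity)).1 h4
  have hx0 := regParam_mul_norm_le hΔ hε (hgrow x₀) h0
  have hy := regParam_mul_norm_le hΔ hε (hgrow t.output)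
    (by have := residualBound_le hΔ t.phases; linarith)
  -- The budget is `ε/2` for the gradient of `f_μ` and `ε/4` each for the distances of the output
  -- and of `x₀` to the minimizer.
  have := norm_gradient_le_of_addQuad hΔ hε (h.hasLipschitzDeriv.differentiable hp) hx0
    (y := t.output)
  linarith

end Regularized

/-! ### Total number of iterations of the inner method -/

section Counting

variable {p : ℕ}

/-- The first summand of the iteration bound. -/
noncomputable def mainTerm (p : ℕ) (M Δ₀ ε : ℝ) : ℝ :=
  M ^ (2 / (3 * (p : ℝ) + 1)) / ε ^ (2 * ((p : ℝ) + 1) / (3 * (p : ℝ) + 1))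
      * Δ₀ ^ (2 * (p : ℝ) / (3 * (p : ℝ) + 1))

lemma mainTerm_pos {M Δ₀ ε : ℝ} (hM : 0 < M) (hΔ : 0 < Δ₀) (hε : 0 < ε) :
    0 < mainTerm p M Δ₀ ε := by
  unfold mainTerm; positivity

lemma iterationBound_eq {M Δ₀ ε : ℝ} (hp : 2 ≤ p) (hM : 0 < M) (hε : 0 < ε) :
    iterationBound p M Δ₀ ε = mainTerm p M Δ₀ ε
      + max 0 (Real.logb 2 (Δ₀ / innerTol p M ε)) := by
  unfold iterationBound mainTerm
  congr 3
  have hp0 : (p : ℝ) ≠ 0 := by exact_mod_cast (by omega : p ≠ 0)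
  unfold innerTol
  rw [Real.div_rpow hε.le (by norm_num),
    show (4 * (p : ℝ) + 1) / p = 3 + (p + 1) / p by field_simp; ring,
    Real.rpow_add (by norm_num), show (2 : ℝ) ^ (3 : ℝ) = 8 by norm_num]
  have : ε ^ (((p : ℝ) + 1) / p) ≠ 0 := by positivity
  field_simp

lemma mainTerm_le_iterationBound {M Δ₀ ε : ℝ} : mainTerm p M Δ₀ ε ≤ iterationBound p M Δ₀ ε :=
  le_add_of_nonneg_right (le_max_left _ _)

/-- Inserting `μ` and `Δ_k`, one finds `M μ^(-(p+1)/2) Δ_k^((p-1)/2)` proportional to `M Δ₀^p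
ε^(-(p+1)) 2^(-k(p-1)/2)`. The power `2/(3p+1)` makes this the main term times a geometric sequence,
and rounding up costs at most 1. -/
lemma phaseLength_le {M Δ₀ ε : ℝ} (hM : 0 < M) (hΔ : 0 < Δ₀) (hε : 0 < ε) (k : ℕ) :
    (phaseLength p M Δ₀ ε k : ℝ) ≤ 1
      + (2 * rateConst p * (2 : ℝ) ^ (((p : ℝ) + 1) / 2) * 32 ^ (((p : ℝ) + 1) / 2))
          ^ (2 / (3 * (p : ℝ) + 1))
        * mainTerm p M Δ₀ ε * ((1 / 2) ^ (((p : ℝ) - 1) / (3 * p + 1))) ^ k := by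
  have hc : 0 < rateConst p := by unfold rateConst; positivity
  have hμ := regParam_pos hΔ hε
  have hD := residualBound_pos hΔ k
  set s : ℝ := 3 * p + 1 with hs
  have hs0 : 0 < s := by positivity
  set Y : ℝ := (2 * rateConst p * M * (2 : ℝ) ^ (((p : ℝ) + 1) / 2)
      / regParam Δ₀ ε ^ (((p : ℝ) + 1) / 2)
      * residualBound Δ₀ k ^ (((p : ℝ) - 1) / 2)) ^ (2 / s) with hY
  have hY0 : 0 ≤ Y := by positivity
  have h1 : (phaseLength p M Δ₀ ε k : ℝ) ≤ 1 + Y := by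
    unfold phaseLength
    rw [Nat.cast_max]
    refine max_le ?_ (by push_cast; linarith)
    have := Nat.ceil_lt_add_one hY0
    linarith
  refine h1.trans (le_of_eq ?_)
  congr 1
  have eμ : regParam Δ₀ ε ^ (((p : ℝ) + 1) / 2)
      = (ε ^ (p + 1 : ℝ)) / (32 ^ (((p : ℝ) + 1) / 2) * Δ₀ ^ (((p : ℝ) + 1) / 2)) := by
    unfold regParam
    rw [Real.div_rpow (by positivity) (by positivity), Real.mul_rpow (by norm_num) hΔ.le,
      ← Real.rpow_natCast, ← Real.rpow_mul hε.le]
    congr 2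
    push_cast
    ring
  have eD : residualBound Δ₀ k ^ (((p : ℝ) - 1) / 2)
      = Δ₀ ^ (((p : ℝ) - 1) / 2) * ((1 / 2) ^ (((p : ℝ) - 1) / 2)) ^ k := by
    unfold residualBound
    rw [div_eq_mul_one_div, Real.mul_rpow hΔ.le (by positivity), ← one_div_pow,
      ← Real.rpow_natCast, ← Real.rpow_natCast, ← Real.rpow_mul (by norm_num),
      ← Real.rpow_mul (by norm_num), mul_comm (k : ℝ)]
  have eΔ : Δ₀ ^ (((p : ℝ) + 1) / 2) * Δ₀ ^ (((p : ℝ) - 1) / 2) = Δ₀ ^ (p : ℝ) := by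
    rw [← Real.rpow_add hΔ]; congr 1; ring
  have eY : 2 * rateConst p * M * (2 : ℝ) ^ (((p : ℝ) + 1) / 2)
      / regParam Δ₀ ε ^ (((p : ℝ) + 1) / 2)
      * residualBound Δ₀ k ^ (((p : ℝ) - 1) / 2)
      = (2 * rateConst p * (2 : ℝ) ^ (((p : ℝ) + 1) / 2) * 32 ^ (((p : ℝ) + 1) / 2))
        * (M / ε ^ (p + 1 : ℝ) * Δ₀ ^ (p : ℝ)) * ((1 / 2) ^ (((p : ℝ) - 1) / 2)) ^ k := by
    rw [eμ, eD, ← eΔ]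
    field_simp
  have em : (M / ε ^ (p + 1 : ℝ) * Δ₀ ^ (p : ℝ)) ^ (2 / s) = mainTerm p M Δ₀ ε := by
    unfold mainTerm
    rw [Real.mul_rpow (by positivity) (by positivity), Real.div_rpow hM.le (by positivity),
      ← Real.rpow_mul hε.le, ← Real.rpow_mul hΔ.le,
      show ((p : ℝ) + 1) * (2 / s) = 2 * (p + 1) / s by ring,
      show (p : ℝ) * (2 / s) = 2 * p / s by ring]
  have eq : (((1 / 2 : ℝ) ^ (((p : ℝ) - 1) / 2)) ^ k) ^ (2 / s)
      = ((1 / 2) ^ (((p : ℝ) - 1) / s)) ^ k := by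
    have h2 : (0 : ℝ) ≤ 1 / 2 := by norm_num
    rw [← Real.rpow_natCast, ← Real.rpow_natCast, ← Real.rpow_mul h2, ← Real.rpow_mul h2,
      ← Real.rpow_mul h2]
    congr 1
    field_simp
  rw [hY, eY, Real.mul_rpow (by positivity) (by positivity),
    Real.mul_rpow (by positivity) (by positivity), em, eq]

lemma innerTol_pos {M ε : ℝ} (hp : 2 ≤ p) (hM : 0 < M) (hε : 0 < ε) : 0 < innerTol p M ε := by
  have : (0 : ℝ) < p := by exact_mod_cast (by omega : 0 < p)
  unfold innerTol; positivity

/-- Bound for the total number of iterations of the inner method. -/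
lemma exists_sum_phaseLength_le (hp : 2 ≤ p) : ∃ C : ℝ, 0 < C ∧ ∀ M Δ₀ ε : ℝ, 0 < M → 0 < Δ₀ →
    0 < ε → ∀ K : ℕ, (∀ k < K, innerTol p M ε ≤ residualBound Δ₀ k) →
    ((∑ k ∈ Finset.range K, phaseLength p M Δ₀ ε k : ℕ) : ℝ) ≤ C * iterationBound p M Δ₀ ε := by
  have hp2 : (2 : ℝ) ≤ p := by exact_mod_cast hp
  set s : ℝ := 3 * p + 1 with hs
  have hs0 : 0 < s := by positivity
  set q : ℝ := (1 / 2) ^ (((p : ℝ) - 1) / s) with hq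
  have hq0 : 0 ≤ q := by positivity
  have hq1 : q < 1 := Real.rpow_lt_one (by norm_num) (by norm_num)
    (div_pos (by linarith) hs0)
  set c1 : ℝ := (2 * rateConst p * (2 : ℝ) ^ (((p : ℝ) + 1) / 2) * 32 ^ (((p : ℝ) + 1) / 2))
          ^ (2 / s) with hc1
  have hc10 : 0 < c1 := by
    have hc : 0 < rateConst p := by unfold rateConst; positivity
    positivity
  set e0 : ℝ := 2 ^ (((p : ℝ) + 1) / p) * 8 * (p : ℝ) ^ (1 / (p : ℝ)) * ((p + 1)! : ℝ) with he0
  have he00 : 0 < e0 := by positivity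
  set c2 : ℝ := e0 ^ (2 * p / s) with hc2
  have hc20 : 0 < c2 := by positivity
  have h1q : 0 < 1 - q := by linarith
  refine ⟨c2 + c1 / (1 - q) + 1, by positivity, fun M Δ₀ ε hM hΔ hε K hK => ?_⟩
  set T := mainTerm p M Δ₀ ε with hT
  have hT0 : 0 < T := mainTerm_pos hM hΔ hε
  have hB := iterationBound_eq (Δ₀ := Δ₀) hp hM hε
  rw [← hT] at hB
  set m := max 0 (Real.logb 2 (Δ₀ / innerTol p M ε)) with hm
  have hm0 : 0 ≤ m := le_max_left _ _
  have hC : 0 < c2 + c1 / (1 - q) + 1 := by positivity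
  rcases Nat.eq_zero_or_pos K with rfl | hK0
  · simp only [Finset.range_zero, Finset.sum_empty, Nat.cast_zero, hB]
    positivity
  have htol := innerTol_pos hp hM hε
  have hgeom : ((∑ k ∈ Finset.range K, phaseLength p M Δ₀ ε k : ℕ) : ℝ)
      ≤ K + c1 * T * (1 - q)⁻¹ := by
    push_cast
    calc ∑ k ∈ Finset.range K, (phaseLength p M Δ₀ ε k : ℝ)
        ≤ ∑ k ∈ Finset.range K, (1 + c1 * T * q ^ k) :=
          Finset.sum_le_sum fun k _ => phaseLength_le hM hΔ hε k
      _ = K + c1 * T * ∑ k ∈ Finset.range K, q ^ k := by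
          rw [Finset.sum_add_distrib, Finset.mul_sum]; simp
      _ ≤ K + c1 * T * (1 - q)⁻¹ := by
          gcongr
          rw [← tsum_geometric_of_lt_one hq0 hq1]
          exact (summable_geometric_of_lt_one hq0 hq1).sum_le_tsum _ fun k _ => by positivity
  have hKm : (K : ℝ) ≤ 1 + m := by
    have h1 := hK (K - 1) (by omega)
    unfold residualBound at h1
    rw [le_div_iff₀ (by positivity), ← le_div_iff₀' htol] at h1
    have h2 : ((K - 1 : ℕ) : ℝ) ≤ Real.logb 2 (Δ₀ / innerTol p M ε) := by
      rw [Real.le_logb_iff_rpow_le (by norm_num) (by positivity), Real.rpow_natCast]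
      exact h1
    have h3 := h2.trans (le_max_right 0 _)
    rw [Nat.cast_sub hK0] at h3
    push_cast at h3
    linarith
  -- This absorbs the 1 in `K ≤ 1 + m`. Once the loop is entered, `ε̃ ≤ Δ₀`, and `(Δ₀/ε̃)^(2p/s)` is
  -- exactly `c2` times the main term.
  have h1T : 1 ≤ c2 * T := by
    have h1 : innerTol p M ε ≤ Δ₀ := (hK 0 hK0).trans (residualBound_le hΔ 0)
    have h2 : 1 ≤ e0 * (Δ₀ * M ^ (1 / (p : ℝ)) / ε ^ (((p : ℝ) + 1) / p)) := by
      have h3 : 1 ≤ Δ₀ / innerTol p M ε := by rwa [le_div_iff₀ htol, one_mul]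
      refine h3.trans (le_of_eq ?_)
      unfold innerTol
      rw [Real.div_rpow hε.le (by norm_num), Real.mul_rpow (by positivity) hM.le, he0]
      field_simp
    have h4 := Real.one_le_rpow h2 (by positivity : 0 ≤ 2 * (p : ℝ) / s)
    rw [Real.mul_rpow he00.le (by positivity)] at h4
    refine h4.trans (le_of_eq ?_)
    congr 1
    rw [hT, mainTerm, Real.div_rpow (by positivity) (by positivity),
      Real.mul_rpow hΔ.le (by positivity), ← Real.rpow_mul hM.le, ← Real.rpow_mul hε.le,
      show 1 / (p : ℝ) * (2 * p / s) = 2 / s by field_simp,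
      show ((p : ℝ) + 1) / p * (2 * p / s) = 2 * (p + 1) / s by field_simp]
    ring
  calc _ ≤ K + c1 * T * (1 - q)⁻¹ := hgeom
    _ ≤ c2 * T + m + c1 * T * (1 - q)⁻¹ := by linarith
    _ ≤ (c2 + c1 / (1 - q) + 1) * (T + m) := by
      have h5 : 0 ≤ (c2 + c1 / (1 - q)) * m + T := by positivity
      have : (c2 + c1 / (1 - q) + 1) * (T + m)
          = c2 * T + m + c1 * T * (1 - q)⁻¹ + ((c2 + c1 / (1 - q)) * m + T) := by
        rw [div_eq_mul_inv]; ring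
      linarith
    _ = _ := by rw [hB]

end Counting

/-! ### Oracle procedures for classes of functions -/

section Programs

/-- Sequential composition of procedures. -/
def OracleProgram.bind {Q A R R' : Type} (P : OracleProgram Q A R)
    (k : R → OracleProgram Q A R') : OracleProgram Q A R' :=
  match P with
  | .done r => k r
  | .ask q next => .ask q fun a => (next a).bind k

lemma OracleProgram.result_bind {Q A R R' : Type} (O : Q → A) (P : OracleProgram Q A R)
    (k : R → OracleProgram Q A R') : (P.bind k).result O = (k (P.result O)).result O := by
  induction P with
  | done r => rfl
  | ask q next ih => exact ih (O q)

lemma OracleProgram.calls_bind {Q A R R' : Type} (O : Q → A) (P : OracleProgram Q A R)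
    (k : R → OracleProgram Q A R') :
    (P.bind k).calls O = P.calls O + (k (P.result O)).calls O := by
  induction P with
  | done r => simp [bind, calls, result]
  | ask q next ih =>
    have := ih (O q)
    simp only [bind, calls, result]
    omega

/-- There is a procedure that, for every instance in the class `𝓕`, returns a result with the
required property after at most `m` oracle calls. -/
def Solvable {Q A R I : Type} (O : I → Q → A) (𝓕 : Set I) (post : I → R → Prop) (m : ℕ) : Prop :=
  ∃ P : OracleProgram Q A R, ∀ f ∈ 𝓕, post f (P.result (O f)) ∧ P.calls (O f) ≤ m

variable {Q A R R' I : Type} {O : I → Q → A} {𝓕 : Set I} {post : I → R → Prop}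
  {post' : I → R' → Prop} {m m' : ℕ}

lemma Solvable.of_result (r : R) (h : ∀ f ∈ 𝓕, post f r) : Solvable O 𝓕 post m :=
  ⟨.done r, fun f hf => ⟨h f hf, Nat.zero_le _⟩⟩

/-- Closes the branches that no admissible function can reach, among them the end of the bisection.
-/
lemma Solvable.of_empty [Inhabited R] (h : ∀ f ∈ 𝓕, False) : Solvable O 𝓕 post m :=
  .of_result default fun f hf => (h f hf).elim

lemma Solvable.mono {𝓖 : Set I} (h : Solvable O 𝓖 post m) (h𝓕 : 𝓕 ⊆ 𝓖) (hm : m ≤ m') :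
    Solvable O 𝓕 post m' := by
  obtain ⟨P, hP⟩ := h
  exact ⟨P, fun f hf => ⟨(hP f (h𝓕 hf)).1, (hP f (h𝓕 hf)).2.trans hm⟩⟩

/-- After the answer only functions sharing it remain, and any one of them, `f₀`, may be used to
compute the continuation. Answers that no function of the class gives get an arbitrary continuation.
-/
lemma Solvable.ask [Inhabited R] (q : Q)
    (h : ∀ f₀ ∈ 𝓕, Solvable O {f ∈ 𝓕 | O f q = O f₀ q} post m) :
    Solvable O 𝓕 post (m + 1) := by
  have h' : ∀ a, Solvable O {f ∈ 𝓕 | O f q = a} post m := by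
    intro a
    by_cases ha : ∃ f₀ ∈ 𝓕, O f₀ q = a
    · obtain ⟨f₀, hf₀, rfl⟩ := ha
      exact h f₀ hf₀
    · exact .of_empty fun f hf => ha ⟨f, hf⟩
  choose P hP using h'
  refine ⟨.ask q P, fun f hf => ?_⟩
  have := hP (O f q) f ⟨hf, rfl⟩
  exact ⟨this.1, Nat.succ_le_succ this.2⟩

/-- Only the result is passed on, so the postcondition of the first procedure has to carry
everything the second one may know about `f`. -/
lemma Solvable.bind (h : Solvable O 𝓕 post m)
    (h' : ∀ r, Solvable O {f ∈ 𝓕 | post f r} post' m') : Solvable O 𝓕 post' (m + m') := by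
  obtain ⟨P, hP⟩ := h
  choose k hk using h'
  refine ⟨P.bind k, fun f hf => ?_⟩
  rw [OracleProgram.result_bind, OracleProgram.calls_bind]
  have h1 := hP f hf
  have h2 := hk (P.result (O f)) f ⟨hf, h1.1⟩
  exact ⟨h2.1, Nat.add_le_add h1.2 h2.2⟩

end Programs

/-! ### Dependence of the proximal tensor step on `L` -/

section Sensitivity

variable {p n : ℕ} {M : ℝ} {g : Euc n → ℝ}

lemma norm_extrapolate_sub_le {A L D : ℝ} (hA : 0 ≤ A) (hL : 0 < L) {y u xs : Euc n}
    (hy : ‖y - xs‖ ≤ D) (hu : ‖u - xs‖ ≤ D) : ‖extrapolate A L y u - xs‖ ≤ D := by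
  have ha := stepWeight_pos (A := A) hL
  have h := (convex_closedBall xs D) (mem_closedBall_iff_norm.2 hy) (mem_closedBall_iff_norm.2 hu)
    (a := A / (A + stepWeight A L)) (b := stepWeight A L / (A + stepWeight A L))
    (by positivity) (by positivity) (by field_simp)
  exact mem_closedBall_iff_norm.1 h

/-- Dependence of the extrapolated point on `L`. -/
lemma norm_extrapolate_sub_extrapolate_le {A L₁ L₂ : ℝ} (hA : 0 ≤ A) (hL₁ : 0 < L₁)
    (hL : L₁ ≤ L₂) (y u : Euc n) :
    ‖extrapolate A L₁ y u - extrapolate A L₂ y u‖ ≤ (L₂ - L₁) / L₁ * ‖u - y‖ := by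
  have hL₂ : 0 < L₂ := hL₁.trans_le hL
  have ha₁ := stepWeight_pos (A := A) hL₁
  have ha₂ := stepWeight_pos (A := A) hL₂
  have hq₁ := stepWeight_sq hA hL₁
  have hq₂ := stepWeight_sq hA hL₂
  -- In terms of `r = L a`, the positive root of `r² = A L + r`, the point is `y + (u - y)/r`.
  -- Subtracting the equations for two values of `L` controls `1/r₁ - 1/r₂`.
  have hx : ∀ L, 0 < L → extrapolate A L y u = y + (1 / (L * stepWeight A L)) • (u - y) := by
    intro L hL
    have ha := stepWeight_pos (A := A) hL
    have hq := stepWeight_sq hA hL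
    have e1 : stepWeight A L / (A + stepWeight A L) = 1 / (L * stepWeight A L) := by
      rw [← hq]; field_simp
    have e2 : A / (A + stepWeight A L) = 1 - 1 / (L * stepWeight A L) := by
      rw [← e1]; field_simp; ring
    unfold extrapolate
    rw [e1, e2]
    module
  rw [hx L₁ hL₁, hx L₂ hL₂]
  set r₁ := L₁ * stepWeight A L₁ with hr₁
  set r₂ := L₂ * stepWeight A L₂ with hr₂
  have hr₁0 : 0 < r₁ := by positivity
  have hr₂0 : 0 < r₂ := by positivity
  have q₁ : r₁ ^ 2 = A * L₁ + r₁ := by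
    have : r₁ ^ 2 = L₁ * (L₁ * stepWeight A L₁ ^ 2) := by rw [hr₁]; ring
    rw [this, hq₁, hr₁]; ring
  have q₂ : r₂ ^ 2 = A * L₂ + r₂ := by
    have : r₂ ^ 2 = L₂ * (L₂ * stepWeight A L₂ ^ 2) := by rw [hr₂]; ring
    rw [this, hq₂, hr₂]; ring
  have hr₁1 : 1 ≤ r₁ := by
    have : 0 ≤ A * L₁ := by positivity
    nlinarith
  have hr₂1 : 1 ≤ r₂ := by
    have : 0 ≤ A * L₂ := by positivity
    nlinarith
  have hdiff : (r₂ - r₁) * (r₁ + r₂ - 1) = A * (L₂ - L₁) := by linear_combination q₂ - q₁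
  have hmono : r₁ ≤ r₂ := by
    have h1 : 0 ≤ A * (L₂ - L₁) := mul_nonneg hA (by linarith)
    by_contra hc
    have : (r₂ - r₁) * (r₁ + r₂ - 1) < 0 := mul_neg_of_neg_of_pos (by linarith) (by linarith)
    linarith
  have hs : |1 / r₁ - 1 / r₂| ≤ (L₂ - L₁) / L₁ := by
    have e : 1 / r₁ - 1 / r₂ = (r₂ - r₁) / (r₁ * r₂) := by field_simp
    rw [e, abs_of_nonneg (div_nonneg (by linarith) (by positivity)),
      div_le_div_iff₀ (by positivity) hL₁]
    have h1 : A * L₁ ≤ r₁ * r₂ := by nlinarith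
    have h2 : (r₂ - r₁) * L₁ * (r₁ + r₂ - 1) ≤ (L₂ - L₁) * (r₁ * r₂) := by
      have : (r₂ - r₁) * L₁ * (r₁ + r₂ - 1) = (L₂ - L₁) * (A * L₁) := by
        linear_combination L₁ * hdiff
      rw [this]
      exact mul_le_mul_of_nonneg_left h1 (by linarith)
    have h3 : (r₂ - r₁) * L₁ ≤ (r₂ - r₁) * L₁ * (r₁ + r₂ - 1) :=
      le_mul_of_one_le_right (mul_nonneg (by linarith) hL₁.le) (by linarith)
    linarith
  have e : y + (1 / r₁) • (u - y) - (y + (1 / r₂) • (u - y)) = (1 / r₁ - 1 / r₂) • (u - y) := by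
    module
  rw [e, norm_smul]
  exact mul_le_mul_of_nonneg_right hs (norm_nonneg _)

/-- A proximal tensor step has length bounded in terms of the distance to a minimizer. -/
lemma HasLipschitzDeriv.proxStep_length_sq_le (hp : 2 ≤ p) (hM : 0 < M)
    (hg : HasLipschitzDeriv p M g) {xs : Euc n} (hxs : ∀ x, g xs ≤ g x) {L D : ℝ} (hL : 0 < L)
    {x y : Euc n} (hx : ‖x - xs‖ ≤ D) (hy : IsTensorStep p (p * M) (addQuad g L x) x y) :
    ‖y - x‖ ^ 2 ≤ D ^ 2 + 2 * M * D ^ (p + 1) / L := by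
  have hp2 : (2 : ℝ) ≤ p := by exact_mod_cast hp
  -- The step is compared with the minimizer: the model at `y` is at least `g y ≥ g xs`, while at
  -- `xs` it exceeds `g xs` by at most `M D^(p+1)`.
  have h1 : tensorModel p (p * M) (addQuad g L x) x y
      ≤ tensorModel p (p * M) (addQuad g L x) x xs := hy (Set.mem_univ xs)
  rw [tensorModel_addQuad hp hg.contDiff, tensorModel_addQuad hp hg.contDiff] at h1
  have h2 := hg.le_tensorModel (p * M) x y
  have h3 := hg.tensorModel_le (p * M) x xs
  have h4 : 0 ≤ (p * M - M) / ((p + 1)! : ℝ) * ‖y - x‖ ^ (p + 1) := by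
    have : 0 ≤ p * M - M := by nlinarith
    positivity
  have hx' : ‖xs - x‖ ≤ D := by rwa [norm_sub_rev]
  have h5 : (p * M + M) / ((p + 1)! : ℝ) * ‖xs - x‖ ^ (p + 1) ≤ M * D ^ (p + 1) := by
    have : (p * M + M) / ((p + 1)! : ℝ) ≤ M := by
      rw [Nat.factorial_succ]
      push_cast
      rw [show p * M + M = (p + 1) * M by ring, mul_div_mul_left _ _ (by positivity)]
      exact div_le_self hM.le (by exact_mod_cast Nat.factorial_pos p)
    gcongr
  have h6 : L / 2 * ‖xs - x‖ ^ 2 ≤ L / 2 * D ^ 2 := by gcongr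
  have h7 := hxs y
  have h8 : L / 2 * ‖y - x‖ ^ 2 ≤ L / 2 * D ^ 2 + M * D ^ (p + 1) := by linarith
  have h9 : L / 2 * (D ^ 2 + 2 * M * D ^ (p + 1) / L) = L / 2 * D ^ 2 + M * D ^ (p + 1) := by
    field_simp
  rw [← h9] at h8
  exact le_of_mul_le_mul_left h8 (by positivity)

lemma pow_sub_pow_le_mul {a b H : ℝ} (ha : 0 ≤ a) (hb : 0 ≤ b) (haH : a ≤ H) (hbH : b ≤ H)
    (k : ℕ) : |a ^ k - b ^ k| ≤ k * H ^ (k - 1) * |a - b| := by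
  have := abs_pow_sub_pow_le a b k
  refine this.trans ?_
  have h1 : max |a| |b| ≤ H := by
    rw [abs_of_nonneg ha, abs_of_nonneg hb]; exact max_le haH hbH
  calc |a - b| * k * max |a| |b| ^ (k - 1) ≤ |a - b| * k * H ^ (k - 1) := by gcongr
    _ = _ := by ring

/-- Comparison of the models of two proximal tensor steps. -/
lemma abs_proxModel_sub_le (hM : 0 < M) (hg : HasLipschitzDeriv p M g) {x₁ x₂ y : Euc n}
    {ρ L₁ L₂ : ℝ} (hx : ‖x₁ - x₂‖ ≤ ρ) (h₁ : ‖y - x₁‖ ≤ ρ) (h₂ : ‖y - x₂‖ ≤ ρ)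
    (hL₁ : 0 ≤ L₁) (hL : L₁ ≤ L₂) :
    |(tensorModel p (p * M) g x₁ y + L₁ / 2 * ‖y - x₁‖ ^ 2)
      - (tensorModel p (p * M) g x₂ y + L₂ / 2 * ‖y - x₂‖ ^ 2)|
      ≤ (2 * p + 2) * M * ρ ^ p * ‖x₁ - x₂‖ + (L₂ - L₁) * ρ ^ 2 + L₂ * ρ * ‖x₁ - x₂‖ := by
  have hρ : 0 ≤ ρ := (norm_nonneg _).trans hx
  have hL₂ : 0 ≤ L₂ := hL₁.trans hL
  have hd : |‖y - x₁‖ - ‖y - x₂‖| ≤ ‖x₁ - x₂‖ := by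
    refine (abs_norm_sub_norm_le _ _).trans (le_of_eq ?_)
    rw [sub_sub_sub_cancel_left, norm_sub_rev]
  have h1 := abs_taylorPoly_sub_taylorPoly_le hM.le hg.contDiff hg.lipschitz hx h₁
  have h2 := pow_sub_pow_le_mul (norm_nonneg _) (norm_nonneg _) h₁ h₂ (p + 1)
  have h3 := pow_sub_pow_le_mul (norm_nonneg _) (norm_nonneg _) h₁ h₂ 2
  have e : (tensorModel p (p * M) g x₁ y + L₁ / 2 * ‖y - x₁‖ ^ 2)
      - (tensorModel p (p * M) g x₂ y + L₂ / 2 * ‖y - x₂‖ ^ 2)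
      = (taylorPoly p g x₁ y - taylorPoly p g x₂ y)
        + p * M / ((p + 1)! : ℝ) * (‖y - x₁‖ ^ (p + 1) - ‖y - x₂‖ ^ (p + 1))
        + L₁ / 2 * (‖y - x₁‖ ^ 2 - ‖y - x₂‖ ^ 2) - (L₂ - L₁) / 2 * ‖y - x₂‖ ^ 2 := by
    rw [tensorModel_eq, tensorModel_eq]; ring
  have b2 : |p * M / ((p + 1)! : ℝ) * (‖y - x₁‖ ^ (p + 1) - ‖y - x₂‖ ^ (p + 1))|
      ≤ (p + 1) * M * ρ ^ p * ‖x₁ - x₂‖ := by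
    rw [abs_mul, abs_of_nonneg (by positivity)]
    have c1 : p * M / ((p + 1)! : ℝ) ≤ M := by
      rw [div_le_iff₀ (by positivity), mul_comm M]
      refine mul_le_mul_of_nonneg_right ?_ hM.le
      exact_mod_cast (Nat.le_succ p).trans (Nat.self_le_factorial (p + 1))
    have c2 : |‖y - x₁‖ ^ (p + 1) - ‖y - x₂‖ ^ (p + 1)| ≤ (p + 1) * ρ ^ p * ‖x₁ - x₂‖ := by
      refine h2.trans ?_
      push_cast
      gcongr
    calc _ ≤ M * ((p + 1) * ρ ^ p * ‖x₁ - x₂‖) := by gcongr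
      _ = _ := by ring
  have b3 : |L₁ / 2 * (‖y - x₁‖ ^ 2 - ‖y - x₂‖ ^ 2)| ≤ L₂ * ρ * ‖x₁ - x₂‖ := by
    rw [abs_mul, abs_of_nonneg (by positivity)]
    have c3 : |‖y - x₁‖ ^ 2 - ‖y - x₂‖ ^ 2| ≤ 2 * ρ * ‖x₁ - x₂‖ := by
      refine h3.trans ?_
      simp only [Nat.cast_ofNat, Nat.add_one_sub_one, pow_one]
      gcongr
    calc _ ≤ L₂ / 2 * (2 * ρ * ‖x₁ - x₂‖) := by gcongr
      _ = _ := by ring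
  have b4 : |(L₂ - L₁) / 2 * ‖y - x₂‖ ^ 2| ≤ (L₂ - L₁) * ρ ^ 2 := by
    rw [abs_mul, abs_of_nonneg (by linarith), abs_of_nonneg (by positivity)]
    have : ‖y - x₂‖ ^ 2 ≤ ρ ^ 2 := by gcongr
    have h0 : 0 ≤ L₂ - L₁ := by linarith
    calc _ ≤ (L₂ - L₁) / 2 * ρ ^ 2 := by gcongr
      _ ≤ _ := by
        have : 0 ≤ (L₂ - L₁) * ρ ^ 2 := by positivity
        linarith
  rw [e]
  refine (abs_sub _ _).trans ((add_le_add (abs_add_three _ _ _) le_rfl).trans ?_)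
  linarith

/-- Hölder continuity of the proximal tensor step. -/
lemma HasLipschitzDeriv.norm_proxStep_sub_sq_le (hp : 2 ≤ p) (hM : 0 < M)
    (hg : HasLipschitzDeriv p M g) (hconv : ConvexOn ℝ Set.univ g) {x₁ x₂ y₁ y₂ : Euc n}
    {ρ L₁ L₂ : ℝ} (hx : ‖x₁ - x₂‖ ≤ ρ) (h₁₁ : ‖y₁ - x₁‖ ≤ ρ) (h₁₂ : ‖y₁ - x₂‖ ≤ ρ)
    (h₂₁ : ‖y₂ - x₁‖ ≤ ρ) (h₂₂ : ‖y₂ - x₂‖ ≤ ρ) (hL₁ : 0 < L₁) (hL : L₁ ≤ L₂)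
    (hy₁ : IsTensorStep p (p * M) (addQuad g L₁ x₁) x₁ y₁)
    (hy₂ : IsTensorStep p (p * M) (addQuad g L₂ x₂) x₂ y₂) :
    L₁ * ‖y₁ - y₂‖ ^ 2 ≤ 2 * ((2 * p + 2) * M * ρ ^ p * ‖x₁ - x₂‖ + (L₂ - L₁) * ρ ^ 2
      + L₂ * ρ * ‖x₁ - x₂‖) := by
  -- Each minimizer's quadratic growth is tested at the other minimizer. In the sum only the
  -- differences between the two models at the same point survive.
  have g1 := hg.tensorStep_growth hp hM.le hconv hy₁ y₂
  have g2 := hg.tensorStep_growth hp hM.le hconv hy₂ y₁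
  have a1 := (abs_le.1 (abs_proxModel_sub_le hM hg hx h₁₁ h₁₂ hL₁.le hL)).1
  have a2 := (abs_le.1 (abs_proxModel_sub_le hM hg hx h₂₁ h₂₂ hL₁.le hL)).2
  rw [norm_sub_rev y₂ y₁] at g1
  have : L₁ / 2 * ‖y₁ - y₂‖ ^ 2 ≤ L₂ / 2 * ‖y₁ - y₂‖ ^ 2 := by gcongr
  linarith

end Sensitivity

/-! ### Polynomial bounds in `1/ε` -/

section PolynomialBounds

/-- `q` is nonnegative and polynomially bounded in `1/ε` for `ε ∈ (0, 1/2]`. -/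
def PolyBdd (q : ℝ → ℝ) : Prop :=
  ∃ (K : ℝ) (m : ℕ), ∀ ε, 0 < ε → ε ≤ 1 / 2 → 0 ≤ q ε ∧ q ε ≤ K * (1 / ε) ^ m

lemma PolyBdd.const {c : ℝ} (hc : 0 ≤ c) : PolyBdd fun _ => c :=
  ⟨c, 0, fun _ _ _ => ⟨hc, by simp⟩⟩

lemma polyBdd_one_div : PolyBdd fun ε => 1 / ε :=
  ⟨1, 1, fun ε hε _ => ⟨by positivity, by simp⟩⟩

lemma PolyBdd.mul {q r : ℝ → ℝ} (hq : PolyBdd q) (hr : PolyBdd r) :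
    PolyBdd fun ε => q ε * r ε := by
  obtain ⟨K, m, h⟩ := hq
  obtain ⟨K', m', h'⟩ := hr
  refine ⟨K * K', m + m', fun ε hε hε' => ⟨mul_nonneg (h ε hε hε').1 (h' ε hε hε').1, ?_⟩⟩
  have h1 := h ε hε hε'
  calc q ε * r ε ≤ (K * (1 / ε) ^ m) * (K' * (1 / ε) ^ m') :=
        mul_le_mul h1.2 (h' ε hε hε').2 (h' ε hε hε').1 (h1.1.trans h1.2)
    _ = _ := by ring

lemma PolyBdd.add {q r : ℝ → ℝ} (hq : PolyBdd q) (hr : PolyBdd r) :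
    PolyBdd fun ε => q ε + r ε := by
  obtain ⟨K, m, h⟩ := hq
  obtain ⟨K', m', h'⟩ := hr
  refine ⟨|K| + |K'|, m + m', fun ε hε hε' =>
    ⟨add_nonneg (h ε hε hε').1 (h' ε hε hε').1, ?_⟩⟩
  have h1 : 1 ≤ 1 / ε := by rw [le_div_iff₀ hε]; linarith
  have h2 : K * (1 / ε) ^ m ≤ |K| * (1 / ε) ^ (m + m') := by
    gcongr
    · exact le_abs_self K
    · omega
  have h3 : K' * (1 / ε) ^ m' ≤ |K'| * (1 / ε) ^ (m + m') := by
    gcongr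
    · exact le_abs_self K'
    · omega
  have := (h ε hε hε').2
  have := (h' ε hε hε').2
  linarith

lemma PolyBdd.pow {q : ℝ → ℝ} (hq : PolyBdd q) (k : ℕ) : PolyBdd fun ε => q ε ^ k := by
  induction k with
  | zero => simpa using PolyBdd.const zero_le_one
  | succ k ih => simpa only [pow_succ] using ih.mul hq

lemma log_two_le_log_one_div {ε : ℝ} (hε : 0 < ε) (hε' : ε ≤ 1 / 2) :
    Real.log 2 ≤ Real.log (1 / ε) := by
  refine Real.log_le_log (by norm_num) ?_
  rw [le_div_iff₀ hε]; linarith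

/-- The degree becomes a factor of `log(1/ε)`; the additive constants are absorbed because `ε ≤ 1/2`
keeps `log(1/ε)` above `log 2`. -/
lemma PolyBdd.ceil_logb_le {q : ℝ → ℝ} (hq : PolyBdd q)
    (hpos : ∀ ε, 0 < ε → ε ≤ 1 / 2 → 0 < q ε) :
    ∃ C : ℝ, 0 < C ∧ ∀ ε, 0 < ε → ε ≤ 1 / 2 →
      (⌈Real.logb 2 (q ε)⌉₊ : ℝ) ≤ C * Real.log (1 / ε) := by
  obtain ⟨K, m, h⟩ := hq
  have hl2 : 0 < Real.log 2 := Real.log_pos (by norm_num)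
  set K' := max K 1 with hK'
  have hK1 : 1 ≤ K' := le_max_right _ _
  have hK0 : 0 ≤ Real.logb 2 K' := Real.logb_nonneg (by norm_num) hK1
  refine ⟨(Real.logb 2 K' + 1 + m) / Real.log 2, by positivity, fun ε hε hε' => ?_⟩
  have hln := log_two_le_log_one_div hε hε'
  have hεp : 0 < (1 / ε) := by positivity
  set b := Real.logb 2 K' + m * (Real.log (1 / ε) / Real.log 2) with hb
  have hb0 : 0 ≤ b := by
    have : 0 ≤ Real.log (1 / ε) := hl2.le.trans hln
    positivity
  have h1 : Real.logb 2 (q ε) ≤ b := by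
    have h2 : q ε ≤ K' * (1 / ε) ^ m :=
      (h ε hε hε').2.trans (mul_le_mul_of_nonneg_right (le_max_left _ _) (by positivity))
    refine (Real.logb_le_logb_of_le (by norm_num) (hpos ε hε hε') h2).trans (le_of_eq ?_)
    rw [Real.logb_mul (by positivity) (by positivity), Real.logb_pow, hb, Real.logb, Real.logb]
  have h3 : (⌈Real.logb 2 (q ε)⌉₊ : ℝ) ≤ ⌈b⌉₊ := by exact_mod_cast Nat.ceil_le_ceil h1
  have h4 := (Nat.ceil_lt_add_one hb0).le
  refine (h3.trans h4).trans ?_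
  have h5 : Real.logb 2 K' + 1 ≤ (Real.logb 2 K' + 1) * (Real.log (1 / ε) / Real.log 2) :=
    le_mul_of_one_le_right (by positivity) (by rwa [le_div_iff₀ hl2, one_mul])
  calc b + 1 ≤ (Real.logb 2 K' + 1) * (Real.log (1 / ε) / Real.log 2)
        + m * (Real.log (1 / ε) / Real.log 2) := by rw [hb]; linarith
    _ = _ := by ring

end PolynomialBounds

/-! ### Choice of the search parameters -/

section SearchBounds

/-- The constant `2 (p+1) M / p!` in the condition on `L_k`. -/
noncomputable def stepConst (p : ℕ) (M : ℝ) : ℝ := 2 * (p + 1) * M / (p ! : ℝ)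

lemma stepConst_pos (p : ℕ) {M : ℝ} (hM : 0 < M) : 0 < stepConst p M := by
  unfold stepConst; positivity

/-- Quantities governing the bisection search for `L_k`: `D` bounds the distances to the minimizer,
`H` the lengths of the trial steps, `[ℓ, U]` is the search interval, `δ` the resolution
at which the search has succeeded, and `S` the number of bisections. -/
structure IsSearchBound (p : ℕ) (M Δ₀ ε D H ℓ U δ : ℝ) (S : ℕ) : Prop where
  one_le_D : 1 ≤ D
  radius_le : 8 * Δ₀ / ε ≤ D
  y_le : (8 * Δ₀ / ε) ^ 2 * (2 * stepConst p M * (2 * (8 * Δ₀ / ε)) ^ (p - 1))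
    ≤ regParam Δ₀ ε * D ^ 2
  ℓ_pos : 0 < ℓ
  ℓ_le : ℓ ≤ ε / 4
  ℓ_le_mul : ℓ ≤ stepConst p M * (ε / 4)
  one_le_H : 1 ≤ H
  le_H : D ^ 2 + 2 * M * D ^ (p + 1) / ℓ ≤ H
  lt_U : 2 * stepConst p M * H ^ (p - 1) < U
  ℓ_lt_U : ℓ < U
  δ_le : δ ≤ ℓ / 2
  shift : 2 * D * δ / ℓ ≤ ℓ / (8 * (stepConst p M * p * H ^ (p - 1)))
  model : 2 * ((2 * p + 2) * M * (H + 2 * D) ^ p * (2 * D / ℓ) + (H + 2 * D) ^ 2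
    + U * (H + 2 * D) * (2 * D / ℓ)) * δ ≤ ℓ * (ℓ / (8 * (stepConst p M * p * H ^ (p - 1)))) ^ 2
  δ_pos : 0 < δ
  U_le : U ≤ δ * 2 ^ S

/-- Reciprocals keep every parameter a polynomial expression in `1/ε`: `J = 1/ℓ`, `q = 1/δ`, and
`1/V` is the tolerance for displacements in the gap estimate. The three summands of `q` serve the
three upper bounds on `δ`. -/
lemma isSearchBound_of_eq {p : ℕ} (hp : 2 ≤ p) {M Δ₀ ε R J D H U V W q : ℝ} {S : ℕ} (hM : 0 < M)
    (hΔ : 0 < Δ₀) (hε : 0 < ε) (hε' : ε ≤ 1 / 2) (hR : R = 8 * Δ₀ * (1 / ε))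
    (hJ : J = 4 / min 1 (stepConst p M) * (1 / ε))
    (hD : D = R + R ^ 2 * (2 * stepConst p M * (2 * R) ^ (p - 1)) * (32 * Δ₀ * (1 / ε) ^ 2) + 1)
    (hH : H = D ^ 2 + 2 * M * D ^ (p + 1) * J + 1)
    (hU : U = 2 * stepConst p M * H ^ (p - 1) + 1)
    (hV : V = 8 * (stepConst p M * p * H ^ (p - 1)) * J)
    (hW : W = 2 * ((2 * p + 2) * M * (H + 2 * D) ^ p * (2 * D * J)
      + (H + 2 * D) ^ 2 + U * (H + 2 * D) * (2 * D * J)))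
    (hq : q = 2 * J + 2 * D * J * V + W * J * V ^ 2) (hS : U * q ≤ 2 ^ S) :
    IsSearchBound p M Δ₀ ε D H (1 / J) U (1 / q) S := by
  have hc1 := stepConst_pos p hM
  set c := stepConst p M with hc
  have hp0 : (0 : ℝ) < p := by exact_mod_cast (by omega : 0 < p)
  have ha0 : 0 < min 1 c := lt_min one_pos hc1
  have pR : 0 < R := by rw [hR]; positivity
  have pJ : 0 < J := by rw [hJ]; positivity
  have pD' : 0 ≤ R ^ 2 * (2 * c * (2 * R) ^ (p - 1)) * (32 * Δ₀ * (1 / ε) ^ 2) := by positivity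
  have pD : 1 ≤ D := by linarith
  have pH' : 0 ≤ 2 * M * D ^ (p + 1) * J := by positivity
  have pH : 1 ≤ H := by have := sq_nonneg D; linarith
  have pU' : 0 ≤ 2 * c * H ^ (p - 1) := by positivity
  have pU : 1 ≤ U := by linarith
  have pV : 0 < V := by rw [hV]; positivity
  have pW : 0 < W := by rw [hW]; positivity
  have pq : 0 < q := by rw [hq]; positivity
  have eR : 8 * Δ₀ / ε = R := by rw [hR]; ring
  have eℓ : 1 / J = min 1 c * (ε / 4) := by rw [hJ]; field_simp
  have eV : 1 / J / (8 * (c * p * H ^ (p - 1))) = 1 / V := by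
    rw [hV]; field_simp
  have hq1 : 2 * J ≤ q := by
    have : 0 ≤ 2 * D * J * V + W * J * V ^ 2 := by positivity
    linarith
  have hq2 : 2 * D * J * V ≤ q := by
    have : 0 ≤ 2 * J + W * J * V ^ 2 := by positivity
    linarith
  have hq3 : W * J * V ^ 2 ≤ q := by
    have : 0 ≤ 2 * J + 2 * D * J * V := by positivity
    linarith
  have ha1 : 1 / J ≤ ε / 4 := by
    rw [eℓ]; exact mul_le_of_le_one_left (by positivity) (min_le_left _ _)
  constructor
  · exact pD
  · rw [eR]; linarith
  · rw [eR]
    have h2 : D ≤ D ^ 2 := by nlinarith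
    have h1 : R ^ 2 * (2 * c * (2 * R) ^ (p - 1)) * (32 * Δ₀ * (1 / ε) ^ 2) ≤ D ^ 2 := by linarith
    have h3 : regParam Δ₀ ε * (32 * Δ₀ * (1 / ε) ^ 2) = 1 := by
      unfold regParam; field_simp
    have h4 := mul_le_mul_of_nonneg_left h1 (regParam_pos hΔ hε).le
    refine le_trans (le_of_eq ?_) h4
    linear_combination (-(R ^ 2 * (2 * c * (2 * R) ^ (p - 1)))) * h3
  · positivity
  · exact ha1
  · rw [eℓ]; exact mul_le_mul_of_nonneg_right (min_le_right _ _) (by positivity)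
  · exact pH
  · rw [div_div_eq_mul_div, div_one]; linarith
  · rw [← hc]; linarith
  · linarith
  · rw [div_div, one_div_le_one_div pq (by positivity)]
    linarith
  · rw [← hc, eV, div_div_eq_mul_div, div_one, mul_one_div, div_mul_eq_mul_div,
      div_le_div_iff₀ pq pV]
    linarith
  · rw [← hc, eV, div_div_eq_mul_div, div_one, ← hW, mul_one_div, div_le_iff₀ pq]
    have : W = 1 / J * (1 / V) ^ 2 * (W * J * V ^ 2) := by field_simp
    rw [this]
    gcongr
  · positivity
  · rw [one_div_mul_eq_div, le_div_iff₀ pq]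
    exact hS

lemma exists_isSearchBound {p : ℕ} (hp : 2 ≤ p) {M Δ₀ : ℝ} (hM : 0 < M) (hΔ : 0 < Δ₀) :
    ∃ C : ℝ, 0 < C ∧ ∀ ε, 0 < ε → ε ≤ 1 / 2 → ∃ (D H ℓ U δ : ℝ) (S : ℕ),
      IsSearchBound p M Δ₀ ε D H ℓ U δ S ∧ (S : ℝ) ≤ C * Real.log (1 / ε) := by
  have hc1 := stepConst_pos p hM
  have ha0 : 0 < min 1 (stepConst p M) := lt_min one_pos hc1
  have two : PolyBdd fun _ => 2 := .const zero_le_two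
  have one : PolyBdd fun _ => 1 := .const zero_le_one
  have bc : PolyBdd fun _ => stepConst p M := .const hc1.le
  have bM : PolyBdd fun _ => M := .const hM.le
  have bp : PolyBdd fun _ => (p : ℝ) := .const p.cast_nonneg
  obtain ⟨R, hR, bR⟩ : ∃ R : ℝ → ℝ, (∀ ε, R ε = 8 * Δ₀ * (1 / ε)) ∧ PolyBdd R :=
    ⟨_, fun _ => rfl, (PolyBdd.const (by positivity)).mul polyBdd_one_div⟩
  obtain ⟨J, hJ, bJ⟩ : ∃ J : ℝ → ℝ, (∀ ε, J ε = 4 / min 1 (stepConst p M) * (1 / ε)) ∧ PolyBdd J :=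
    ⟨_, fun _ => rfl, (PolyBdd.const (by positivity)).mul polyBdd_one_div⟩
  obtain ⟨D, hD, bD⟩ : ∃ D : ℝ → ℝ, (∀ ε, D ε = R ε + R ε ^ 2 * (2 * stepConst p M
      * (2 * R ε) ^ (p - 1)) * (32 * Δ₀ * (1 / ε) ^ 2) + 1) ∧ PolyBdd D :=
    ⟨_, fun _ => rfl, (bR.add (((bR.pow 2).mul ((two.mul bc).mul ((two.mul bR).pow _))).mul
      ((PolyBdd.const (by positivity)).mul (polyBdd_one_div.pow 2)))).add one⟩
  obtain ⟨H, hH, bH⟩ : ∃ H : ℝ → ℝ, (∀ ε, H ε = D ε ^ 2 + 2 * M * D ε ^ (p + 1) * J ε + 1)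
      ∧ PolyBdd H :=
    ⟨_, fun _ => rfl, ((bD.pow 2).add (((two.mul bM).mul (bD.pow _)).mul bJ)).add one⟩
  obtain ⟨U, hU, bU⟩ : ∃ U : ℝ → ℝ, (∀ ε, U ε = 2 * stepConst p M * H ε ^ (p - 1) + 1)
      ∧ PolyBdd U := ⟨_, fun _ => rfl, ((two.mul bc).mul (bH.pow _)).add one⟩
  obtain ⟨V, hV, bV⟩ : ∃ V : ℝ → ℝ, (∀ ε, V ε = 8 * (stepConst p M * p * H ε ^ (p - 1)) * J ε)
      ∧ PolyBdd V :=
    ⟨_, fun _ => rfl, ((PolyBdd.const (by norm_num)).mul ((bc.mul bp).mul (bH.pow _))).mul bJ⟩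
  have bρ := bH.add (two.mul bD)
  have bDJ := (two.mul bD).mul bJ
  obtain ⟨W, hW, bW⟩ : ∃ W : ℝ → ℝ, (∀ ε, W ε = 2 * ((2 * p + 2) * M * (H ε + 2 * D ε) ^ p
      * (2 * D ε * J ε) + (H ε + 2 * D ε) ^ 2 + U ε * (H ε + 2 * D ε) * (2 * D ε * J ε)))
      ∧ PolyBdd W :=
    ⟨_, fun _ => rfl, two.mul ((((((two.mul bp).add two).mul bM).mul (bρ.pow p)).mul bDJ).add
      (bρ.pow 2) |>.add ((bU.mul bρ).mul bDJ))⟩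
  obtain ⟨q, hq, bq⟩ : ∃ q : ℝ → ℝ, (∀ ε, q ε = 2 * J ε + 2 * D ε * J ε * V ε
      + W ε * J ε * V ε ^ 2) ∧ PolyBdd q :=
    ⟨_, fun _ => rfl, ((two.mul bJ).add (bDJ.mul bV)).add ((bW.mul bJ).mul (bV.pow 2))⟩
  obtain ⟨r, hr, br⟩ : ∃ r : ℝ → ℝ, (∀ ε, r ε = U ε * q ε + 1) ∧ PolyBdd r :=
    ⟨_, fun _ => rfl, (bU.mul bq).add one⟩
  have rpos : ∀ ε, 0 < ε → ε ≤ 1 / 2 → 0 < r ε := by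
    intro ε hε hε'
    obtain ⟨K, m, h⟩ := bU.mul bq
    have := (h ε hε hε').1
    rw [hr]; linarith
  obtain ⟨C, hC0, hC⟩ := br.ceil_logb_le rpos
  refine ⟨C, hC0, fun ε hε hε' => ?_⟩
  refine ⟨D ε, H ε, 1 / J ε, U ε, 1 / q ε, ⌈Real.logb 2 (r ε)⌉₊, ?_, hC ε hε hε'⟩
  refine isSearchBound_of_eq hp hM hΔ hε hε' (hR ε) (hJ ε) (hD ε) (hH ε) (hU ε) (hV ε) (hW ε)
    (hq ε) ?_
  have h1 : r ε ≤ 2 ^ ⌈Real.logb 2 (r ε)⌉₊ := by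
    rw [← Real.rpow_natCast, ← Real.logb_le_iff_le_rpow (by norm_num) (rpos ε hε hε')]
    exact Nat.le_ceil _
  have := hr ε
  linarith

end SearchBounds

/-! ### Separation of long and short trial values -/

section Search

variable {p n : ℕ} {M Δ₀ ε D H ℓ U δ : ℝ} {S : ℕ} {g : Euc n → ℝ}

/-- The length of a trial step in the search interval. -/
lemma IsSearchBound.trial_length_le (hb : IsSearchBound p M Δ₀ ε D H ℓ U δ S) (hp : 2 ≤ p)
    (hM : 0 < M) (hg : HasLipschitzDeriv p M g) {xs : Euc n} (hxs : ∀ x, g xs ≤ g x) {L : ℝ}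
    (hL : ℓ ≤ L) {x y : Euc n} (hx : ‖x - xs‖ ≤ D)
    (hy : IsTensorStep p (p * M) (addQuad g L x) x y) : ‖y - x‖ ≤ H := by
  have hℓ := hb.ℓ_pos
  have hD : 0 < D := one_pos.trans_le hb.one_le_D
  have h1 := hg.proxStep_length_sq_le hp hM hxs (hℓ.trans_le hL) hx hy
  have h2 : 2 * M * D ^ (p + 1) / L ≤ 2 * M * D ^ (p + 1) / ℓ := by gcongr
  have h3 := hb.le_H
  have h4 := hb.one_le_H
  refine le_of_sq_le_sq ?_ (by linarith)
  nlinarith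

/-- Trial values of `L` with step lengths on different sides of the admissible range are separated
by more than `δ`. -/
lemma IsSearchBound.gap (hb : IsSearchBound p M Δ₀ ε D H ℓ U δ S) (hp : 2 ≤ p) (hM : 0 < M)
    (hg : HasLipschitzDeriv p M g) (hconv : ConvexOn ℝ Set.univ g) {xs : Euc n}
    (hxs : ∀ x, g xs ≤ g x) {A : ℝ} (hA : 0 ≤ A) {y u : Euc n} (hy : ‖y - xs‖ ≤ D)
    (hu : ‖u - xs‖ ≤ D) {L₁ L₂ : ℝ} (h₁ : ℓ ≤ L₁) (h₁₂ : L₁ ≤ L₂) (h₂ : L₂ ≤ U) {y₁ y₂ : Euc n}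
    (hy₁ : IsTensorStep p (p * M) (addQuad g L₁ (extrapolate A L₁ y u)) (extrapolate A L₁ y u) y₁)
    (hy₂ : IsTensorStep p (p * M) (addQuad g L₂ (extrapolate A L₂ y u)) (extrapolate A L₂ y u) y₂)
    (hlong : L₁ < stepConst p M * ‖y₁ - extrapolate A L₁ y u‖ ^ (p - 1))
    (hshort : 2 * stepConst p M * ‖y₂ - extrapolate A L₂ y u‖ ^ (p - 1) < L₂) :
    δ < L₂ - L₁ := by
  by_contra hc
  push Not at hc
  have hℓ := hb.ℓ_pos
  have hL₁ : 0 < L₁ := hℓ.trans_le h₁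
  have hL₂ : 0 < L₂ := hL₁.trans_le h₁₂
  have hD : 0 < D := one_pos.trans_le hb.one_le_D
  have hH : 0 < H := one_pos.trans_le hb.one_le_H
  have hU : 0 < U := hL₂.trans_le h₂
  have hδ := hb.δ_pos
  have hp0 : (0 : ℝ) < p := by exact_mod_cast (by omega : 0 < p)
  have hx₁ := norm_extrapolate_sub_le hA hL₁ hy hu
  have hx₂ := norm_extrapolate_sub_le hA hL₂ hy hu
  have hxx := norm_extrapolate_sub_extrapolate_le hA hL₁ h₁₂ y u
  set x₁ := extrapolate A L₁ y u
  set x₂ := extrapolate A L₂ y u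
  have hl₁ := hb.trial_length_le hp hM hg hxs h₁ hx₁ hy₁
  have hl₂ := hb.trial_length_le hp hM hg hxs (h₁.trans h₁₂) hx₂ hy₂
  have hc1 := stepConst_pos p hM
  set c := stepConst p M
  set Z := c * p * H ^ (p - 1) with hZ
  have hZ0 : 0 < Z := by positivity
  -- If `L₂ - L₁ ≤ δ`, both the extrapolated points and the trial points move by at most `v`, so the
  -- step lengths differ by at most `2v`.
  set v := ℓ / (8 * Z) with hv
  have hv0 : 0 < v := by positivity
  have huy : ‖u - y‖ ≤ 2 * D := by
    rw [← sub_sub_sub_cancel_right u y xs]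
    exact (norm_sub_le _ _).trans (by linarith)
  have hxx2 : ‖x₁ - x₂‖ ≤ 2 * D := by
    rw [← sub_sub_sub_cancel_right x₁ x₂ xs]
    exact (norm_sub_le _ _).trans (by linarith)
  have hdx : ‖x₁ - x₂‖ ≤ δ * (2 * D / ℓ) := by
    refine hxx.trans ?_
    calc (L₂ - L₁) / L₁ * ‖u - y‖ ≤ δ / ℓ * (2 * D) := by
          have : 0 ≤ L₂ - L₁ := by linarith
          gcongr
      _ = _ := by ring
  have hdxv : ‖x₁ - x₂‖ ≤ v := by
    refine hdx.trans (le_trans (le_of_eq ?_) hb.shift)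
    ring
  have t₁₂ : ‖y₁ - x₂‖ ≤ H + 2 * D := by
    rw [← sub_add_sub_cancel y₁ x₁ x₂]
    exact (norm_add_le _ _).trans (by linarith)
  have t₂₁ : ‖y₂ - x₁‖ ≤ H + 2 * D := by
    rw [← sub_add_sub_cancel y₂ x₂ x₁]
    rw [norm_sub_rev] at hxx2
    exact (norm_add_le _ _).trans (by linarith)
  have hsq := hg.norm_proxStep_sub_sq_le hp hM hconv (ρ := H + 2 * D) (by linarith) (by linarith)
    t₁₂ t₂₁ (by linarith) hL₁ h₁₂ hy₁ hy₂
  have hyy : ‖y₁ - y₂‖ ≤ v := by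
    have h5 : ℓ * ‖y₁ - y₂‖ ^ 2 ≤ ℓ * v ^ 2 := by
      calc ℓ * ‖y₁ - y₂‖ ^ 2 ≤ L₁ * ‖y₁ - y₂‖ ^ 2 := by gcongr
        _ ≤ _ := hsq
        _ ≤ 2 * ((2 * p + 2) * M * (H + 2 * D) ^ p * (δ * (2 * D / ℓ)) + δ * (H + 2 * D) ^ 2
            + U * (H + 2 * D) * (δ * (2 * D / ℓ))) := by gcongr
        _ = 2 * ((2 * p + 2) * M * (H + 2 * D) ^ p * (2 * D / ℓ) + (H + 2 * D) ^ 2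
            + U * (H + 2 * D) * (2 * D / ℓ)) * δ := by ring
        _ ≤ _ := hb.model
    exact le_of_sq_le_sq (le_of_mul_le_mul_left h5 hℓ) hv0.le
  have hh : |‖y₁ - x₁‖ - ‖y₂ - x₂‖| ≤ 2 * v := by
    refine (abs_norm_sub_norm_le _ _).trans ?_
    rw [show y₁ - x₁ - (y₂ - x₂) = (y₁ - y₂) - (x₁ - x₂) by abel]
    exact (norm_sub_le _ _).trans (by linarith)
  have hpow := pow_sub_pow_le_mul (norm_nonneg (y₁ - x₁)) (norm_nonneg (y₂ - x₂)) hl₁ hl₂ (p - 1)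
  -- Here the factor 2 between the two conditions on `L` is used: long and short together make the
  -- left side exceed `L₁ - L₂/2 ≥ (ℓ - δ)/2 ≥ ℓ/4`.
  have hfin : c * (‖y₁ - x₁‖ ^ (p - 1) - ‖y₂ - x₂‖ ^ (p - 1)) ≤ ℓ / 4 := by
    calc c * (‖y₁ - x₁‖ ^ (p - 1) - ‖y₂ - x₂‖ ^ (p - 1))
        ≤ c * (((p - 1 : ℕ) : ℝ) * H ^ (p - 1 - 1) * |‖y₁ - x₁‖ - ‖y₂ - x₂‖|) := by
          gcongr
          exact (le_abs_self _).trans hpow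
      _ ≤ c * (p * H ^ (p - 1) * (2 * v)) := by
          gcongr
          · omega
          · exact hb.one_le_H
          · omega
      _ = ℓ / 4 := by
          rw [hv, hZ]; field_simp; norm_num
  have := hb.δ_le
  linarith

end Search

/-! ### What a trial needs from the oracle, and extending an execution -/

section Trial

variable {p n : ℕ} {M Δ₀ ε : ℝ} {x₀ z : Euc n} {f f₀ g : Euc n → ℝ}

lemma tensorModel_congr_oracle (K : ℝ) {x : Euc n} (h : oracle p f x = oracle p f₀ x) :
    tensorModel p K f x = tensorModel p K f₀ x := by
  funext y
  unfold tensorModel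
  congr 1
  refine Finset.sum_congr rfl fun r hr => ?_
  have : iteratedFDeriv ℝ r f x = iteratedFDeriv ℝ r f₀ x :=
    congrFun h ⟨r, Finset.mem_range.1 hr⟩
  rw [this]

lemma gradient_congr_oracle (hp : 2 ≤ p) {x : Euc n} (h : oracle p f x = oracle p f₀ x) :
    gradient f x = gradient f₀ x := by
  have h1 : iteratedFDeriv ℝ 1 f x = iteratedFDeriv ℝ 1 f₀ x := congrFun h ⟨1, by omega⟩
  have h2 : fderiv ℝ f x = fderiv ℝ f₀ x := by
    ext v
    have := congrArg (fun T => T fun _ => v) h1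
    simpa only [iteratedFDeriv_one_apply] using this
  unfold gradient
  rw [h2]

lemma isTensorStep_addQuad_congr_oracle (hp : 2 ≤ p) (hf : HasLipschitzDeriv p M f)
    (hf₀ : HasLipschitzDeriv p M f₀) {K L : ℝ} {x w y : Euc n} (h : oracle p f x = oracle p f₀ x)
    (hy : IsTensorStep p K (addQuad f₀ L w) x y) : IsTensorStep p K (addQuad f L w) x y := by
  have : tensorModel p K (addQuad f L w) x = tensorModel p K (addQuad f₀ L w) x := by
    funext y
    rw [tensorModel_addQuad hp hf.contDiff, tensorModel_addQuad hp hf₀.contDiff,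
      tensorModel_congr_oracle K h]
  unfold IsTensorStep
  rwa [this]

/-- Only the jet of `f` at the extrapolated point enters the model, so a trial point computed for
one function serves all functions with that jet. -/
lemma InnerTrace.IsTrial.congr_oracle (hp : 2 ≤ p) {t : InnerTrace n} {j : ℕ} {L μ : ℝ}
    {y : Euc n} (hf : HasLipschitzDeriv p M f) (hf₀ : HasLipschitzDeriv p M f₀)
    (h : oracle p f (extrapolate (t.A j) L (t.y j) (t.u j))
      = oracle p f₀ (extrapolate (t.A j) L (t.y j) (t.u j)))
    (hy : t.IsTrial p M (addQuad f₀ μ x₀) j L y) : t.IsTrial p M (addQuad f μ x₀) j L y := by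
  unfold InnerTrace.IsTrial IsTensorStep at *
  have : ∀ w, tensorModel p (p * M) (addQuad (addQuad f μ x₀) L w)
        (extrapolate (t.A j) L (t.y j) (t.u j))
      = tensorModel p (p * M) (addQuad (addQuad f₀ μ x₀) L w)
        (extrapolate (t.A j) L (t.y j) (t.u j)) := by
    intro w
    funext v
    rw [tensorModel_addQuad hp (hasLipschitzDeriv_addQuad hp hf _ _).contDiff,
      tensorModel_addQuad hp (hasLipschitzDeriv_addQuad hp hf₀ _ _).contDiff,
      tensorModel_addQuad hp hf.contDiff, tensorModel_addQuad hp hf₀.contDiff,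
      tensorModel_congr_oracle _ h]
  rwa [this]

/-- The length of the tensor step from the point extrapolated with `L`. -/
noncomputable def InnerTrace.trialLength (t : InnerTrace n) (j : ℕ) (L : ℝ) (y : Euc n) : ℝ :=
  ‖y - extrapolate (t.A j) L (t.y j) (t.u j)‖

/-- The execution continued with the value `L`, the point `y` and the gradient `v` in
iteration `j`. -/
noncomputable def InnerTrace.extend (t : InnerTrace n) (j : ℕ) (L : ℝ) (y v : Euc n) :
    InnerTrace n where
  L := Function.update t.L j L
  A := Function.update t.A (j + 1) (t.A j + stepWeight (t.A j) L)
  y := Function.update t.y (j + 1) y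
  u := Function.update t.u (j + 1) (t.u j - stepWeight (t.A j) L • v)

lemma InnerTrace.IsRun.extend {t : InnerTrace n} {j : ℕ} (h : t.IsRun p M g z j) {L : ℝ}
    (hL : 0 < L) {y : Euc n} (hy : t.IsTrial p M g j L y)
    (hlow : L ≤ 2 * stepConst p M * t.trialLength j L y ^ (p - 1))
    (hup : stepConst p M * t.trialLength j L y ^ (p - 1) ≤ L) :
    (t.extend j L y (gradient g y)).IsRun p M g z (j + 1) := by
  have e : 2 * (p + 1) * M / (p ! * L) * t.trialLength j L y ^ (p - 1)
      = stepConst p M * t.trialLength j L y ^ (p - 1) / L := by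
    unfold stepConst; field_simp
  refine ⟨?_, ?_, ?_, fun k hk => ?_⟩
  · simpa [InnerTrace.extend] using h.A_zero
  · simpa [InnerTrace.extend] using h.y_zero
  · simpa [InnerTrace.extend] using h.u_zero
  rcases Nat.lt_succ_iff_lt_or_eq.1 hk with hk | rfl
  · have hs := h.step k hk
    have h1 : k ≠ j := by omega
    have h2 : k ≠ j + 1 := by omega
    constructor
    · simpa [InnerTrace.extend, h1, h2] using hs.L_pos
    · simpa [InnerTrace.extend, h1, h2] using hs.A_succ
    · simpa [InnerTrace.extend, InnerTrace.IsTrial, h1, h2] using hs.y_succ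
    · simpa [InnerTrace.extend, h1, h2] using hs.lower
    · simpa [InnerTrace.extend, h1, h2] using hs.upper
    · simpa [InnerTrace.extend, h1, h2] using hs.u_succ
  · have h2 : k ≠ k + 1 := by omega
    constructor
    · simpa [InnerTrace.extend] using hL
    · simp [InnerTrace.extend]
    · simpa [InnerTrace.extend, InnerTrace.IsTrial] using hy
    · simp only [InnerTrace.extend, Function.update_self, Function.update_of_ne h2]
      rw [← InnerTrace.trialLength, e, div_le_div_iff₀ two_pos hL]
      linarith
    · simp only [InnerTrace.extend, Function.update_self, Function.update_of_ne h2]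
      rw [← InnerTrace.trialLength, e]
      exact div_le_one_of_le₀ hup hL.le
    · simp [InnerTrace.extend]

end Trial

/-! ### A priori bounds along an execution -/

section States

variable {p n : ℕ} {M Δ₀ ε D H ℓ U δ : ℝ} {S : ℕ} {x₀ z xs : Euc n} {f g : Euc n → ℝ}

lemma norm_sub_le_of_residual_le (hΔ : 0 < Δ₀) (hε : 0 < ε)
    (hgrow : regParam Δ₀ ε / 2 * ‖z - xs‖ ^ 2 ≤ g z - g xs) (hz : g z - g xs ≤ Δ₀) :
    ‖z - xs‖ ≤ 8 * Δ₀ / ε := by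
  have h := regParam_mul_norm_le hΔ hε hgrow hz
  have hμ := regParam_pos hΔ hε
  have e : regParam Δ₀ ε * (8 * Δ₀ / ε) = ε / 4 := by
    unfold regParam; field_simp; norm_num
  rw [← e] at h
  exact le_of_mul_le_mul_left h hμ

lemma InnerTrace.IsRun.A_one_le {t : InnerTrace n} {N : ℕ} (h : t.IsRun p M g z N) :
    ∀ k < N, t.A 1 ≤ t.A (k + 1) := by
  intro k
  induction k with
  | zero => intro _; exact le_rfl
  | succ k ih =>
    intro hk
    rw [(h.step (k + 1) hk).A_succ]
    have := stepWeight_pos (A := t.A (k + 1)) (h.step (k + 1) hk).L_pos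
    linarith [ih (by omega)]

/-- The iterates stay within distance `D` of the minimizer. -/
lemma IsSearchBound.norm_sub_le (hb : IsSearchBound p M Δ₀ ε D H ℓ U δ S) (hp : 2 ≤ p)
    (hM : 0 < M) (hΔ : 0 < Δ₀) (hε : 0 < ε)
    (hg : HasLipschitzDeriv p M g) (hconv : ConvexOn ℝ Set.univ g)
    (hxs : ∀ x, g xs ≤ g x) (hgrow : ∀ x, regParam Δ₀ ε / 2 * ‖x - xs‖ ^ 2 ≤ g x - g xs)
    (hz : g z - g xs ≤ Δ₀) {t : InnerTrace n} {j : ℕ} (h : t.IsRun p M g z j) :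
    ‖t.y j - xs‖ ≤ D ∧ ‖t.u j - xs‖ ≤ D := by
  have hzR := norm_sub_le_of_residual_le hΔ hε (hgrow z) hz
  have hu := h.norm_u_sub_le hp hM.le hg hconv hxs le_rfl
  refine ⟨?_, hu.trans (hzR.trans hb.radius_le)⟩
  have hμ := regParam_pos hΔ hε
  have hD : 0 < D := one_pos.trans_le hb.one_le_D
  rcases Nat.eq_zero_or_pos j with rfl | hj
  · rw [h.y_zero]; exact hzR.trans hb.radius_le
  obtain ⟨k, rfl⟩ : ∃ k, j = k + 1 := ⟨j - 1, by omega⟩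
  -- The potential bounds `u` directly. For `y` the first iteration suffices: `A_j ≥ A_1 = 1/L_0`,
  -- and `h_0² ≤ (4/3) R²` limits `L_0`, so the residual is at most `L_0 R²/2` and quadratic growth
  -- applies.
  have hL0 := (h.step 0 hj).L_pos
  have hA1 : t.A 1 = 1 / t.L 0 := by
    rw [(h.step 0 hj).A_succ, h.A_zero, stepWeight_zero hL0, zero_add]
  have hA : 1 / t.L 0 ≤ t.A (k + 1) := hA1 ▸ h.A_one_le k (Nat.lt_succ_self k)
  have hsum := h.sum_le hp hM.le hg hconv hxs (k := 1) hj
  rw [Finset.sum_range_one, zero_add, hA1, one_div_mul_cancel hL0.ne', one_mul] at hsum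
  set R := 8 * Δ₀ / ε with hR
  have hR0 : 0 < R := by positivity
  have hzR2 : ‖z - xs‖ ^ 2 ≤ R ^ 2 := by gcongr
  have hh : t.stepLength 0 ≤ 2 * R := by
    refine le_of_sq_le_sq ?_ (by positivity)
    nlinarith
  have hL : t.L 0 ≤ 2 * stepConst p M * (2 * R) ^ (p - 1) := by
    have hc := stepConst_pos p hM
    refine (h.L_le hj).trans ?_
    rw [show 4 * (p + 1) * M / (p ! : ℝ) = 2 * stepConst p M by unfold stepConst; ring]
    have := t.stepLength_nonneg 0
    gcongr
  have hres := h.residual_le hp hM.le hg hconv xs le_rfl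
  have h0 := sub_nonneg.2 (hxs (t.y (k + 1)))
  have h1 : g (t.y (k + 1)) - g xs ≤ t.L 0 * (1 / 2 * R ^ 2) := by
    have h2 : 1 / t.L 0 * (g (t.y (k + 1)) - g xs) ≤ 1 / 2 * R ^ 2 :=
      (mul_le_mul_of_nonneg_right hA h0).trans (hres.trans (by linarith))
    calc g (t.y (k + 1)) - g xs = t.L 0 * (1 / t.L 0 * (g (t.y (k + 1)) - g xs)) := by
          field_simp
      _ ≤ _ := mul_le_mul_of_nonneg_left h2 hL0.le
  have h3 : t.L 0 * (1 / 2 * R ^ 2) ≤ (2 * stepConst p M * (2 * R) ^ (p - 1)) * (1 / 2 * R ^ 2) :=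
    mul_le_mul_of_nonneg_right hL (by positivity)
  have h4 := hb.y_le
  have h5 := hgrow (t.y (k + 1))
  have h6 : regParam Δ₀ ε * ‖t.y (k + 1) - xs‖ ^ 2 ≤ regParam Δ₀ ε * D ^ 2 := by linarith
  exact le_of_sq_le_sq (le_of_mul_le_mul_left h6 hμ) hD.le

/-- Applying the tangent inequality to `f` rather than to `f_μ` and adding the quadratic growth
gives the full constant `μ` instead of `μ/2`. -/
lemma mul_norm_sub_le_norm_gradient {μ : ℝ} (hf : Differentiable ℝ f)
    (hconv : ConvexOn ℝ Set.univ f)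
    (hgrow : ∀ x, μ / 2 * ‖x - xs‖ ^ 2 ≤ addQuad f μ x₀ x - addQuad f μ x₀ xs) (y : Euc n) :
    μ * ‖y - xs‖ ≤ ‖gradient (addQuad f μ x₀) y‖ := by
  rcases (norm_nonneg (y - xs)).eq_or_lt with h0 | h0
  · rw [← h0, mul_zero]; exact norm_nonneg _
  have h1 := hconv.add_fderiv_le hf y xs
  rw [← inner_gradient_left] at h1
  have h2 := real_inner_le_norm (gradient (addQuad f μ x₀) y) (y - xs)
  rw [gradient_addQuad hf] at h2 ⊢
  rw [inner_add_left, real_inner_smul_left] at h2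
  have h3 := hgrow y
  unfold addQuad at h3
  have e1 : inner ℝ (gradient f y) (xs - y) = -inner ℝ (gradient f y) (y - xs) := by
    rw [← inner_neg_right, neg_sub]
  have e2 : ‖xs - x₀‖ ^ 2 = ‖y - x₀‖ ^ 2 - 2 * inner ℝ (y - x₀) (y - xs) + ‖y - xs‖ ^ 2 := by
    rw [← norm_sub_sq_real, sub_sub_sub_cancel_left]
  have h4 : μ * ‖y - xs‖ * ‖y - xs‖
      ≤ ‖gradient f y + μ • (y - x₀)‖ * ‖y - xs‖ := by
    rw [e1] at h1
    rw [e2] at h3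
    nlinarith
  exact le_of_mul_le_mul_right h4 h0

/-- A short step for the smallest trial value of `L` leads to a small gradient. -/
lemma IsSearchBound.norm_gradient_le (hb : IsSearchBound p M Δ₀ ε D H ℓ U δ S) (hp : 2 ≤ p)
    (hM : 0 < M) (hΔ : 0 < Δ₀) (hε : 0 < ε) (hε' : ε ≤ 1 / 2) (h : IsProblem p M Δ₀ x₀ f)
    {t : InnerTrace n} {j : ℕ} {y : Euc n}
    (hy : t.IsTrial p M (addQuad f (regParam Δ₀ ε) x₀) j ℓ y)
    (hshort : 2 * stepConst p M * t.trialLength j ℓ y ^ (p - 1) < ℓ) : ‖gradient f y‖ ≤ ε := by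
  obtain ⟨xs, -, hgrow, h0⟩ := h.exists_minimizer hp hΔ hε
  have hf := h.hasLipschitzDeriv.differentiable hp
  have hℓ := hb.ℓ_pos
  have hc := stepConst_pos p hM
  have hh0 : 0 ≤ t.trialLength j ℓ y := norm_nonneg _
  have hup : 2 * (p + 1) * M / (p ! * ℓ) * t.trialLength j ℓ y ^ (p - 1) ≤ 1 := by
    have e : 2 * (p + 1) * M / (p ! * ℓ) * t.trialLength j ℓ y ^ (p - 1)
        = stepConst p M * t.trialLength j ℓ y ^ (p - 1) / ℓ := by
      unfold stepConst; field_simp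
    rw [e]
    have : 0 ≤ stepConst p M * t.trialLength j ℓ y ^ (p - 1) := by positivity
    exact div_le_one_of_le₀ (by linarith) hℓ.le
  -- A step longer than 1 would give `2c < ℓ ≤ c ε/4`.
  have hh1 : t.trialLength j ℓ y ≤ 1 := by
    by_contra hcon
    push Not at hcon
    have h1 : 1 ≤ t.trialLength j ℓ y ^ (p - 1) := one_le_pow₀ hcon.le
    have h2 := hb.ℓ_le_mul
    nlinarith
  have h1 := (hasLipschitzDeriv_addQuad hp h.hasLipschitzDeriv
    (regParam Δ₀ ε) x₀).norm_gradient_prox_le_half hp hM.le hℓ hy hup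
  have h2 := norm_sub_norm_le (gradient (addQuad f (regParam Δ₀ ε) x₀) y)
    (-(ℓ • (y - extrapolate (t.A j) ℓ (t.y j) (t.u j))))
  rw [sub_neg_eq_add, norm_neg, norm_smul, Real.norm_of_nonneg hℓ.le] at h2
  rw [← InnerTrace.trialLength] at h1 h2
  have h3 : ℓ * t.trialLength j ℓ y ≤ ε / 4 :=
    (mul_le_of_le_one_right hℓ.le hh1).trans hb.ℓ_le
  -- The gradient of `f_μ` is at most `(3/2) ℓ h ≤ 3ε/8`, which also bounds `μ ‖y - xs‖`. The
  -- remaining `ε/4` belongs to `x₀`.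
  have h4 := mul_norm_sub_le_norm_gradient hf h.convex hgrow y
  have h5 := norm_gradient_le_of_addQuad hΔ hε hf
    (regParam_mul_norm_le hΔ hε (hgrow x₀) h0) (y := y)
  linarith

end States

/-! ### The search for `L_k` and the inner method as oracle procedures -/

section Search

variable {p n : ℕ} {M Δ₀ ε D H ℓ U δ : ℝ} {S N j m : ℕ} {x₀ z : Euc n}

instance : Inhabited (InnerTrace n) := ⟨⟨0, 0, 0, 0⟩⟩

/-- The instances for which `z` is an admissible starting point of the inner method. -/
def phaseClass (p : ℕ) (M Δ₀ ε : ℝ) {n : ℕ} (x₀ z : Euc n) : Set (Euc n → ℝ) :=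
  {f | IsProblem p M Δ₀ x₀ f ∧ ∀ x,
    addQuad f (regParam Δ₀ ε) x₀ z - addQuad f (regParam Δ₀ ε) x₀ x ≤ Δ₀}

/-- The result `r` records `N` iterations of the inner method, or fewer iterations followed by a
trial point with small gradient. -/
def InnerOutcome (p : ℕ) (M Δ₀ ε : ℝ) {n : ℕ} (x₀ z : Euc n) (N : ℕ) (f : Euc n → ℝ)
    (r : InnerTrace n × Option (Euc n)) : Prop :=
  (r.2 = none ∧ r.1.IsRun p M (addQuad f (regParam Δ₀ ε) x₀) z N) ∨
  ∃ y, r.2 = some y ∧ ‖gradient f y‖ ≤ ε ∧ ∃ i < N,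
    r.1.IsRun p M (addQuad f (regParam Δ₀ ε) x₀) z i ∧
    ∃ L : ℝ, 0 < L ∧ r.1.IsTrial p M (addQuad f (regParam Δ₀ ε) x₀) i L y

/-- The instances for which `t` is an execution of `j` iterations of the inner method. -/
def runClass (p : ℕ) (M Δ₀ ε : ℝ) {n : ℕ} (x₀ z : Euc n) (t : InnerTrace n) (j : ℕ) :
    Set (Euc n → ℝ) :=
  {f ∈ phaseClass p M Δ₀ ε x₀ z | t.IsRun p M (addQuad f (regParam Δ₀ ε) x₀) z j}

/-- The instances for which some tensor step with the value `L` is too long. -/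
def longClass (p : ℕ) (M Δ₀ ε : ℝ) {n : ℕ} (x₀ : Euc n) (t : InnerTrace n) (j : ℕ) (L : ℝ) :
    Set (Euc n → ℝ) :=
  {f | ∃ y, t.IsTrial p M (addQuad f (regParam Δ₀ ε) x₀) j L y ∧
    L < stepConst p M * t.trialLength j L y ^ (p - 1)}

/-- The instances for which some tensor step with the value `L` is too short. -/
def shortClass (p : ℕ) (M Δ₀ ε : ℝ) {n : ℕ} (x₀ : Euc n) (t : InnerTrace n) (j : ℕ) (L : ℝ) :
    Set (Euc n → ℝ) :=
  {f | ∃ y, t.IsTrial p M (addQuad f (regParam Δ₀ ε) x₀) j L y ∧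
    2 * stepConst p M * t.trialLength j L y ^ (p - 1) < L}

lemma IsProblem.exists_isTrial (hp : 2 ≤ p) (hM : 0 < M) (hΔ : 0 < Δ₀) (hε : 0 < ε)
    {f : Euc n → ℝ} (h : IsProblem p M Δ₀ x₀ f) (t : InnerTrace n) (j : ℕ) {L : ℝ} (hL : 0 < L) :
    ∃ y, t.IsTrial p M (addQuad f (regParam Δ₀ ε) x₀) j L y :=
  (hasLipschitzDeriv_addQuad hp (hasLipschitzDeriv_addQuad hp h.hasLipschitzDeriv _ _) _
    _).exists_isTensorStep hp hM
    (bddBelow_addQuad (bddBelow_addQuad h.bddBelow (regParam_pos hΔ hε).le _) hL.le _) _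

/-- Trying the value `L`. -/
lemma solvable_of_trial (hp : 2 ≤ p) (hM : 0 < M) (hΔ : 0 < Δ₀) (hε : 0 < ε) (t : InnerTrace n)
    {L : ℝ} (hL : 0 < L) {𝓕 : Set (Euc n → ℝ)} (h𝓕 : 𝓕 ⊆ runClass p M Δ₀ ε x₀ z t j)
    (hlong : Solvable (oracle p) (𝓕 ∩ longClass p M Δ₀ ε x₀ t j L)
      (InnerOutcome p M Δ₀ ε x₀ z (j + 1)) m)
    (hshort : ∀ y, 2 * stepConst p M * t.trialLength j L y ^ (p - 1) < L →
      Solvable (oracle p) {f ∈ 𝓕 | t.IsTrial p M (addQuad f (regParam Δ₀ ε) x₀) j L y}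
        (InnerOutcome p M Δ₀ ε x₀ z (j + 1)) m) :
    Solvable (oracle p) 𝓕 (InnerOutcome p M Δ₀ ε x₀ z (j + 1)) (m + 2) := by
  -- The first call yields the jet for the trial step; a second one, for the gradient at `y`, is
  -- made only if `L` is accepted.
  refine Solvable.ask (m := m + 1) (extrapolate (t.A j) L (t.y j) (t.u j)) fun f₀ hf₀ => ?_
  have hf₀P := (h𝓕 hf₀).1.1
  obtain ⟨y, hy⟩ := hf₀P.exists_isTrial hp hM hΔ hε t j hL
  have htrial : ∀ f ∈ 𝓕, oracle p f (extrapolate (t.A j) L (t.y j) (t.u j))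
      = oracle p f₀ (extrapolate (t.A j) L (t.y j) (t.u j)) →
      t.IsTrial p M (addQuad f (regParam Δ₀ ε) x₀) j L y := fun f hf h =>
    hy.congr_oracle hp (h𝓕 hf).1.1.hasLipschitzDeriv hf₀P.hasLipschitzDeriv h
  rcases lt_or_ge L (stepConst p M * t.trialLength j L y ^ (p - 1)) with h1 | h1
  · exact hlong.mono (fun f hf => ⟨hf.1, y, htrial f hf.1 hf.2, h1⟩) (by omega)
  rcases lt_or_ge (2 * stepConst p M * t.trialLength j L y ^ (p - 1)) L with h2 | h2
  · exact (hshort y h2).mono (fun f hf => ⟨hf.1, htrial f hf.1 hf.2⟩) (by omega)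
  refine Solvable.ask (m := m) y fun f₁ hf₁ => .of_result
    (t.extend j L y (gradient (addQuad f₁ (regParam Δ₀ ε) x₀) y), none) fun f hf => .inl ⟨rfl, ?_⟩
  have hgrad : gradient (addQuad f₁ (regParam Δ₀ ε) x₀) y
      = gradient (addQuad f (regParam Δ₀ ε) x₀) y := by
    rw [gradient_addQuad ((h𝓕 hf₁.1).1.1.hasLipschitzDeriv.differentiable hp),
      gradient_addQuad ((h𝓕 hf.1.1).1.1.hasLipschitzDeriv.differentiable hp),
      gradient_congr_oracle hp hf.2]
  rw [hgrad]
  exact (h𝓕 hf.1.1).2.extend hL (htrial f hf.1.1 hf.1.2) h2 h1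

/-- Bisection between a value with too long and a value with too short steps. -/
lemma IsSearchBound.solvable_bisection (hb : IsSearchBound p M Δ₀ ε D H ℓ U δ S) (hp : 2 ≤ p)
    (hM : 0 < M) (hΔ : 0 < Δ₀) (hε : 0 < ε) (t : InnerTrace n) (s : ℕ) :
    ∀ lo hi : ℝ, ℓ ≤ lo → lo ≤ hi → hi ≤ U → hi - lo ≤ δ * 2 ^ s →
    Solvable (oracle p) (runClass p M Δ₀ ε x₀ z t j ∩ longClass p M Δ₀ ε x₀ t j lo
      ∩ shortClass p M Δ₀ ε x₀ t j hi) (InnerOutcome p M Δ₀ ε x₀ z (j + 1)) (2 * s) := by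
  induction s with
  | zero =>
    intro lo hi hlo hle hhi hw
    -- The interval has length at most `δ`, so by the gap estimate no function can have led here.
    refine .of_empty ?_
    rintro f ⟨⟨⟨⟨hf, hfz⟩, hrun⟩, y₁, hy₁, hl⟩, y₂, hy₂, hs⟩
    obtain ⟨xs, hxs, hgrow, -⟩ := hf.exists_minimizer hp hΔ hε
    have hg := hasLipschitzDeriv_addQuad hp hf.hasLipschitzDeriv (regParam Δ₀ ε) x₀
    have hconv := convexOn_addQuad hf.convex (regParam_pos hΔ hε).le x₀
    obtain ⟨hyD, huD⟩ := hb.norm_sub_le hp hM hΔ hε hg hconv hxs hgrow (hfz xs) hrun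
    have := hb.gap hp hM hg hconv hxs (hrun.A_nonneg j le_rfl) hyD huD hlo hle hhi hy₁ hy₂ hl hs
    rw [pow_zero, mul_one] at hw
    linarith
  | succ s ih =>
    intro lo hi hlo hle hhi hw
    have hℓ := hb.ℓ_pos
    rw [pow_succ] at hw
    refine solvable_of_trial (L := (lo + hi) / 2) hp hM hΔ hε t (by linarith)
      (fun f hf => hf.1.1) ?_ ?_
    · exact (ih ((lo + hi) / 2) hi (by linarith) (by linarith) hhi (by linarith)).mono
        (fun f hf => ⟨⟨hf.1.1.1, hf.2⟩, hf.1.2⟩) le_rfl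
    · exact fun y hy => (ih lo ((lo + hi) / 2) hlo (by linarith) (by linarith)
        (by linarith)).mono (fun f hf => ⟨hf.1.1, y, hf.2, hy⟩) le_rfl

/-- One iteration of the inner method. -/
lemma IsSearchBound.solvable_step (hb : IsSearchBound p M Δ₀ ε D H ℓ U δ S) (hp : 2 ≤ p)
    (hM : 0 < M) (hΔ : 0 < Δ₀) (hε : 0 < ε) (hε' : ε ≤ 1 / 2) (t : InnerTrace n) :
    Solvable (oracle p) (runClass p M Δ₀ ε x₀ z t j) (InnerOutcome p M Δ₀ ε x₀ z (j + 1))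
      (2 * S + 2) := by
  have hℓ := hb.ℓ_pos
  refine solvable_of_trial (L := ℓ) hp hM hΔ hε t hℓ subset_rfl ?_ ?_
  -- The upper end `U` needs no oracle call: trial steps have length at most `H`, and `2c H^(p-1) <
  -- U` makes each of them short.
  · refine (hb.solvable_bisection hp hM hΔ hε t S ℓ U le_rfl hb.ℓ_lt_U.le le_rfl
      (by linarith [hb.U_le])).mono (fun f hf => ⟨hf, ?_⟩) le_rfl
    obtain ⟨⟨⟨h, hfz⟩, hrun⟩, -⟩ := hf
    have hU : 0 < U := hℓ.trans hb.ℓ_lt_U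
    obtain ⟨y, hy⟩ := h.exists_isTrial hp hM hΔ hε t j hU
    obtain ⟨xs, hxs, hgrow, -⟩ := h.exists_minimizer hp hΔ hε
    have hg := hasLipschitzDeriv_addQuad hp h.hasLipschitzDeriv (regParam Δ₀ ε) x₀
    have hconv := convexOn_addQuad h.convex (regParam_pos hΔ hε).le x₀
    obtain ⟨hyD, huD⟩ := hb.norm_sub_le hp hM hΔ hε hg hconv hxs hgrow (hfz xs) hrun
    have hl : t.trialLength j U y ≤ H := hb.trial_length_le hp hM hg hxs hb.ℓ_lt_U.le
      (norm_extrapolate_sub_le (hrun.A_nonneg j le_rfl) hU hyD huD) hy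
    have hl0 : 0 ≤ t.trialLength j U y := norm_nonneg _
    have hc := stepConst_pos p hM
    refine ⟨y, hy, lt_of_le_of_lt ?_ hb.lt_U⟩
    gcongr
  · refine fun y hy => .of_result (t, some y) fun f hf => .inr ⟨y, rfl, ?_, j,
      Nat.lt_succ_self j, hf.1.2, ℓ, hℓ, hf.2⟩
    exact hb.norm_gradient_le hp hM hΔ hε hε' hf.1.1.1 hf.2 hy

/-- `N` iterations of the inner method. -/
lemma IsSearchBound.solvable_phase (hb : IsSearchBound p M Δ₀ ε D H ℓ U δ S) (hp : 2 ≤ p)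
    (hM : 0 < M) (hΔ : 0 < Δ₀) (hε : 0 < ε) (hε' : ε ≤ 1 / 2) (N : ℕ) :
    Solvable (oracle p) (phaseClass p M Δ₀ ε x₀ z) (InnerOutcome p M Δ₀ ε x₀ z N)
      (N * (2 * S + 2)) := by
  induction N with
  | zero =>
    exact .of_result (⟨0, 0, fun _ => z, fun _ => z⟩, none) fun f hf =>
      .inl ⟨rfl, rfl, rfl, rfl, fun k hk => absurd hk (Nat.not_lt_zero k)⟩
  | succ N ih =>
    rw [Nat.succ_mul]
    refine ih.bind ?_
    rintro ⟨t, _ | y⟩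
    · refine (hb.solvable_step hp hM hΔ hε hε' t (j := N)).mono ?_ le_rfl
      rintro f ⟨hf, ⟨-, hrun⟩ | ⟨y, hy, -⟩⟩
      · exact ⟨hf, hrun⟩
      · cases hy
    · refine .of_result (t, some y) ?_
      rintro f ⟨hf, ⟨hy, -⟩ | ⟨y', hy', hgr, i, hi, h⟩⟩
      · cases hy
      · exact .inr ⟨y', hy', hgr, i, by omega, h⟩

end Search

/-! ### The outer method as an oracle procedure -/

section Outer

variable {p n : ℕ} {M Δ₀ ε D H ℓ U δ : ℝ} {S k K : ℕ} {x₀ : Euc n}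

instance : Inhabited (OuterTrace n) := ⟨⟨0, 0, default, 0⟩⟩

/-- The result `r` records `k` passes through the loop, or an interrupted execution. -/
def OuterOutcome (p : ℕ) (M Δ₀ ε : ℝ) {n : ℕ} (x₀ : Euc n) (k : ℕ) (f : Euc n → ℝ)
    (r : OuterTrace n × Bool) : Prop :=
  (r.2 = false ∧ r.1.phases = k ∧ r.1.IsLoop p M Δ₀ ε x₀ f) ∨
    (r.2 = true ∧ r.1.IsStoppedRun p M Δ₀ ε x₀ f)

/-- The execution of the outer method with a further pass through the loop. -/
def OuterTrace.extend (t : OuterTrace n) (k : ℕ) (s : InnerTrace n) (N : ℕ) : OuterTrace n where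
  phases := k + 1
  z := Function.update t.z (k + 1) (s.y N)
  inner := Function.update t.inner k s
  output := t.output

/-- The execution of the outer method interrupted in the next pass through the loop. -/
def OuterTrace.interrupt (t : OuterTrace n) (k : ℕ) (s : InnerTrace n) (y : Euc n) :
    OuterTrace n where
  phases := k
  z := t.z
  inner := Function.update t.inner k s
  output := y

/-- `K` passes through the loop. -/
lemma IsSearchBound.solvable_loop (hb : IsSearchBound p M Δ₀ ε D H ℓ U δ S) (hp : 2 ≤ p)
    (hM : 0 < M) (hΔ : 0 < Δ₀) (hε : 0 < ε) (hε' : ε ≤ 1 / 2) (K : ℕ)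
    (hK : ∀ k < K, innerTol p M ε ≤ residualBound Δ₀ k) :
    Solvable (oracle p) {f | IsProblem p M Δ₀ x₀ f} (OuterOutcome p M Δ₀ ε x₀ K)
      ((∑ k ∈ Finset.range K, phaseLength p M Δ₀ ε k) * (2 * S + 2)) := by
  induction K with
  | zero =>
    refine .of_result (⟨0, fun _ => x₀, default, 0⟩, false) fun f hf =>
      .inl ⟨rfl, rfl, rfl, ?_, ?_, ?_⟩
    all_goals exact fun k hk => absurd hk (Nat.not_lt_zero k)
  | succ K ih =>
    rw [Finset.sum_range_succ, Nat.add_mul]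
    refine (ih fun k hk => hK k (by omega)).bind ?_
    rintro ⟨t, _ | _⟩
    · by_cases htK : t.phases = K
      swap
      · refine .of_empty ?_
        rintro f ⟨hf, ⟨-, h, -⟩ | ⟨h, -⟩⟩
        · exact htK h
        · cases h
      -- Recording the outcome of a phase costs no oracle calls.
      rw [← add_zero (phaseLength p M Δ₀ ε K * (2 * S + 2))]
      have hloop : ∀ f ∈ {f ∈ {f | IsProblem p M Δ₀ x₀ f} |
          OuterOutcome p M Δ₀ ε x₀ K f (t, false)}, t.IsLoop p M Δ₀ ε x₀ f := by
        rintro f ⟨hf, ⟨-, -, h⟩ | ⟨h, -⟩⟩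
        · exact h
        · cases h
      refine ((hb.solvable_phase hp hM hΔ hε hε' (x₀ := x₀) (z := t.z K)
        (phaseLength p M Δ₀ ε K)).mono (fun f hf => ⟨hf.1, fun x => ?_⟩) le_rfl).bind ?_
      -- By the halving of the residuals `z_K` has residual at most `Δ_K ≤ Δ₀`, so it is an
      -- admissible start.
      · obtain ⟨xs, hxs, hgrow, h0⟩ := hf.1.exists_minimizer hp hΔ hε
        have := (hloop f hf).residual_le hp hM hΔ hε hf.1 hxs hgrow h0 K htK.ge
        have := residualBound_le hΔ K
        have := hxs x
        linarith
      rintro ⟨s, _ | y⟩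
      · refine .of_result (t.extend K s (phaseLength p M Δ₀ ε K), false) ?_
        rintro f ⟨hf, ⟨-, hrun⟩ | ⟨y, hy, -⟩⟩
        swap
        · cases hy
        have hl := hloop f hf
        refine .inl ⟨rfl, rfl, ?_, fun k hk => hK k hk, fun k hk => ?_, fun k hk => ?_⟩
        · simpa [OuterTrace.extend] using hl.z_zero
        · simp only [OuterTrace.extend] at hk ⊢
          rw [Function.update_of_ne hk.ne]
          rcases Nat.lt_succ_iff_lt_or_eq.1 hk with h | rfl
          · rw [Function.update_of_ne h.ne]
            exact hl.phase k (by omega)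
          · rw [Function.update_self]
            exact hrun
        · simp only [OuterTrace.extend] at hk ⊢
          rcases Nat.lt_succ_iff_lt_or_eq.1 hk with h | rfl
          · rw [Function.update_of_ne h.ne, Function.update_of_ne (by omega)]
            exact hl.z_succ k (by omega)
          · rw [Function.update_self, Function.update_self]
      · refine .of_result (t.interrupt K s y, true) ?_
        rintro f ⟨hf, ⟨hy, -⟩ | ⟨y', hy, hgr, i, hi, hrun, htr⟩⟩
        · cases hy
        cases hy
        have hl := hloop f hf
        refine .inr ⟨rfl, ⟨hl.z_zero, fun k hk => hl.continues k (htK ▸ hk), fun k hk => ?_,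
          fun k hk => ?_⟩, hK K (Nat.lt_succ_self K), ⟨i, hi, ?_⟩, hgr⟩
        · simp only [OuterTrace.interrupt] at hk ⊢
          rw [Function.update_of_ne hk.ne]
          exact hl.phase k (htK ▸ hk)
        · simp only [OuterTrace.interrupt] at hk ⊢
          rw [Function.update_of_ne hk.ne]
          exact hl.z_succ k (htK ▸ hk)
        · simp only [OuterTrace.interrupt, Function.update_self]
          exact ⟨hrun, htr⟩
    · refine .of_result (t, true) ?_
      rintro f ⟨hf, ⟨h, -⟩ | ⟨-, h⟩⟩
      · cases h
      · exact .inr ⟨rfl, h⟩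

/-- The outer method. -/
lemma IsSearchBound.solvable_run (hb : IsSearchBound p M Δ₀ ε D H ℓ U δ S) (hp : 2 ≤ p)
    (hM : 0 < M) (hΔ : 0 < Δ₀) (hε : 0 < ε) (hε' : ε ≤ 1 / 2) (K : ℕ)
    (hK : ∀ k < K, innerTol p M ε ≤ residualBound Δ₀ k)
    (hexit : residualBound Δ₀ K < innerTol p M ε) :
    Solvable (oracle p) {f | IsProblem p M Δ₀ x₀ f}
      (fun f (t : OuterTrace n) => t.IsRun p M Δ₀ ε x₀ f ∨ t.IsStoppedRun p M Δ₀ ε x₀ f)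
      ((∑ k ∈ Finset.range K, phaseLength p M Δ₀ ε k) * (2 * S + 2) + 1) := by
  refine (hb.solvable_loop hp hM hΔ hε hε' K hK).bind ?_
  rintro ⟨t, _ | _⟩
  · refine Solvable.ask (m := 0) (t.z K) fun f₀ hf₀ => ?_
    obtain ⟨y, hy⟩ := (hasLipschitzDeriv_addQuad hp hf₀.1.hasLipschitzDeriv (regParam Δ₀ ε)
      x₀).exists_isTensorStep hp hM
      (bddBelow_addQuad hf₀.1.bddBelow (regParam_pos hΔ hε).le _) (t.z K)
    refine .of_result { t with output := y } ?_
    rintro f ⟨⟨hf, ⟨-, rfl, hl⟩ | ⟨h, -⟩⟩, hor⟩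
    · refine .inl ⟨⟨hl.z_zero, hl.continues, hl.phase, hl.z_succ⟩, hexit, ?_⟩
      exact isTensorStep_addQuad_congr_oracle hp hf.hasLipschitzDeriv
        hf₀.1.hasLipschitzDeriv hor hy
    · cases h
  · refine .of_result t ?_
    rintro f ⟨hf, ⟨h, -⟩ | ⟨-, h⟩⟩
    · cases h
    · exact .inr h

lemma exists_residualBound_lt {p : ℕ} {M ε : ℝ} (h : 0 < innerTol p M ε) (Δ₀ : ℝ) :
    ∃ K, residualBound Δ₀ K < innerTol p M ε ∧
      ∀ k < K, innerTol p M ε ≤ residualBound Δ₀ k := by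
  classical
  have hex : ∃ K, residualBound Δ₀ K < innerTol p M ε := by
    have h2 : Filter.Tendsto (residualBound Δ₀) Filter.atTop (nhds 0) :=
      tendsto_const_nhds.div_atTop (tendsto_pow_atTop_atTop_of_one_lt one_lt_two)
    exact (h2.eventually_lt_const h).exists
  exact ⟨Nat.find hex, Nat.find_spec hex, fun k hk => not_lt.1 (Nat.find_min hex hk)⟩

/-- The main term decreases in `ε`, so its value at 1 is a lower bound. It serves to absorb additive
constants into the complexity bound. -/
lemma exists_mainTerm_ge (p : ℕ) {M Δ₀ : ℝ} (hM : 0 < M) (hΔ : 0 < Δ₀) :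
    ∃ b : ℝ, 0 < b ∧ ∀ ε, 0 < ε → ε ≤ 1 / 2 → b ≤ mainTerm p M Δ₀ ε := by
  refine ⟨mainTerm p M Δ₀ 1, mainTerm_pos hM hΔ one_pos, fun ε hε hε' => ?_⟩
  unfold mainTerm
  have : ε ^ (2 * ((p : ℝ) + 1) / (3 * (p : ℝ) + 1))
      ≤ 1 ^ (2 * ((p : ℝ) + 1) / (3 * (p : ℝ) + 1)) :=
    Real.rpow_le_rpow hε.le (by linarith) (by positivity)
  gcongr

/-- The number of oracle calls of the outer method. -/
lemma exists_calls_le (hp : 2 ≤ p) {M Δ₀ : ℝ} (hM : 0 < M) (hΔ : 0 < Δ₀) :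
    ∃ C : ℝ, 0 < C ∧ ∀ ε, 0 < ε → ε ≤ 1 / 2 → ∀ (n : ℕ) (x₀ : Euc n), ∃ m : ℕ,
      (m : ℝ) ≤ C * Real.log (1 / ε) * iterationBound p M Δ₀ ε ∧
      Solvable (oracle p) {f | IsProblem p M Δ₀ x₀ f}
        (fun f (t : OuterTrace n) => t.IsRun p M Δ₀ ε x₀ f ∨ t.IsStoppedRun p M Δ₀ ε x₀ f) m := by
  obtain ⟨C₁, hC₁, hsum⟩ := exists_sum_phaseLength_le hp
  obtain ⟨C₂, hC₂, hsearch⟩ := exists_isSearchBound hp hM hΔ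
  obtain ⟨b, hb0, hb⟩ := exists_mainTerm_ge p hM hΔ
  have hl2 : 0 < Real.log 2 := Real.log_pos (by norm_num)
  -- The count is `C₁ B (2 C₂ Λ + 2) + 1`. The 2 is absorbed by `Λ ≥ log 2`, and the final 1, the
  -- call for the last tensor step, by `Λ B ≥ b log 2`.
  refine ⟨C₁ * (2 * C₂ + 2 / Real.log 2) + 1 / (b * Real.log 2), by positivity,
    fun ε hε hε' n x₀ => ?_⟩
  obtain ⟨D, H, ℓ, U, δ, S, hB, hS⟩ := hsearch ε hε hε'
  obtain ⟨K, hexit, hK⟩ := exists_residualBound_lt (innerTol_pos hp hM hε) Δ₀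
  refine ⟨_, ?_, hB.solvable_run hp hM hΔ hε hε' K hK hexit⟩
  have hs := hsum M Δ₀ ε hM hΔ hε K hK
  have hln := log_two_le_log_one_div hε hε'
  have hbB := (hb ε hε hε').trans mainTerm_le_iterationBound
  set B := iterationBound p M Δ₀ ε
  set Λ := Real.log (1 / ε)
  have h1 : 1 ≤ 1 / Real.log 2 * Λ := by
    rw [one_div, inv_mul_eq_div, le_div_iff₀ hl2]; linarith
  have h2 : 1 ≤ 1 / b * B := by
    rw [one_div, inv_mul_eq_div, le_div_iff₀ hb0]; linarith
  have h3 : 1 ≤ 1 / (b * Real.log 2) * Λ * B := by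
    have := one_le_mul_of_one_le_of_one_le h1 h2
    calc 1 ≤ 1 / Real.log 2 * Λ * (1 / b * B) := this
      _ = _ := by field_simp
  have hB0 : 0 < B := hb0.trans_le hbB
  push_cast at hs ⊢
  calc (∑ k ∈ Finset.range K, (phaseLength p M Δ₀ ε k : ℝ)) * (2 * S + 2) + 1
      ≤ C₁ * B * (2 * (C₂ * Λ) + 2 * (1 / Real.log 2 * Λ)) + 1 / (b * Real.log 2) * Λ * B := by
        gcongr
        linarith
    _ = _ := by ring

end Outer

theorem mainTheorem1 (p : ℕ) (hp : 2 ≤ p) :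
    (∃ C : ℝ, 0 < C ∧
      ∀ (M Δ₀ ε : ℝ), 0 < M → 0 < Δ₀ → 0 < ε →
      ∀ (n : ℕ) (x₀ : Euc n) (f : Euc n → ℝ), IsProblem p M Δ₀ x₀ f →
      ∀ t : OuterTrace n, t.IsRun p M Δ₀ ε x₀ f →
        ‖gradient f t.output‖ ≤ ε ∧
        (t.iterations p M Δ₀ ε : ℝ) ≤ C * iterationBound p M Δ₀ ε) ∧
    (∀ (M Δ₀ : ℝ), 0 < M → 0 < Δ₀ → ∃ C : ℝ, 0 < C ∧
      ∀ ε : ℝ, 0 < ε → ε ≤ 1 / 2 →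
      ∀ (n : ℕ) (x₀ : Euc n), ∃ P : OracleProgram (Euc n) (Jet p n) (OuterTrace n),
      ∀ f : Euc n → ℝ, IsProblem p M Δ₀ x₀ f →
        ((P.result (oracle p f)).IsRun p M Δ₀ ε x₀ f ∨
          (P.result (oracle p f)).IsStoppedRun p M Δ₀ ε x₀ f) ∧
        ‖gradient f (P.result (oracle p f)).output‖ ≤ ε ∧
        (P.calls (oracle p f) : ℝ)
          ≤ C * Real.log (1 / ε) * iterationBound p M Δ₀ ε) := by
  refine ⟨?_, fun M Δ₀ hM hΔ => ?_⟩
  · obtain ⟨C, hC, h⟩ := exists_sum_phaseLength_le hp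
    exact ⟨C, hC, fun M Δ₀ ε hM hΔ hε n x₀ f hf t ht =>
      ⟨ht.norm_gradient_output_le hp hM hΔ hε hf, h M Δ₀ ε hM hΔ hε _ ht.loop.continues⟩⟩
  · obtain ⟨C, hC, h⟩ := exists_calls_le hp hM hΔ
    refine ⟨C, hC, fun ε hε hε' n x₀ => ?_⟩
    obtain ⟨m, hm, P, hP⟩ := h ε hε hε' n x₀
    refine ⟨P, fun f hf => ⟨(hP f hf).1, ?_, (Nat.cast_le.2 (hP f hf).2).trans hm⟩⟩
    rcases (hP f hf).1 with hr | hr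
    · exact hr.norm_gradient_output_le hp hM hΔ hε hf
    · exact hr.small
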